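/- **Setting.** Let $N\ge 2$ and $L\ge 0$ be integers, $\varepsilon=1$ for odd $N$ and $\varepsilon=-1$ for even $N$, and fix a square root $\varepsilon^{1/2}$. Let $t_1^{1/2},\dots,t_L^{1/2}$ and $\alpha_1,\dots,\alpha_L$ be arbitrary nonzero complex numbers (the inhomogeneities; for the $\tau_2$-model with rapidities $p_i$ one has $t_i=x_{p_i}y_{p_i}$ and $\alpha_i=x_{p_i}^{1/2}y_{p_i}^{-1/2}$). For $q=(q^{1/2})^2\neq 0$, $q^2\ne1$, put $[n]=\frac{q^n-q^{-n}}{q-q^{-1}}$, $[n]!=[n]\cdots[1]$. On $\mathbb C^N$ with basis $v_0,\dots,v_{N-1}$ (and $v_{-1}=v_N=0$) let $$k^{1/2}v_\sigma=\varepsilon^{1/2}q^{\frac{N-1}2-\sigma}v_\sigma,\quad e v_\sigma=\varepsilon\alpha[N-\sigma]v_{\sigma-1},\quad f v_\sigma=\alpha^{-1}[\sigma+1]v_{\sigma+1},\quad hv_\sigma=(N-1-2\sigma)v_\sigma,$$ with $\alpha=\alpha_i$ for the $i$th factor of $(\mathbb C^N)^{\otimes L}$; a subscript $i$ denotes the action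 on the $i$th factor. Let $$\tilde{\mathcal L}_i(z)=\begin{pmatrix}q^{-1/2}(z k_i^{1/2}-z^{-1}k_i^{-1/2})&(q-q^{-1})f_i\\(q-q^{-1})e_i&q^{1/2}(zk_i^{-1/2}-z^{-1}k_i^{1/2})\end{pmatrix},$$ $$\tilde{\mathcal T}(z)=\tilde{\mathcal L}_1(t_1^{1/2}zq^{1/2})\cdots\tilde{\mathcal L}_L(t_L^{1/2}zq^{1/2})=\begin{pmatrix}\tilde A(z)&\tilde B(z)\\\tilde C(z)&\tilde D(z)\end{pmatrix},\qquad \tilde\tau(z)=\tilde A(z)+\tilde D(z).$$ Put $m(z)=\prod_{i}(t_i^{1/2}zq^{1/2}-t_i^{-1/2}z^{-1}q^{-1/2})$, $n_\pm(z)=\pm z^{\mp1}(q-q^{-1})$, $A=(k^{1/2})^{\otimes L}$, $$B_\pm=\sum_{i=1}^Lq^{\frac{L+1}2-i}\,t_i^{\mp\frac12}q^{\mp\frac12}\,(k^{\pm\frac12})^{\otimes(i-1)}\otimes f\otimes(k^{\mp\frac12})^{\otimes(L-i)},$$ $$C_\pm=\sum_{i=1}^Lq^{-\frac{L+1}2+i}\,t_i^{\mp\frac12}q^{\mp\frac12}\,(k^{\mp\frac12})^{\otimes(i-1)}\otimes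 e\otimes(k^{\pm\frac12})^{\otimes(L-i)},$$ and $H^{(N)}=\frac1N\sum_{i}h_i$. Let $L(\mathfrak{sl}_2)=\mathbb C[t,t^{-1}]\otimes\mathfrak{sl}_2$ with $x_n^+=t^n\otimes E$, $x_n^-=t^n\otimes F$, $h_n=t^n\otimes\mathrm{diag}(1,-1)$; let $\mathfrak b_+$ be the Lie subalgebra generated by $h_n,x_n^+,x_m^-$ and $\mathfrak b_-$ the one generated by $h_{-n},x_{-m}^+,x_{-n}^-$ ($n\ge0$, $m>0$). Finally let $q_0=(q_0^{1/2})^2$ be a primitive $N$th root of unity if $N$ is odd and a primitive $2N$th root of unity if $N$ is even (so $\varepsilon q_0^N=1$). **Proposition.** 1. For every $q\ne0$ with $q^2\neq1$: $\tilde A(z)/(m(z)q^{-L/2})\to A$ as $z\to\infty$, $\tilde D(z)/(m(z)q^{L/2})\to A$ as $z\to0$, and $\tilde B(z)/(m(z)n_\pm(z))\to B_\pm$, $\tilde C(z)/(m(z)n_\pm(z))\to C_\pm$ as $z^{\pm1}\to\infty$. Moreover $k_0\mapsto A^{-2}$, $k_1\mapsto A^2$, $e_0\mapsto B_+$, $e_1\mapsto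 C_+$, $f_0\mapsto C_-$, $f_1\mapsto B_-$ defines a representation of $U_q'(\widehat{\mathfrak{sl}}_2)$ on $(\mathbb C^N)^{\otimes L}$. 2. The limits $B_\pm^{(N)}=\lim (B_\pm)^N/[N]!$ and $C_\pm^{(N)}=\lim (C_\pm)^N/[N]!$, as $q^{1/2}\to q_0^{1/2}$ with $q^{1/2}\ne q_0^{1/2}$, exist. 3. There is a unique Lie algebra homomorphism $\varphi_+:\mathfrak b_+\to\mathrm{End}((\mathbb C^N)^{\otimes L})$ with $\varphi_+(h_0)=H^{(N)}$, $\varphi_+(x_0^+)=C_+^{(N)}$, $\varphi_+(x_1^-)=B_+^{(N)}$, and a unique Lie algebra homomorphism $\varphi_-:\mathfrak b_-\to\mathrm{End}((\mathbb C^N)^{\otimes L})$ with $\varphi_-(h_0)=H^{(N)}$, $\varphi_-(x_{-1}^+)=C_-^{(N)}$, $\varphi_-(x_0^-)=B_-^{(N)}$. 4. At $q=q_0$, let $W_\pm$ be the sector $A^2=q^{\pm L}$, that is, the eigenspace of $A^2$ with eigenvalue $q^{\pm L}$. Then $W_\pm$ is preserved by $\varphi_\pm(\mathfrak b_\pm)$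 and by $\tilde\tau(z)$ for all $z\neq0$. If $\tilde\tau(1)$ is invertible on $W_\pm$, then for all $z\ne0$ $$[\tilde\tau(1)^{-1}\tilde\tau(z),\varphi_\pm(x)]=0\ \text{ on } W_\pm\quad\text{for all }x\in\mathfrak b_\pm .$$ Here $\tilde\tau(1)^{-1}$ may be any operator $R$ on $(\mathbb C^N)^{\otimes L}$ with $R\,\tilde\tau(1)v=v$ for all $v\in W_\pm$. -/

import Mathlib

open Filter Topology
open scoped TensorProduct Matrix

attribute [local instance] LieRing.ofAssociativeRing

noncomputable section

/-! ### The chain of `L` spins with `N` states -/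

/-- The spin configurations `σ = (σ₁, …, σ_L)`, `0 ≤ σᵢ ≤ N - 1`; they label the standard basis
`v_{σ₁} ⊗ ⋯ ⊗ v_{σ_L}` of `(ℂ^N)^{⊗L}`. -/
abbrev Config (N L : ℕ) := Fin L → Fin N

/-- Linear operators on `(ℂ^N)^{⊗L}`, as matrices in the standard basis. -/
abbrev Op (N L : ℕ) := Matrix (Config N L) (Config N L) ℂ

/-- The tensor product operator `X₁ ⊗ ⋯ ⊗ X_L`. -/
def tensorOp {N L : ℕ} (X : Fin L → Matrix (Fin N) (Fin N) ℂ) : Op N L :=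
  Matrix.of fun ρ σ => ∏ i, X i (ρ i) (σ i)

/-- The operator acting as `X` on the `i`th tensor factor and as the identity on the others. -/
def siteOp {N L : ℕ} (i : Fin L) (X : Matrix (Fin N) (Fin N) ℂ) : Op N L :=
  tensorOp (Function.update (fun _ => 1) i X)

/-! ### The `N`-dimensional representation of `U_q(sl₂)`

The parameter `s` is a square root `q^{1/2}` of `q`, so that `q = s ^ 2`, and `c` is a square root
`ε^{1/2}` of the sign `ε`. -/

/-- The sign `ε`: `1` for odd `N` and `-1` for even `N`. -/
def epsSign (N : ℕ) : ℂ := if Odd N then 1 else -1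

/-- The `q`-integer `[n] = (q^n - q^{-n}) / (q - q⁻¹)`. -/
def qInt (q : ℂ) (n : ℤ) : ℂ := (q ^ n - q ^ (-n)) / (q - q⁻¹)

/-- The `q`-factorial `[n]! = [n][n-1]⋯[1]`. -/
def qFactorial (q : ℂ) (n : ℕ) : ℂ := ∏ j ∈ Finset.range n, qInt q ((j : ℤ) + 1)

/-- The power `k^{m/2}` of `k^{1/2} v_σ = ε^{1/2} q^{(N-1-2σ)/2} v_σ`
(so `k v_σ = ε q^{N-1-2σ} v_σ`). -/
def kHalf (N : ℕ) (s c : ℂ) (m : ℤ) : Matrix (Fin N) (Fin N) ℂ :=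
  Matrix.diagonal fun σ => (c * s ^ ((N : ℤ) - 1 - 2 * (σ : ℕ))) ^ m

/-- `e v_σ = ε α [N - σ] v_{σ-1}`, with `e v_0 = 0`. -/
def eMat (N : ℕ) (s α : ℂ) : Matrix (Fin N) (Fin N) ℂ :=
  Matrix.of fun ρ σ =>
    if (ρ : ℕ) + 1 = (σ : ℕ) then epsSign N * α * qInt (s ^ 2) ((N : ℤ) - (σ : ℕ)) else 0

/-- `f v_σ = α⁻¹ [σ + 1] v_{σ+1}`, with `f v_{N-1} = 0`. -/
def fMat (N : ℕ) (s α : ℂ) : Matrix (Fin N) (Fin N) ℂ :=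
  Matrix.of fun ρ σ =>
    if (ρ : ℕ) = (σ : ℕ) + 1 then α⁻¹ * qInt (s ^ 2) ((σ : ℕ) + 1) else 0

/-- `h v_σ = (N - 1 - 2σ) v_σ`. -/
def hMat (N : ℕ) : Matrix (Fin N) (Fin N) ℂ :=
  Matrix.diagonal fun σ => (N : ℂ) - 1 - 2 * ((σ : ℕ) : ℂ)

/-! ### Monodromy and transfer matrices

`u i` is the square root `t_{p_i}^{1/2}` of the inhomogeneity `t_{p_i} = x_{p_i} y_{p_i}`, and
`α i` is the normalization of `e` and `f` at the site `i`
(for the `τ₂`-model, `α i = x_{p_i}^{1/2} y_{p_i}^{-1/2}`). -/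

/-- The `L`-operator at the site `i`, a `2 × 2` matrix of operators. -/
def lOp (N : ℕ) {L : ℕ} (s c : ℂ) (α : Fin L → ℂ) (i : Fin L) (z : ℂ) :
    Matrix (Fin 2) (Fin 2) (Op N L) :=
  !![s⁻¹ • siteOp i (z • kHalf N s c 1 - z⁻¹ • kHalf N s c (-1)),
      (s ^ 2 - (s ^ 2)⁻¹) • siteOp i (fMat N s (α i));
    (s ^ 2 - (s ^ 2)⁻¹) • siteOp i (eMat N s (α i)),
      s • siteOp i (z • kHalf N s c (-1) - z⁻¹ • kHalf N s c 1)]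

/-- The monodromy matrix, the ordered product over `i = 1, …, L` of the `L`-operators at
`t_{p_i}^{1/2} z q^{1/2}`. Its entries are `A(z), B(z); C(z), D(z)`. -/
def monodromy (N : ℕ) {L : ℕ} (s c : ℂ) (u α : Fin L → ℂ) (z : ℂ) :
    Matrix (Fin 2) (Fin 2) (Op N L) :=
  (List.ofFn fun i : Fin L => lOp N s c α i (u i * z * s)).prod

/-- The transfer matrix, the trace of the monodromy matrix over the auxiliary space `ℂ²`. -/
def transfer (N : ℕ) {L : ℕ} (s c : ℂ) (u α : Fin L → ℂ) (z : ℂ) : Op N L :=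
  (monodromy N s c u α z).trace

/-- `m(z) = ∏ᵢ (t_{p_i}^{1/2} z q^{1/2} - t_{p_i}^{-1/2} z⁻¹ q^{-1/2})`. -/
def mFactor {L : ℕ} (s : ℂ) (u : Fin L → ℂ) (z : ℂ) : ℂ :=
  ∏ i, (u i * z * s - (u i * z * s)⁻¹)

/-- `n_±(z) = ± z^{∓1} (q - q⁻¹)`, with `d = ±1` for the sign. -/
def nFactor (s : ℂ) (d : ℤ) (z : ℂ) : ℂ := (d : ℂ) * z ^ (-d) * (s ^ 2 - (s ^ 2)⁻¹)

/-- `A = k^{1/2} ⊗ ⋯ ⊗ k^{1/2}`. -/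
def aOp (N L : ℕ) (s c : ℂ) : Op N L := tensorOp fun _ => kHalf N s c 1

/-- `B_±`, with `d = ±1` for the sign: the sum over `i = 1, …, L` of
`q^{(L+1)/2-i} t_{p_i}^{∓1/2} q^{∓1/2} (k^{±1/2})^{⊗(i-1)} ⊗ f ⊗ (k^{∓1/2})^{⊗(L-i)}`.
(The index `i` below starts from `0`.) -/
def bOp (N : ℕ) {L : ℕ} (s c : ℂ) (u α : Fin L → ℂ) (d : ℤ) : Op N L :=
  ∑ i : Fin L, (s ^ ((L : ℤ) + 1 - 2 * ((i : ℕ) + 1)) * (u i * s) ^ (-d)) •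
    tensorOp fun j =>
      if j < i then kHalf N s c d else if j = i then fMat N s (α i) else kHalf N s c (-d)

/-- `C_±`, with `d = ±1` for the sign: the sum over `i = 1, …, L` of
`q^{-(L+1)/2+i} t_{p_i}^{∓1/2} q^{∓1/2} (k^{∓1/2})^{⊗(i-1)} ⊗ e ⊗ (k^{±1/2})^{⊗(L-i)}`.
(The index `i` below starts from `0`.) -/
def cOp (N : ℕ) {L : ℕ} (s c : ℂ) (u α : Fin L → ℂ) (d : ℤ) : Op N L :=
  ∑ i : Fin L, (s ^ (-((L : ℤ) + 1) + 2 * ((i : ℕ) + 1)) * (u i * s) ^ (-d)) •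
    tensorOp fun j =>
      if j < i then kHalf N s c (-d) else if j = i then eMat N s (α i) else kHalf N s c d

/-- `H^{(N)} = (1/N) ∑ᵢ id ⊗ ⋯ ⊗ h ⊗ ⋯ ⊗ id`. -/
def hOp (N L : ℕ) : Op N L := (N : ℂ)⁻¹ • ∑ i : Fin L, siteOp i (hMat N)

/-- `X` is the divided power `lim X(q)^N / [N]!`, for `q = s ^ 2` tending to `q₀ = s₀ ^ 2`
through values different from `q₀`. -/
def IsDividedPowerLimit {N L : ℕ} (s₀ : ℂ) (Xq : ℂ → Op N L) (X : Op N L) : Prop :=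
  Tendsto (fun s : ℂ => (qFactorial (s ^ 2) N)⁻¹ • Xq s ^ N) (𝓝[≠] s₀) (𝓝 X)

/-! ### The quantum affine algebra `U_q'(ŝl₂)` -/

/-- The Chevalley generators of `U_q'(ŝl₂)`; `kinv i` is the inverse of `k i`. -/
inductive AffGen
  | e (i : Fin 2)
  | f (i : Fin 2)
  | k (i : Fin 2)
  | kinv (i : Fin 2)

/-- The generator, in the free algebra. -/
def AffGen.free (g : AffGen) : FreeAlgebra ℂ AffGen := FreeAlgebra.ι ℂ g

/-- The defining relations of `U_q'(ŝl₂)`, whose Cartan matrix has diagonal entries `2` and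
off-diagonal entries `-2`. -/
inductive AffRel (q : ℂ) : FreeAlgebra ℂ AffGen → FreeAlgebra ℂ AffGen → Prop
  | k_kinv (i : Fin 2) : AffRel q ((AffGen.k i).free * (AffGen.kinv i).free) 1
  | kinv_k (i : Fin 2) : AffRel q ((AffGen.kinv i).free * (AffGen.k i).free) 1
  | k_k (i j : Fin 2) :
      AffRel q ((AffGen.k i).free * (AffGen.k j).free) ((AffGen.k j).free * (AffGen.k i).free)
  | k_e (i j : Fin 2) :
      AffRel q ((AffGen.k i).free * (AffGen.e j).free * (AffGen.kinv i).free)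
        (q ^ (if i = j then 2 else -2 : ℤ) • (AffGen.e j).free)
  | k_f (i j : Fin 2) :
      AffRel q ((AffGen.k i).free * (AffGen.f j).free * (AffGen.kinv i).free)
        (q ^ (if i = j then -2 else 2 : ℤ) • (AffGen.f j).free)
  | e_f (i j : Fin 2) :
      AffRel q ((AffGen.e i).free * (AffGen.f j).free - (AffGen.f j).free * (AffGen.e i).free)
        (if i = j then (q - q⁻¹)⁻¹ • ((AffGen.k i).free - (AffGen.kinv i).free) else 0)
  | serre_e (i j : Fin 2) (hij : i ≠ j) :
      AffRel q
        ((AffGen.e i).free ^ 3 * (AffGen.e j).free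
          - qInt q 3 • ((AffGen.e i).free ^ 2 * (AffGen.e j).free * (AffGen.e i).free)
          + qInt q 3 • ((AffGen.e i).free * (AffGen.e j).free * (AffGen.e i).free ^ 2)
          - (AffGen.e j).free * (AffGen.e i).free ^ 3) 0
  | serre_f (i j : Fin 2) (hij : i ≠ j) :
      AffRel q
        ((AffGen.f i).free ^ 3 * (AffGen.f j).free
          - qInt q 3 • ((AffGen.f i).free ^ 2 * (AffGen.f j).free * (AffGen.f i).free)
          + qInt q 3 • ((AffGen.f i).free * (AffGen.f j).free * (AffGen.f i).free ^ 2)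
          - (AffGen.f j).free * (AffGen.f i).free ^ 3) 0

/-- The algebra `U_q'(ŝl₂)`. -/
abbrev UqAffine (q : ℂ) := RingQuot (AffRel q)

/-- The class of a Chevalley generator in `U_q'(ŝl₂)`. -/
def UqAffine.gen (q : ℂ) (g : AffGen) : UqAffine q := RingQuot.mkAlgHom ℂ (AffRel q) g.free

/-! ### The loop algebra `L(sl₂)` and its Borel subalgebras -/

/-- The Lie algebra `sl₂(ℂ)` of traceless `2 × 2` matrices. -/
abbrev Sl2C := LieAlgebra.SpecialLinear.sl (Fin 2) ℂ

/-- The loop algebra `L(sl₂) = ℂ[t, t⁻¹] ⊗ sl₂`. -/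
abbrev LoopSl2 := LieAlgebra.loopAlgebra ℂ ℤ Sl2C

/-- The Drinfeld generator `x_n^+ = t^n ⊗ E`. -/
def xPlus (n : ℤ) : LoopSl2 :=
  AddMonoidAlgebra.single n (1 : ℂ) ⊗ₜ[ℂ]
    (LieAlgebra.SpecialLinear.single (0 : Fin 2) 1 (by decide) (1 : ℂ) : Sl2C)

/-- The Drinfeld generator `x_n^- = t^n ⊗ F`. -/
def xMinus (n : ℤ) : LoopSl2 :=
  AddMonoidAlgebra.single n (1 : ℂ) ⊗ₜ[ℂ]
    (LieAlgebra.SpecialLinear.single (1 : Fin 2) 0 (by decide) (1 : ℂ) : Sl2C)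

/-- The Drinfeld generator `h_n = t^n ⊗ diag(1, -1)`. -/
def hLoop (n : ℤ) : LoopSl2 :=
  AddMonoidAlgebra.single n (1 : ℂ) ⊗ₜ[ℂ]
    (LieAlgebra.SpecialLinear.singleSubSingle (0 : Fin 2) 1 (1 : ℂ) : Sl2C)

/-- The generators `h_n, x_n^+, x_m^-` (`n ≥ 0`, `m > 0`) of `b₊`. -/
def borelPlusGens : Set LoopSl2 :=
  {x | (∃ n : ℤ, 0 ≤ n ∧ (x = hLoop n ∨ x = xPlus n)) ∨ ∃ m : ℤ, 0 < m ∧ x = xMinus m}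

/-- The generators `h_{-n}, x_{-m}^+, x_{-n}^-` (`n ≥ 0`, `m > 0`) of `b₋`. -/
def borelMinusGens : Set LoopSl2 :=
  {x | (∃ n : ℤ, 0 ≤ n ∧ (x = hLoop (-n) ∨ x = xMinus (-n))) ∨
    ∃ m : ℤ, 0 < m ∧ x = xPlus (-m)}

/-- The Borel subalgebra `b₊`. -/
def borelPlus : LieSubalgebra ℂ LoopSl2 := LieSubalgebra.lieSpan ℂ LoopSl2 borelPlusGens

/-- The Borel subalgebra `b₋`. -/
def borelMinus : LieSubalgebra ℂ LoopSl2 := LieSubalgebra.lieSpan ℂ LoopSl2 borelMinusGens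

theorem hLoop_mem_borelPlus : hLoop 0 ∈ borelPlus :=
  LieSubalgebra.subset_lieSpan (Or.inl ⟨0, le_rfl, Or.inl rfl⟩)

theorem xPlus_mem_borelPlus : xPlus 0 ∈ borelPlus :=
  LieSubalgebra.subset_lieSpan (Or.inl ⟨0, le_rfl, Or.inr rfl⟩)

theorem xMinus_mem_borelPlus : xMinus 1 ∈ borelPlus :=
  LieSubalgebra.subset_lieSpan (Or.inr ⟨1, one_pos, rfl⟩)

theorem hLoop_mem_borelMinus : hLoop 0 ∈ borelMinus :=
  LieSubalgebra.subset_lieSpan (Or.inl ⟨0, le_rfl, Or.inl rfl⟩)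

theorem xPlus_mem_borelMinus : xPlus (-1) ∈ borelMinus :=
  LieSubalgebra.subset_lieSpan (Or.inr ⟨1, one_pos, rfl⟩)

theorem xMinus_mem_borelMinus : xMinus 0 ∈ borelMinus :=
  LieSubalgebra.subset_lieSpan (Or.inl ⟨0, le_rfl, Or.inr rfl⟩)

/-- `φ` extends `h_0 ↦ H`, `x_0^+ ↦ C`, `x_1^- ↦ B` to a representation of `b₊`. -/
def ExtendsPlus {N L : ℕ} (φ : borelPlus →ₗ⁅ℂ⁆ Op N L) (H C B : Op N L) : Prop :=
  φ ⟨hLoop 0, hLoop_mem_borelPlus⟩ = H ∧ φ ⟨xPlus 0, xPlus_mem_borelPlus⟩ = C ∧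
    φ ⟨xMinus 1, xMinus_mem_borelPlus⟩ = B

/-- `φ` extends `h_0 ↦ H`, `x_{-1}^+ ↦ C`, `x_0^- ↦ B` to a representation of `b₋`. -/
def ExtendsMinus {N L : ℕ} (φ : borelMinus →ₗ⁅ℂ⁆ Op N L) (H C B : Op N L) : Prop :=
  φ ⟨hLoop 0, hLoop_mem_borelMinus⟩ = H ∧ φ ⟨xPlus (-1), xPlus_mem_borelMinus⟩ = C ∧
    φ ⟨xMinus 0, xMinus_mem_borelMinus⟩ = B

/-! ### Sectors -/

/-- The sector with `A² = μ`: the eigenspace of `A²` with eigenvalue `μ`. -/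
def sector (N L : ℕ) (s c μ : ℂ) : Submodule ℂ (Config N L → ℂ) :=
  Module.End.eigenspace (Matrix.mulVecLin (aOp N L s c ^ 2)) μ

/-- The operator `X` maps the subspace `W` to itself. -/
def Preserves {N L : ℕ} (W : Submodule ℂ (Config N L → ℂ)) (X : Op N L) : Prop :=
  ∀ v ∈ W, X *ᵥ v ∈ W

/-- `R` inverts `T` on the subspace `W`: `R T v = v` for all `v ∈ W`. (For finite-dimensional `W`
preserved by `T` it follows that `T` is invertible on `W` and that `R` agrees there with the
inverse; if `T` is invertible, `R = T⁻¹` is such an operator.) -/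
def InvertsOn {N L : ℕ} (W : Submodule ℂ (Config N L → ℂ)) (R T : Op N L) : Prop :=
  ∀ v ∈ W, R *ᵥ (T *ᵥ v) = v

/-- `[X, Y] = 0` on the subspace `W`. -/
def CommuteOn {N L : ℕ} (W : Submodule ℂ (Config N L → ℂ)) (X Y : Op N L) : Prop :=
  ∀ v ∈ W, ⁅X, Y⁆ *ᵥ v = 0

end

/-! The monodromy matrix is a product of `L`-operators, and its entries satisfy intertwining
relations (`ChainRel`) with the lowering operator `F` of the chain and its group-like elements `K`,
`K'`. These relations are checked at one site and pass to the chain because they are stable under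
the coproduct (`ChainRel.mul`). After division by a scalar and a diagonal gauge transformation, each
`L`-operator tends to a triangular matrix, so the limit of the product is an iterated coproduct;
this gives `A` and `B_+`. Two symmetries, `flip` (inverting `q` and the spectral parameter) and
`swap` (exchanging raising and lowering), give the other limits. The mixed affine commutators follow
by letting the spectral parameter tend to zero in the intertwining relations; the Serre relations
follow from the coproduct (`qSerre_add`).

At the root of unity, the divided powers converge because the `q`-binomial theorem `divPow_add`
expands them into divided powers at single sites, where `F ^ N = 0`. The Serre relations of the
limits come from a higher order `q`-Serre relation (`sum_divPow_eq_zero`). Its coefficients are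
signed `q`-binomials that vanish at `q₀` unless `N` divides the summation index, so four terms
survive and form the ordinary relation `⁅Y, ⁅Y, ⁅Y, Z⁆⁆⁆ = 0` (`serre_of_tendsto_divPow`). The two
ordinary Serre relations and the weights under `H` already imply all relations of a Borel subalgebra
(`loopLevel`), which gives the homomorphisms; uniqueness holds because three elements generate.

For the transfer matrix, `trace_mul_divPow` moves the divided power past `a + d` at generic `q`. In
the limit `q ^ N = q ^ (-N)` is a sign, so the transfer matrix commutes with the limit up to that
sign and a multiple of `K - K'`. The sector is exactly the subspace where `K = K'`, and the sign
cancels in the product of the inverse at `1` with the transfer matrix at `z`. -/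

section LoopRelations

/-! ### Half of the loop relations, derived from the Serre relations. -/

variable {K 𝔤 : Type*} [Field K] [LieRing 𝔤] [LieAlgebra K 𝔤]

variable (K) in
/-- The elements `E_n` obtained from `e` by repeated application of `½ ad [e, f]`. -/
def loopE (e f : 𝔤) : ℕ → 𝔤
  | 0 => e
  | n + 1 => (2⁻¹ : K) • ⁅⁅e, f⁆, loopE e f n⁆

variable (K) in
/-- The elements `F_{n+1}` obtained from `F_1 = f` by repeated application of `-½ ad [e, f]`. -/
def loopF (e f : 𝔤) : ℕ → 𝔤
  | 0 => f
  | n + 1 => -((2⁻¹ : K) • ⁅⁅e, f⁆, loopF e f n⁆)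

variable (K) in
/-- The elements `H_{n+1} = [e, F_{n+1}]`. -/
def loopH (e f : 𝔤) (n : ℕ) : 𝔤 := ⁅e, loopF K e f n⁆

variable (K) in
theorem lie_lie_loopE [CharZero K] (e f : 𝔤) (n : ℕ) :
    ⁅⁅e, f⁆, loopE K e f n⁆ = (2 : K) • loopE K e f (n + 1) := by
  simp [loopE, smul_smul]

variable (K) in
theorem lie_lie_loopF [CharZero K] (e f : 𝔤) (n : ℕ) :
    ⁅⁅e, f⁆, loopF K e f n⁆ = -((2 : K) • loopF K e f (n + 1)) := by
  simp [loopF, smul_smul]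

/-- The relations between `H_{m+1}` and the other elements. -/
structure LoopLevel (K : Type*) [Field K] [LieAlgebra K 𝔤] (e f : 𝔤) (m : ℕ) : Prop where
  lie_EF : ∀ i j, i + j = m → ⁅loopE K e f i, loopF K e f j⁆ = loopH K e f m
  lie_HE : ∀ j, ⁅loopH K e f m, loopE K e f j⁆ = (2 : K) • loopE K e f (m + 1 + j)
  lie_HF : ∀ j, ⁅loopH K e f m, loopF K e f j⁆ = -((2 : K) • loopF K e f (m + 1 + j))
  lie_HH : ⁅loopH K e f 0, loopH K e f m⁆ = 0

/-- The derivation `ad ⁅e, f⁆` raises both indices with opposite signs, so it compares neighbours on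
an antidiagonal. -/
theorem lie_lie_loopEF [CharZero K] (e f : 𝔤) (i j : ℕ) :
    ⁅⁅e, f⁆, ⁅loopE K e f i, loopF K e f j⁆⁆ =
      (2 : K) • (⁅loopE K e f (i + 1), loopF K e f j⁆ - ⁅loopE K e f i, loopF K e f (j + 1)⁆) := by
  rw [leibniz_lie, lie_lie_loopE, lie_lie_loopF, smul_lie, lie_neg, lie_smul, smul_sub,
    sub_eq_add_neg]

/-- Induction on the level. Since `loopH 0` and `loopH k` commute, neighbours on the next
antidiagonal coincide; the Serre relations then give the action of `loopH (k + 1)` on `e` and `f`.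
That `loopH 0` and `loopH (k + 1)` commute results from computing one bracket in two ways, and needs
characteristic zero. -/
theorem loopLevel [CharZero K] (e f : 𝔤) (he : ⁅e, loopE K e f 1⁆ = 0) (hf : ⁅f, loopF K e f 1⁆ = 0) (m : ℕ) :
    LoopLevel K e f m := by
  have two : (2 : K) ≠ 0 := two_ne_zero
  induction m with
  | zero =>
    refine ⟨?_, fun j => ?_, fun j => ?_, lie_self _⟩
    · rintro i j h
      obtain ⟨rfl, rfl⟩ : i = 0 ∧ j = 0 := by omega
      rfl
    · rw [show 0 + 1 + j = j + 1 by omega]; exact lie_lie_loopE K e f j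
    · rw [show 0 + 1 + j = j + 1 by omega]; exact lie_lie_loopF K e f j
  | succ k ih =>
    have hH0 : loopH K e f 0 = ⁅e, f⁆ := rfl
    have step : ∀ i j, i + j = k →
        ⁅loopE K e f (i + 1), loopF K e f j⁆ = ⁅loopE K e f i, loopF K e f (j + 1)⁆ := by
      intro i j h
      have h1 := lie_lie_loopEF (K := K) e f i j
      rw [ih.lie_EF i j h, ← hH0, ih.lie_HH] at h1
      exact sub_eq_zero.1 ((smul_eq_zero.1 h1.symm).resolve_left two)
    have hEF : ∀ i j, i + j = k + 1 →
        ⁅loopE K e f i, loopF K e f j⁆ = loopH K e f (k + 1) := by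
      intro i
      induction i with
      | zero => intro j h; obtain rfl : j = k + 1 := by omega
                rfl
      | succ i ihi => intro j h; rw [step i j (by omega), ihi (j + 1) (by omega)]
    -- Apply `ad (loopF k)` to the Serre relation `⁅e, loopE 1⁆ = 0`; the next claim is its mirror
    -- image.
    have hE0 : ⁅loopH K e f (k + 1), e⁆ = (2 : K) • loopE K e f (k + 2) := by
      have h1 := leibniz_lie (loopF K e f k) e (loopE K e f 1)
      have s1 : ⁅loopF K e f k, e⁆ = -loopH K e f k := by
        rw [← lie_skew]; exact congrArg _ (ih.lie_EF 0 k (by omega))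
      have s2 : ⁅loopF K e f k, loopE K e f 1⁆ = -loopH K e f (k + 1) := by
        rw [← lie_skew, hEF 1 k (by omega)]
      rw [he, lie_zero, s1, s2, neg_lie, ih.lie_HE 1, lie_neg, lie_skew, eq_comm,
        neg_add_eq_zero] at h1
      exact h1.symm
    have hF0 : ⁅loopH K e f (k + 1), f⁆ = -((2 : K) • loopF K e f (k + 2)) := by
      have h1 := leibniz_lie (loopE K e f k) f (loopF K e f 1)
      have s1 : ⁅loopE K e f k, f⁆ = loopH K e f k := ih.lie_EF k 0 (by omega)
      rw [hf, lie_zero, s1, hEF k 1 (by omega), ih.lie_HF 1, eq_comm, neg_add_eq_zero] at h1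
      rw [← lie_skew, ← h1]
    have hHH : ⁅loopH K e f 0, loopH K e f (k + 1)⁆ = 0 := by
      set D := ⁅loopH K e f 0, loopH K e f (k + 1)⁆ with hD
      -- Along this antidiagonal the brackets form an arithmetic progression with difference `D /
      -- 2`.
      have tel : ∀ i j, i + j = k + 2 → ⁅loopE K e f i, loopF K e f j⁆ =
          ⁅e, loopF K e f (k + 2)⁆ + ((i : K) * 2⁻¹) • D := by
        intro i
        induction i with
        | zero => intro j h; obtain rfl : j = k + 2 := by omega
                  simp [loopE]
        | succ i ihi =>
          intro j h
          have h1 := lie_lie_loopEF (K := K) e f i j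
          rw [hEF i j (by omega), ← hH0, ← hD, ihi (j + 1) (by omega)] at h1
          have h2 : (2⁻¹ : K) • D = ⁅loopE K e f (i + 1), loopF K e f j⁆ -
              (⁅e, loopF K e f (k + 2)⁆ + ((i : K) * 2⁻¹) • D) := by
            rw [h1, smul_smul, inv_mul_cancel₀ two, one_smul, ← h1]
          rw [eq_sub_iff_add_eq] at h2
          rw [← h2]
          push_cast
          module
      have h1 := tel (k + 2) 0 rfl
      -- The Jacobi identity expresses `D` by the two ends of the progression; comparison with `tel`
      -- gives `D = -(k + 2) D`.
      have h2 : D = -((2 : K) • ⁅loopE K e f (k + 2), f⁆) + (2 : K) • ⁅e, loopF K e f (k + 2)⁆ := by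
        have s1 : ⁅e, loopH K e f (k + 1)⁆ = -((2 : K) • loopE K e f (k + 2)) := by
          rw [← lie_skew, hE0]
        have s2 : ⁅f, loopH K e f (k + 1)⁆ = (2 : K) • loopF K e f (k + 2) := by
          rw [← lie_skew, hF0, neg_neg]
        rw [hD, hH0, lie_lie, s1, s2, lie_neg, lie_smul, lie_smul, ← lie_skew f]
        module
      have h3 : ((k : K) + 3) • D = 0 := by
        rw [show loopF K e f 0 = f from rfl] at h1
        rw [h1] at h2
        have : ((k : K) + 3) • D = D + ((k : K) + 2) • D := by module
        rw [this]
        nth_rw 1 [h2]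
        push_cast
        rw [smul_add, smul_smul, show (2 : K) * (((k : K) + 2) * 2⁻¹) = k + 2 by field_simp]
        module
      refine (smul_eq_zero.1 h3).resolve_left ?_
      exact_mod_cast (by omega : k + 3 ≠ 0)
    -- `loopH (k + 1)` commutes with `⁅e, f⁆`, so its action propagates from index `0` to all
    -- indices.
    refine ⟨hEF, fun j => ?_, fun j => ?_, hHH⟩
    · induction j with
      | zero => exact hE0
      | succ j ihj =>
        have h1 := leibniz_lie (loopH K e f (k + 1)) ⁅e, f⁆ (loopE K e f j)
        have s1 : ⁅loopH K e f (k + 1), ⁅e, f⁆⁆ = 0 := by rw [← lie_skew, ← hH0, hHH, neg_zero]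
        rw [s1, zero_lie, zero_add, ihj, lie_lie_loopE, lie_smul, lie_smul, lie_lie_loopE] at h1
        exact smul_right_injective _ two h1
    · induction j with
      | zero => exact hF0
      | succ j ihj =>
        have h1 := leibniz_lie (loopH K e f (k + 1)) ⁅e, f⁆ (loopF K e f j)
        have s1 : ⁅loopH K e f (k + 1), ⁅e, f⁆⁆ = 0 := by rw [← lie_skew, ← hH0, hHH, neg_zero]
        rw [s1, zero_lie, zero_add, ihj, lie_lie_loopF, lie_neg, lie_neg, lie_smul, lie_smul, lie_lie_loopF] at h1
        exact smul_right_injective _ two (neg_injective h1)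

/-- Expanding the second factor as `⁅e, loopF n⁆` leaves the difference of two brackets on the same
antidiagonal. -/
theorem lie_loopH_loopH [CharZero K] (e f : 𝔤) (he : ⁅e, loopE K e f 1⁆ = 0) (hf : ⁅f, loopF K e f 1⁆ = 0)
    (m n : ℕ) : ⁅loopH K e f m, loopH K e f n⁆ = 0 := by
  have hm := loopLevel e f he hf m
  rw [← (loopLevel e f he hf n).lie_EF 0 n (by omega), leibniz_lie, hm.lie_HE, hm.lie_HF, smul_lie,
    lie_neg, lie_smul, (loopLevel e f he hf (m + 1 + n)).lie_EF _ _ rfl,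
    (loopLevel e f he hf (m + 1 + n)).lie_EF 0 _ (by omega), add_neg_cancel]

/-- If `h m` shifts the family `x` by `m + 1` up to a nonzero factor and `x 0`, `x 1` commute, then
the members of `x` commute. -/
theorem lie_eq_zero_of_shift [CharZero K] (x h : ℕ → 𝔤) (a : K) (ha : a ≠ 0)
    (hx : ∀ m j, ⁅h m, x j⁆ = a • x (m + 1 + j)) (h01 : ⁅x 0, x 1⁆ = 0) (i j : ℕ) :
    ⁅x i, x j⁆ = 0 := by
  have two : (2 : K) ≠ 0 := two_ne_zero
  have key : ∀ m i j, ⁅x i, x j⁆ = 0 → ⁅x (m + 1 + i), x j⁆ + ⁅x i, x (m + 1 + j)⁆ = 0 := by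
    intro m i j hij
    have h1 := leibniz_lie (h m) (x i) (x j)
    rw [hij, lie_zero, hx, hx, smul_lie, lie_smul, ← smul_add] at h1
    exact (smul_eq_zero.1 h1.symm).resolve_left ha
  -- For index `m + 2`: shift `⁅x 0, x (m + 1)⁆ = 0` by one and `⁅x 0, x 1⁆ = 0` by `m + 1`. The
  -- terms in `x 1` and `x (m + 1)` have opposite signs, so the sum is `2 ⁅x 0, x (m + 2)⁆ = 0`.
  have h0 : ∀ m, ⁅x 0, x m⁆ = 0 := by
    intro m
    induction m with
    | zero => exact lie_self _
    | succ m ih =>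
      rcases m with _ | m
      · exact h01
      have h1 := key 0 0 (m + 1) ih
      have h2 := key m 0 1 h01
      rw [← lie_skew, add_comm] at h2
      have e1 : m + 1 + 1 = 0 + 1 + (m + 1) := by omega
      rw [e1, ← sub_eq_add_neg, sub_eq_zero] at h2
      simp only [zero_add, add_zero] at h1 h2
      rw [← h2, ← two_smul K] at h1
      rw [e1, zero_add]
      exact (smul_eq_zero.1 h1).resolve_left two
  rcases i with _ | i
  · exact h0 j
  · have h1 := key i 0 j (h0 j)
    rw [h0, add_zero, add_zero] at h1
    exact h1

theorem lie_loopE_loopE [CharZero K] (e f : 𝔤) (he : ⁅e, loopE K e f 1⁆ = 0) (hf : ⁅f, loopF K e f 1⁆ = 0)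
    (i j : ℕ) : ⁅loopE K e f i, loopE K e f j⁆ = 0 :=
  lie_eq_zero_of_shift _ (loopH K e f) (2 : K) two_ne_zero
    (fun m j => (loopLevel e f he hf m).lie_HE j) he i j

theorem lie_loopF_loopF [CharZero K] (e f : 𝔤) (he : ⁅e, loopE K e f 1⁆ = 0) (hf : ⁅f, loopF K e f 1⁆ = 0)
    (i j : ℕ) : ⁅loopF K e f i, loopF K e f j⁆ = 0 :=
  lie_eq_zero_of_shift _ (loopH K e f) (-2 : K) (neg_ne_zero.2 two_ne_zero)
    (fun m j => by rw [(loopLevel e f he hf m).lie_HF j, neg_smul]) hf i j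

theorem lie_loopE_of_weight (h e f : 𝔤) (h_e : ⁅h, e⁆ = (2 : K) • e)
    (h_f : ⁅h, f⁆ = -((2 : K) • f)) (n : ℕ) : ⁅h, loopE K e f n⁆ = (2 : K) • loopE K e f n := by
  have h0 : ⁅h, ⁅e, f⁆⁆ = 0 := by rw [leibniz_lie, h_e, h_f, smul_lie, lie_neg, lie_smul, add_neg_cancel]
  induction n with
  | zero => exact h_e
  | succ n ih => rw [loopE, lie_smul, leibniz_lie, h0, zero_lie, zero_add, ih, lie_smul, smul_comm]

theorem lie_loopF_of_weight (h e f : 𝔤) (h_e : ⁅h, e⁆ = (2 : K) • e)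
    (h_f : ⁅h, f⁆ = -((2 : K) • f)) (n : ℕ) : ⁅h, loopF K e f n⁆ = -((2 : K) • loopF K e f n) := by
  have h0 : ⁅h, ⁅e, f⁆⁆ = 0 := by rw [leibniz_lie, h_e, h_f, smul_lie, lie_neg, lie_smul, add_neg_cancel]
  induction n with
  | zero => exact h_f
  | succ n ih =>
    rw [loopF, lie_neg, lie_smul, leibniz_lie, h0, zero_lie, zero_add, ih, lie_neg, lie_smul,
      smul_neg, smul_neg, smul_comm]

theorem lie_loopH_of_weight (h e f : 𝔤) (h_e : ⁅h, e⁆ = (2 : K) • e)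
    (h_f : ⁅h, f⁆ = -((2 : K) • f)) (n : ℕ) : ⁅h, loopH K e f n⁆ = 0 := by
  rw [loopH, leibniz_lie, h_e, lie_loopF_of_weight h e f h_e h_f, smul_lie, lie_neg, lie_smul,
    add_neg_cancel]

end LoopRelations

/-! ### Brackets of the loop generators. -/

theorem lie_hLoop_hLoop (m n : ℤ) : ⁅hLoop m, hLoop n⁆ = 0 := by
  have h : ⁅(LieAlgebra.SpecialLinear.singleSubSingle (0 : Fin 2) 1 (1 : ℂ) : Sl2C),
      LieAlgebra.SpecialLinear.singleSubSingle (0 : Fin 2) 1 (1 : ℂ)⁆ = 0 := lie_self _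
  rw [hLoop, hLoop, LieAlgebra.ExtendScalars.bracket_tmul, h, TensorProduct.tmul_zero]

theorem lie_hLoop_xPlus (m n : ℤ) : ⁅hLoop m, xPlus n⁆ = (2 : ℂ) • xPlus (m + n) := by
  have h : ⁅(LieAlgebra.SpecialLinear.singleSubSingle (0 : Fin 2) 1 (1 : ℂ) : Sl2C),
      LieAlgebra.SpecialLinear.single (0 : Fin 2) 1 (by decide) (1 : ℂ)⁆ =
      (2 : ℂ) • LieAlgebra.SpecialLinear.single (0 : Fin 2) 1 (by decide) (1 : ℂ) := by
    ext i j
    fin_cases i <;> fin_cases j <;>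
      simp [Matrix.mul_apply, Matrix.single, Ring.lie_def]
    norm_num
  rw [hLoop, xPlus, xPlus, LieAlgebra.ExtendScalars.bracket_tmul, h,
    AddMonoidAlgebra.single_mul_single, one_mul, TensorProduct.tmul_smul]

theorem lie_hLoop_xMinus (m n : ℤ) : ⁅hLoop m, xMinus n⁆ = -((2 : ℂ) • xMinus (m + n)) := by
  have h : ⁅(LieAlgebra.SpecialLinear.singleSubSingle (0 : Fin 2) 1 (1 : ℂ) : Sl2C),
      LieAlgebra.SpecialLinear.single (1 : Fin 2) 0 (by decide) (1 : ℂ)⁆ =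
      -((2 : ℂ) • LieAlgebra.SpecialLinear.single (1 : Fin 2) 0 (by decide) (1 : ℂ)) := by
    ext i j
    fin_cases i <;> fin_cases j <;>
      simp [Matrix.mul_apply, Matrix.single, Ring.lie_def]
    norm_num
  rw [hLoop, xMinus, xMinus, LieAlgebra.ExtendScalars.bracket_tmul, h,
    AddMonoidAlgebra.single_mul_single, one_mul, TensorProduct.tmul_neg, TensorProduct.tmul_smul]

theorem lie_xPlus_xMinus (m n : ℤ) : ⁅xPlus m, xMinus n⁆ = hLoop (m + n) := by
  have h : ⁅(LieAlgebra.SpecialLinear.single (0 : Fin 2) 1 (by decide) (1 : ℂ) : Sl2C),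
      LieAlgebra.SpecialLinear.single (1 : Fin 2) 0 (by decide) (1 : ℂ)⁆ =
      LieAlgebra.SpecialLinear.singleSubSingle (0 : Fin 2) 1 (1 : ℂ) := by
    ext i j
    fin_cases i <;> fin_cases j <;>
      simp [Matrix.mul_apply, Matrix.single, Ring.lie_def]
  rw [hLoop, xPlus, xMinus, LieAlgebra.ExtendScalars.bracket_tmul, h,
    AddMonoidAlgebra.single_mul_single, one_mul]

theorem lie_xPlus_xPlus (m n : ℤ) : ⁅xPlus m, xPlus n⁆ = 0 := by
  rw [xPlus, xPlus, LieAlgebra.ExtendScalars.bracket_tmul, lie_self, TensorProduct.tmul_zero]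

theorem lie_xMinus_xMinus (m n : ℤ) : ⁅xMinus m, xMinus n⁆ = 0 := by
  rw [xMinus, xMinus, LieAlgebra.ExtendScalars.bracket_tmul, lie_self, TensorProduct.tmul_zero]

theorem LinearMap.map_lie_of_mem_span {R 𝔩 𝔤 : Type*} [CommRing R] [LieRing 𝔩] [LieAlgebra R 𝔩]
    [LieRing 𝔤] [LieAlgebra R 𝔤] (f : 𝔩 →ₗ[R] 𝔤) {G : Set 𝔩}
    (h : ∀ x ∈ G, ∀ y ∈ G, f ⁅x, y⁆ = ⁅f x, f y⁆) {x y : 𝔩} (hx : x ∈ Submodule.span R G)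
    (hy : y ∈ Submodule.span R G) : f ⁅x, y⁆ = ⁅f x, f y⁆ := by
  induction hx, hy using Submodule.span_induction₂ with
  | mem_mem x y hx hy => exact h x hx y hy
  | zero_left y hy => simp
  | zero_right x hx => simp
  | add_left x y z hx hy hz h1 h2 => rw [add_lie, map_add, h1, h2, map_add, add_lie]
  | add_right x y z hx hy hz h1 h2 => rw [lie_add, map_add, h1, h2, map_add, lie_add]
  | smul_left r x y hx hy h1 => rw [smul_lie, map_smul, h1, map_smul, smul_lie]
  | smul_right r x y hx hy h1 => rw [lie_smul, map_smul, h1, map_smul, lie_smul]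

theorem Submodule.lie_mem_span_of_generators {R 𝔩 : Type*} [CommRing R] [LieRing 𝔩]
    [LieAlgebra R 𝔩] {G : Set 𝔩} (h : ∀ x ∈ G, ∀ y ∈ G, ⁅x, y⁆ ∈ Submodule.span R G) {x y : 𝔩}
    (hx : x ∈ Submodule.span R G) (hy : y ∈ Submodule.span R G) : ⁅x, y⁆ ∈ Submodule.span R G := by
  induction hx, hy using Submodule.span_induction₂ with
  | mem_mem x y hx hy => exact h x hx y hy
  | zero_left y hy => simp
  | zero_right x hx => simp
  | add_left x y z hx hy hz h1 h2 => rw [add_lie]; exact add_mem h1 h2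
  | add_right x y z hx hy hz h1 h2 => rw [lie_add]; exact add_mem h1 h2
  | smul_left r x y hx hy h1 => rw [smul_lie]; exact Submodule.smul_mem _ _ h1
  | smul_right r x y hx hy h1 => rw [lie_smul]; exact Submodule.smul_mem _ _ h1

/-! ### Representations of the Borel subalgebras. -/

section LoopMap

variable {𝔤 : Type*} [LieRing 𝔤] [LieAlgebra ℂ 𝔤]

/-- The linear map on the loop algebra with `h_n ↦ H n`, `x_n^+ ↦ E n`, `x_n^- ↦ F n`. -/
noncomputable def loopMap (H E F : ℤ → 𝔤) : LoopSl2 →ₗ[ℂ] 𝔤 :=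
  (Finsupp.lsum ℂ fun n : ℤ =>
    ((LinearMap.toSpanSingleton ℂ 𝔤 (H n)).comp (Matrix.entryLinearMap ℂ ℂ (0 : Fin 2) (0 : Fin 2)) +
      (LinearMap.toSpanSingleton ℂ 𝔤 (E n)).comp (Matrix.entryLinearMap ℂ ℂ (0 : Fin 2) (1 : Fin 2)) +
      (LinearMap.toSpanSingleton ℂ 𝔤 (F n)).comp
        (Matrix.entryLinearMap ℂ ℂ (1 : Fin 2) (0 : Fin 2))).comp
      (LieAlgebra.SpecialLinear.sl (Fin 2) ℂ).toSubmodule.subtype).comp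
    (LieAlgebra.LoopAlgebra.toFinsupp ℂ ℤ Sl2C).toLinearMap

theorem loopMap_tmul (H E F : ℤ → 𝔤) (n : ℤ) (z : Sl2C) :
    loopMap H E F (AddMonoidAlgebra.single n (1 : ℂ) ⊗ₜ[ℂ] z) =
      z.val 0 0 • H n + z.val 0 1 • E n + z.val 1 0 • F n := by
  rw [loopMap, LinearMap.comp_apply, ← LieAlgebra.LoopAlgebra.toFinsupp_symm_single,
    LinearEquiv.coe_coe, LinearEquiv.apply_symm_apply]
  simp

theorem loopMap_hLoop (H E F : ℤ → 𝔤) (n : ℤ) : loopMap H E F (hLoop n) = H n := by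
  rw [hLoop, loopMap_tmul]; simp

theorem loopMap_xPlus (H E F : ℤ → 𝔤) (n : ℤ) : loopMap H E F (xPlus n) = E n := by
  rw [xPlus, loopMap_tmul]; simp

theorem loopMap_xMinus (H E F : ℤ → 𝔤) (n : ℤ) : loopMap H E F (xMinus n) = F n := by
  rw [xMinus, loopMap_tmul]; simp

/-- The loop relations for families indexed by sets of integers. -/
structure LoopRelations (S₀ S₁ S₂ : Set ℤ) (H E F : ℤ → 𝔤) : Prop where
  hh : ∀ m ∈ S₀, ∀ n ∈ S₀, ⁅H m, H n⁆ = 0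
  he : ∀ m ∈ S₀, ∀ n ∈ S₁, ⁅H m, E n⁆ = (2 : ℂ) • E (m + n)
  hf : ∀ m ∈ S₀, ∀ n ∈ S₂, ⁅H m, F n⁆ = -((2 : ℂ) • F (m + n))
  ef : ∀ m ∈ S₁, ∀ n ∈ S₂, ⁅E m, F n⁆ = H (m + n)
  ee : ∀ m ∈ S₁, ∀ n ∈ S₁, ⁅E m, E n⁆ = 0
  ff : ∀ m ∈ S₂, ∀ n ∈ S₂, ⁅F m, F n⁆ = 0

/-- A set of loop generators with modes in given sets of integers. -/
def IsLoopGens (S₀ S₁ S₂ : Set ℤ) (G : Set LoopSl2) : Prop :=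
  ∀ x, x ∈ G ↔ (∃ n ∈ S₀, x = hLoop n) ∨ (∃ n ∈ S₁, x = xPlus n) ∨ ∃ n ∈ S₂, x = xMinus n

theorem LoopRelations.loopMap_lie {S₀ S₁ S₂ : Set ℤ} {H E F : ℤ → 𝔤}
    (h : LoopRelations S₀ S₁ S₂ H E F) {G : Set LoopSl2} (hG : IsLoopGens S₀ S₁ S₂ G)
    {x y : LoopSl2} (hx : x ∈ Submodule.span ℂ G) (hy : y ∈ Submodule.span ℂ G) :
    loopMap H E F ⁅x, y⁆ = ⁅loopMap H E F x, loopMap H E F y⁆ := by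
  refine LinearMap.map_lie_of_mem_span _ (fun x hx y hy => ?_) hx hy
  have sk : ∀ a b : LoopSl2, loopMap H E F ⁅b, a⁆ = ⁅loopMap H E F b, loopMap H E F a⁆ →
      loopMap H E F ⁅a, b⁆ = ⁅loopMap H E F a, loopMap H E F b⁆ := by
    intro a b hab
    rw [← lie_skew, map_neg, hab, lie_skew]
  rcases (hG x).1 hx with ⟨m, hm, rfl⟩ | ⟨m, hm, rfl⟩ | ⟨m, hm, rfl⟩ <;>
  rcases (hG y).1 hy with ⟨n, hn, rfl⟩ | ⟨n, hn, rfl⟩ | ⟨n, hn, rfl⟩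
  · simp only [lie_hLoop_hLoop, map_zero, loopMap_hLoop, h.hh m hm n hn]
  · simp only [lie_hLoop_xPlus, map_smul, loopMap_hLoop, loopMap_xPlus, h.he m hm n hn]
  · simp only [lie_hLoop_xMinus, map_smul, map_neg, loopMap_hLoop, loopMap_xMinus,
      h.hf m hm n hn]
  · apply sk
    simp only [lie_hLoop_xPlus, map_smul, loopMap_hLoop, loopMap_xPlus, h.he n hn m hm]
  · simp only [lie_xPlus_xPlus, map_zero, loopMap_xPlus, h.ee m hm n hn]
  · simp only [lie_xPlus_xMinus, loopMap_hLoop, loopMap_xPlus, loopMap_xMinus, h.ef m hm n hn]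
  · apply sk
    simp only [lie_hLoop_xMinus, map_smul, map_neg, loopMap_hLoop, loopMap_xMinus,
      h.hf n hn m hm]
  · apply sk
    simp only [lie_xPlus_xMinus, loopMap_hLoop, loopMap_xPlus, loopMap_xMinus, h.ef n hn m hm]
  · simp only [lie_xMinus_xMinus, map_zero, loopMap_xMinus, h.ff m hm n hn]

theorem IsLoopGens.lie_mem_span {S₀ S₁ S₂ : Set ℤ} {G : Set LoopSl2}
    (hG : IsLoopGens S₀ S₁ S₂ G) (h01 : ∀ m ∈ S₀, ∀ n ∈ S₁, m + n ∈ S₁)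
    (h02 : ∀ m ∈ S₀, ∀ n ∈ S₂, m + n ∈ S₂) (h12 : ∀ m ∈ S₁, ∀ n ∈ S₂, m + n ∈ S₀)
    {x y : LoopSl2} (hx : x ∈ Submodule.span ℂ G) (hy : y ∈ Submodule.span ℂ G) :
    ⁅x, y⁆ ∈ Submodule.span ℂ G := by
  refine Submodule.lie_mem_span_of_generators (fun x hx y hy => ?_) hx hy
  have sk : ∀ a b : LoopSl2, ⁅b, a⁆ ∈ Submodule.span ℂ G → ⁅a, b⁆ ∈ Submodule.span ℂ G := by
    intro a b hab
    rw [← lie_skew]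
    exact neg_mem hab
  have g0 : ∀ n ∈ S₀, hLoop n ∈ Submodule.span ℂ G := fun n hn =>
    Submodule.subset_span ((hG _).2 (Or.inl ⟨n, hn, rfl⟩))
  have g1 : ∀ n ∈ S₁, xPlus n ∈ Submodule.span ℂ G := fun n hn =>
    Submodule.subset_span ((hG _).2 (Or.inr (Or.inl ⟨n, hn, rfl⟩)))
  have g2 : ∀ n ∈ S₂, xMinus n ∈ Submodule.span ℂ G := fun n hn =>
    Submodule.subset_span ((hG _).2 (Or.inr (Or.inr ⟨n, hn, rfl⟩)))
  rcases (hG x).1 hx with ⟨m, hm, rfl⟩ | ⟨m, hm, rfl⟩ | ⟨m, hm, rfl⟩ <;>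
  rcases (hG y).1 hy with ⟨n, hn, rfl⟩ | ⟨n, hn, rfl⟩ | ⟨n, hn, rfl⟩
  · rw [lie_hLoop_hLoop]; exact zero_mem _
  · rw [lie_hLoop_xPlus]; exact Submodule.smul_mem _ _ (g1 _ (h01 m hm n hn))
  · rw [lie_hLoop_xMinus]; exact neg_mem (Submodule.smul_mem _ _ (g2 _ (h02 m hm n hn)))
  · apply sk; rw [lie_hLoop_xPlus]; exact Submodule.smul_mem _ _ (g1 _ (h01 n hn m hm))
  · rw [lie_xPlus_xPlus]; exact zero_mem _
  · rw [lie_xPlus_xMinus]; exact g0 _ (h12 m hm n hn)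
  · apply sk; rw [lie_hLoop_xMinus]
    exact neg_mem (Submodule.smul_mem _ _ (g2 _ (h02 n hn m hm)))
  · apply sk; rw [lie_xPlus_xMinus]; exact g0 _ (h12 n hn m hm)
  · rw [lie_xMinus_xMinus]; exact zero_mem _

theorem LoopRelations.exists_lieHom {S₀ S₁ S₂ : Set ℤ} {H E F : ℤ → 𝔤}
    (h : LoopRelations S₀ S₁ S₂ H E F) {G : Set LoopSl2} (hG : IsLoopGens S₀ S₁ S₂ G)
    (h01 : ∀ m ∈ S₀, ∀ n ∈ S₁, m + n ∈ S₁) (h02 : ∀ m ∈ S₀, ∀ n ∈ S₂, m + n ∈ S₂)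
    (h12 : ∀ m ∈ S₁, ∀ n ∈ S₂, m + n ∈ S₀) :
    ∃ φ : LieSubalgebra.lieSpan ℂ LoopSl2 G →ₗ⁅ℂ⁆ 𝔤, ∀ x, φ x = loopMap H E F x.val := by
  -- The linear span of the generators is closed under the bracket, so it contains the Lie
  -- subalgebra they generate.
  have hmem : ∀ x ∈ LieSubalgebra.lieSpan ℂ LoopSl2 G, x ∈ Submodule.span ℂ G := by
    let 𝔟 : LieSubalgebra ℂ LoopSl2 :=
      { Submodule.span ℂ G with lie_mem' := fun hx hy => hG.lie_mem_span h01 h02 h12 hx hy }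
    exact (LieSubalgebra.lieSpan_le (K := 𝔟)).2 Submodule.subset_span
  refine ⟨⟨(loopMap H E F).comp (LieSubalgebra.lieSpan ℂ LoopSl2 G).toSubmodule.subtype, ?_⟩,
    fun x => rfl⟩
  intro x y
  exact h.loopMap_lie hG (hmem _ x.2) (hmem _ y.2)

theorem isLoopGens_borelPlusGens :
    IsLoopGens {n | 0 ≤ n} {n | 0 ≤ n} {n | 0 < n} borelPlusGens := by
  intro x
  constructor
  · rintro (⟨n, hn, rfl | rfl⟩ | ⟨n, hn, rfl⟩)
    exacts [Or.inl ⟨n, hn, rfl⟩, Or.inr (Or.inl ⟨n, hn, rfl⟩), Or.inr (Or.inr ⟨n, hn, rfl⟩)]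
  · rintro (⟨n, hn, rfl⟩ | ⟨n, hn, rfl⟩ | ⟨n, hn, rfl⟩)
    exacts [Or.inl ⟨n, hn, Or.inl rfl⟩, Or.inl ⟨n, hn, Or.inr rfl⟩, Or.inr ⟨n, hn, rfl⟩]

theorem isLoopGens_borelMinusGens :
    IsLoopGens {n | n ≤ 0} {n | n < 0} {n | n ≤ 0} borelMinusGens := by
  intro x
  constructor
  · rintro (⟨n, hn, rfl | rfl⟩ | ⟨n, hn, rfl⟩)
    exacts [Or.inl ⟨-n, neg_nonpos.2 hn, rfl⟩, Or.inr (Or.inr ⟨-n, neg_nonpos.2 hn, rfl⟩),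
      Or.inr (Or.inl ⟨-n, neg_lt_zero.2 hn, rfl⟩)]
  · rintro (⟨n, hn, rfl⟩ | ⟨n, hn, rfl⟩ | ⟨n, hn, rfl⟩)
    exacts [Or.inl ⟨-n, neg_nonneg.2 hn, Or.inl (by rw [neg_neg])⟩,
      Or.inr ⟨-n, neg_pos.2 hn, by rw [neg_neg]⟩,
      Or.inl ⟨-n, neg_nonneg.2 hn, Or.inr (by rw [neg_neg])⟩]

theorem lie_loopE_one_eq_zero (e f : 𝔤) (h : ⁅e, ⁅e, ⁅e, f⁆⁆⁆ = 0) : ⁅e, loopE ℂ e f 1⁆ = 0 := by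
  have h1 : ⁅⁅e, f⁆, e⁆ = -⁅e, ⁅e, f⁆⁆ := (lie_skew _ _).symm
  rw [loopE, loopE, lie_smul, h1, lie_neg, h, neg_zero, smul_zero]

theorem lie_loopF_one_eq_zero (e f : 𝔤) (h : ⁅f, ⁅f, ⁅f, e⁆⁆⁆ = 0) : ⁅f, loopF ℂ e f 1⁆ = 0 := by
  have h1 : ⁅⁅e, f⁆, f⁆ = ⁅f, ⁅f, e⁆⁆ := by
    rw [← lie_skew f e, lie_neg, lie_skew]
  rw [loopF, loopF, lie_neg, lie_smul, h1, h, smul_zero, neg_zero]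

/-- A representation of `b₊` from operators that satisfy the Serre relations. -/
theorem exists_lieHom_borelPlus (h e f : 𝔤) (h_e : ⁅h, e⁆ = (2 : ℂ) • e)
    (h_f : ⁅h, f⁆ = -((2 : ℂ) • f)) (he : ⁅e, ⁅e, ⁅e, f⁆⁆⁆ = 0) (hf : ⁅f, ⁅f, ⁅f, e⁆⁆⁆ = 0) :
    ∃ φ : borelPlus →ₗ⁅ℂ⁆ 𝔤, φ ⟨hLoop 0, hLoop_mem_borelPlus⟩ = h ∧
      φ ⟨xPlus 0, xPlus_mem_borelPlus⟩ = e ∧ φ ⟨xMinus 1, xMinus_mem_borelPlus⟩ = f := by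
  replace he := lie_loopE_one_eq_zero e f he
  replace hf := lie_loopF_one_eq_zero e f hf
  -- Mode zero of the Cartan family is the given `h`, which `e` and `f` do not produce; `f` sits at
  -- mode `1`, whence the shift by one in `H` and `F`.
  let H : ℤ → 𝔤 := fun n => if n = 0 then h else loopH ℂ e f (n - 1).toNat
  let E : ℤ → 𝔤 := fun n => loopE ℂ e f n.toNat
  let F : ℤ → 𝔤 := fun n => loopF ℂ e f (n - 1).toNat
  have hH0 : H 0 = h := if_pos rfl
  have hH : ∀ n : ℕ, H (n + 1) = loopH ℂ e f n := fun n => by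
    simp only [H]; rw [if_neg (by omega)]; congr 1; omega
  have hE : ∀ n : ℕ, E n = loopE ℂ e f n := fun n => rfl
  have hF : ∀ n : ℕ, F (n + 1) = loopF ℂ e f n := fun n => by
    simp only [F]; congr 1; omega
  have nn : ∀ n : ℤ, 0 ≤ n → ∃ k : ℕ, n = k := fun n hn => ⟨n.toNat, by omega⟩
  have np : ∀ n : ℤ, 0 < n → ∃ k : ℕ, n = k + 1 := fun n hn => ⟨(n - 1).toNat, by omega⟩
  have nz : ∀ n : ℤ, 0 ≤ n → n = 0 ∨ ∃ k : ℕ, n = k + 1 := fun n hn => by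
    rcases hn.eq_or_lt with h | h
    exacts [Or.inl h.symm, Or.inr (np n h)]
  have rel : LoopRelations {n | 0 ≤ n} {n | 0 ≤ n} {n | 0 < n} H E F := by
    constructor
    · intro m hm n hn
      rcases nz m hm with rfl | ⟨m, rfl⟩ <;> rcases nz n hn with rfl | ⟨n, rfl⟩
      · exact lie_self _
      · rw [hH0, hH, lie_loopH_of_weight h e f h_e h_f]
      · rw [hH0, hH, ← lie_skew, lie_loopH_of_weight h e f h_e h_f, neg_zero]
      · rw [hH, hH, lie_loopH_loopH e f he hf]
    · intro m hm n hn
      obtain ⟨n, rfl⟩ := nn n hn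
      rcases nz m hm with rfl | ⟨m, rfl⟩
      · rw [hH0, zero_add, hE, lie_loopE_of_weight h e f h_e h_f]
      · rw [hH, hE, (loopLevel e f he hf m).lie_HE, ← hE]; push_cast; rfl
    · intro m hm n hn
      obtain ⟨n, rfl⟩ := np n hn
      rcases nz m hm with rfl | ⟨m, rfl⟩
      · rw [hH0, zero_add, hF, lie_loopF_of_weight h e f h_e h_f]
      · rw [hH, hF, (loopLevel e f he hf m).lie_HF, ← hF]; push_cast; rw [add_assoc (m + 1 : ℤ)]
    · intro m hm n hn
      obtain ⟨m, rfl⟩ := nn m hm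
      obtain ⟨n, rfl⟩ := np n hn
      rw [hE, hF, (loopLevel e f he hf (m + n)).lie_EF m n rfl, ← hH]; push_cast
      rw [add_assoc]
    · intro m hm n hn
      exact lie_loopE_loopE e f he hf _ _
    · intro m hm n hn
      exact lie_loopF_loopF e f he hf _ _
  obtain ⟨φ, hφ⟩ := rel.exists_lieHom isLoopGens_borelPlusGens
    (fun m hm n hn => by simp only [Set.mem_ofPred_eq] at hm hn ⊢; omega)
    (fun m hm n hn => by simp only [Set.mem_ofPred_eq] at hm hn ⊢; omega)
    (fun m hm n hn => by simp only [Set.mem_ofPred_eq] at hm hn ⊢; omega)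
  refine ⟨φ, ?_, ?_, ?_⟩
  · exact (hφ _).trans ((loopMap_hLoop H E F 0).trans hH0)
  · exact (hφ _).trans (loopMap_xPlus H E F 0)
  · exact (hφ _).trans ((loopMap_xMinus H E F 1).trans (hF 0))

/-- A representation of `b₋` from operators that satisfy the Serre relations. -/
theorem exists_lieHom_borelMinus (h e f : 𝔤) (h_e : ⁅h, e⁆ = (2 : ℂ) • e)
    (h_f : ⁅h, f⁆ = -((2 : ℂ) • f)) (he : ⁅e, ⁅e, ⁅e, f⁆⁆⁆ = 0) (hf : ⁅f, ⁅f, ⁅f, e⁆⁆⁆ = 0) :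
    ∃ φ : borelMinus →ₗ⁅ℂ⁆ 𝔤, φ ⟨hLoop 0, hLoop_mem_borelMinus⟩ = h ∧
      φ ⟨xPlus (-1), xPlus_mem_borelMinus⟩ = e ∧ φ ⟨xMinus 0, xMinus_mem_borelMinus⟩ = f := by
  -- The automorphism exchanging `t` with `t⁻¹` and raising with lowering turns `b₋` into `b₊`: `f`
  -- now plays the role of `e`, and Cartan elements change sign.
  replace he := lie_loopF_one_eq_zero f e he
  replace hf := lie_loopE_one_eq_zero f e hf
  have w_f : ⁅-h, f⁆ = (2 : ℂ) • f := by rw [neg_lie, h_f, neg_neg]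
  have w_e : ⁅-h, e⁆ = -((2 : ℂ) • e) := by rw [neg_lie, h_e]
  let H : ℤ → 𝔤 := fun n => -if n = 0 then -h else loopH ℂ f e (-n - 1).toNat
  let F : ℤ → 𝔤 := fun n => loopE ℂ f e (-n).toNat
  let E : ℤ → 𝔤 := fun n => loopF ℂ f e (-n - 1).toNat
  have hH0 : H 0 = - -h := congrArg _ (if_pos rfl)
  have hH : ∀ n : ℕ, H (-(n + 1)) = -loopH ℂ f e n := fun n => by
    simp only [H]; rw [if_neg (by omega)]; congr 2; omega
  have hF : ∀ n : ℕ, F (-n) = loopE ℂ f e n := fun n => by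
    simp only [F]; congr 1; omega
  have hE : ∀ n : ℕ, E (-(n + 1)) = loopF ℂ f e n := fun n => by
    simp only [E]; congr 1; omega
  have nn : ∀ n : ℤ, n ≤ 0 → ∃ k : ℕ, n = -k := fun n hn => ⟨(-n).toNat, by omega⟩
  have np : ∀ n : ℤ, n < 0 → ∃ k : ℕ, n = -(k + 1) := fun n hn => ⟨(-n - 1).toNat, by omega⟩
  have nz : ∀ n : ℤ, n ≤ 0 → n = 0 ∨ ∃ k : ℕ, n = -(k + 1) := fun n hn => by
    rcases hn.eq_or_lt with h | h
    exacts [Or.inl h, Or.inr (np n h)]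
  have rel : LoopRelations {n | n ≤ 0} {n | n < 0} {n | n ≤ 0} H E F := by
    constructor
    · intro m hm n hn
      rcases nz m hm with rfl | ⟨m, rfl⟩ <;> rcases nz n hn with rfl | ⟨n, rfl⟩
      · exact lie_self _
      · rw [hH0, hH, neg_lie, lie_neg, lie_loopH_of_weight _ f e w_f w_e, neg_zero, neg_zero]
      · rw [hH0, hH, ← lie_skew, neg_lie, lie_neg, lie_loopH_of_weight _ f e w_f w_e]; simp
      · rw [hH, hH, neg_lie, lie_neg, lie_loopH_loopH f e hf he]; simp
    · intro m hm n hn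
      obtain ⟨n, rfl⟩ := np n hn
      rcases nz m hm with rfl | ⟨m, rfl⟩
      · rw [hH0, zero_add, hE, neg_lie, lie_loopF_of_weight _ f e w_f w_e, neg_neg]
      · rw [hH, hE, neg_lie, (loopLevel f e hf he m).lie_HF, ← hE, neg_neg]; congr 2; push_cast; ring
    · intro m hm n hn
      obtain ⟨n, rfl⟩ := nn n hn
      rcases nz m hm with rfl | ⟨m, rfl⟩
      · rw [hH0, zero_add, hF, neg_lie, lie_loopE_of_weight _ f e w_f w_e]
      · rw [hH, hF, neg_lie, (loopLevel f e hf he m).lie_HE, ← hF]; congr 3; push_cast; ring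
    · intro m hm n hn
      obtain ⟨m, rfl⟩ := np m hm
      obtain ⟨n, rfl⟩ := nn n hn
      rw [hE, hF, ← lie_skew, (loopLevel f e hf he (n + m)).lie_EF n m rfl, ← hH]; congr 1
      push_cast; ring
    · intro m hm n hn
      exact lie_loopF_loopF f e hf he _ _
    · intro m hm n hn
      exact lie_loopE_loopE f e hf he _ _
  obtain ⟨φ, hφ⟩ := rel.exists_lieHom isLoopGens_borelMinusGens
    (fun m hm n hn => by simp only [Set.mem_ofPred_eq] at hm hn ⊢; omega)
    (fun m hm n hn => by simp only [Set.mem_ofPred_eq] at hm hn ⊢; omega)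
    (fun m hm n hn => by simp only [Set.mem_ofPred_eq] at hm hn ⊢; omega)
  refine ⟨φ, ?_, ?_, ?_⟩
  · exact (hφ _).trans ((loopMap_hLoop H E F 0).trans (hH0.trans (neg_neg h)))
  · exact (hφ _).trans ((loopMap_xPlus H E F (-1)).trans (hE 0))
  · exact (hφ _).trans (loopMap_xMinus H E F 0)

end LoopMap

/-! ### Generation of the Borel subalgebras by three elements. -/

theorem borelPlus_le {𝔟 : LieSubalgebra ℂ LoopSl2} (h0 : hLoop 0 ∈ 𝔟) (he : xPlus 0 ∈ 𝔟)
    (hf : xMinus 1 ∈ 𝔟) : borelPlus ≤ 𝔟 := by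
  have two : (2 : ℂ) ≠ 0 := two_ne_zero
  -- Bracketing with this element moves the modes of `xPlus` and `xMinus` up by one.
  have h1 : hLoop 1 ∈ 𝔟 := by
    rw [show (1 : ℤ) = 0 + 1 by rfl, ← lie_xPlus_xMinus]; exact 𝔟.lie_mem he hf
  have hE : ∀ n : ℕ, xPlus n ∈ 𝔟 := by
    intro n
    induction n with
    | zero => exact he
    | succ n ih =>
      have := 𝔟.smul_mem (2 : ℂ)⁻¹ (𝔟.lie_mem h1 ih)
      rwa [lie_hLoop_xPlus, smul_smul, inv_mul_cancel₀ two, one_smul, add_comm] at this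
  have hF : ∀ n : ℕ, xMinus (n + 1) ∈ 𝔟 := by
    intro n
    induction n with
    | zero => exact hf
    | succ n ih =>
      have := neg_mem (show (2 : ℂ)⁻¹ • ⁅_, _⁆ ∈ 𝔟 from 𝔟.smul_mem (2 : ℂ)⁻¹ (𝔟.lie_mem h1 ih))
      rw [lie_hLoop_xMinus, smul_neg, neg_neg, smul_smul, inv_mul_cancel₀ two, one_smul,
        add_comm] at this
      exact_mod_cast this
  refine LieSubalgebra.lieSpan_le.2 ?_
  rintro x (⟨n, hn, rfl | rfl⟩ | ⟨n, hn, rfl⟩)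
  · rcases hn.eq_or_lt with rfl | hn
    · exact h0
    · obtain ⟨k, rfl⟩ : ∃ k : ℕ, n = k + 1 := ⟨(n - 1).toNat, by omega⟩
      have := 𝔟.lie_mem he (hF k)
      rwa [lie_xPlus_xMinus, zero_add] at this
  · obtain ⟨k, rfl⟩ : ∃ k : ℕ, n = k := ⟨n.toNat, by omega⟩
    exact hE k
  · obtain ⟨k, rfl⟩ : ∃ k : ℕ, n = k + 1 := ⟨(n - 1).toNat, by omega⟩
    exact hF k

theorem borelMinus_le {𝔟 : LieSubalgebra ℂ LoopSl2} (h0 : hLoop 0 ∈ 𝔟) (he : xPlus (-1) ∈ 𝔟)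
    (hf : xMinus 0 ∈ 𝔟) : borelMinus ≤ 𝔟 := by
  have two : (2 : ℂ) ≠ 0 := two_ne_zero
  have h1 : hLoop (-1) ∈ 𝔟 := by
    rw [show (-1 : ℤ) = -1 + 0 by rfl, ← lie_xPlus_xMinus]; exact 𝔟.lie_mem he hf
  have hE : ∀ n : ℕ, xPlus (-(n + 1)) ∈ 𝔟 := by
    intro n
    induction n with
    | zero => exact he
    | succ n ih =>
      have := 𝔟.smul_mem (2 : ℂ)⁻¹ (𝔟.lie_mem h1 ih)
      rw [lie_hLoop_xPlus, smul_smul, inv_mul_cancel₀ two, one_smul] at this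
      convert this using 2
      push_cast; ring
  have hF : ∀ n : ℕ, xMinus (-n) ∈ 𝔟 := by
    intro n
    induction n with
    | zero => exact hf
    | succ n ih =>
      have := neg_mem (show (2 : ℂ)⁻¹ • ⁅_, _⁆ ∈ 𝔟 from 𝔟.smul_mem (2 : ℂ)⁻¹ (𝔟.lie_mem h1 ih))
      rw [lie_hLoop_xMinus, smul_neg, neg_neg, smul_smul, inv_mul_cancel₀ two, one_smul] at this
      convert this using 2
      push_cast; ring
  refine LieSubalgebra.lieSpan_le.2 ?_
  rintro x (⟨n, hn, rfl | rfl⟩ | ⟨n, hn, rfl⟩)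
  · rcases hn.eq_or_lt with rfl | hn
    · exact h0
    · obtain ⟨k, rfl⟩ : ∃ k : ℕ, n = k + 1 := ⟨(n - 1).toNat, by omega⟩
      have := 𝔟.lie_mem (hE k) hf
      rwa [lie_xPlus_xMinus, add_zero] at this
  · obtain ⟨k, rfl⟩ : ∃ k : ℕ, n = k := ⟨n.toNat, by omega⟩
    exact hF k
  · obtain ⟨k, rfl⟩ : ∃ k : ℕ, n = k + 1 := ⟨(n - 1).toNat, by omega⟩
    exact hE k

/-- An induction principle for a Lie subalgebra contained in every Lie subalgebra that has some
given elements. -/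
theorem LieSubalgebra.induction_of_le {R 𝔩 : Type*} [CommRing R] [LieRing 𝔩] [LieAlgebra R 𝔩]
    {𝔟 : LieSubalgebra R 𝔩} {x y z : 𝔩} (hx : x ∈ 𝔟) (hy : y ∈ 𝔟) (hz : z ∈ 𝔟)
    (hle : ∀ 𝔠 : LieSubalgebra R 𝔩, x ∈ 𝔠 → y ∈ 𝔠 → z ∈ 𝔠 → 𝔟 ≤ 𝔠) {p : 𝔟 → Prop}
    (px : p ⟨x, hx⟩) (py : p ⟨y, hy⟩) (pz : p ⟨z, hz⟩) (p0 : p 0)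
    (padd : ∀ a b, p a → p b → p (a + b)) (psmul : ∀ (r : R) a, p a → p (r • a))
    (plie : ∀ a b, p a → p b → p ⁅a, b⁆) (a : 𝔟) : p a := by
  let 𝔠 : LieSubalgebra R 𝔩 :=
    { carrier := {a | ∃ ha : a ∈ 𝔟, p ⟨a, ha⟩}
      add_mem' := fun ⟨ha, pa⟩ ⟨hb, pb⟩ => ⟨add_mem ha hb, padd _ _ pa pb⟩
      zero_mem' := ⟨zero_mem _, p0⟩
      smul_mem' := fun r _ ⟨ha, pa⟩ => ⟨𝔟.smul_mem r ha, psmul r _ pa⟩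
      lie_mem' := fun ⟨ha, pa⟩ ⟨hb, pb⟩ => ⟨𝔟.lie_mem ha hb, plie _ _ pa pb⟩ }
  obtain ⟨_, h⟩ := hle 𝔠 ⟨hx, px⟩ ⟨hy, py⟩ ⟨hz, pz⟩ a.2
  exact h

theorem LieSubalgebra.lieHom_ext_of_le {R 𝔩 𝔤 : Type*} [CommRing R] [LieRing 𝔩] [LieAlgebra R 𝔩]
    [LieRing 𝔤] [LieAlgebra R 𝔤] {𝔟 : LieSubalgebra R 𝔩} {x y z : 𝔩} (hx : x ∈ 𝔟) (hy : y ∈ 𝔟)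
    (hz : z ∈ 𝔟) (hle : ∀ 𝔠 : LieSubalgebra R 𝔩, x ∈ 𝔠 → y ∈ 𝔠 → z ∈ 𝔠 → 𝔟 ≤ 𝔠)
    {φ ψ : 𝔟 →ₗ⁅R⁆ 𝔤} (h1 : φ ⟨x, hx⟩ = ψ ⟨x, hx⟩) (h2 : φ ⟨y, hy⟩ = ψ ⟨y, hy⟩)
    (h3 : φ ⟨z, hz⟩ = ψ ⟨z, hz⟩) : φ = ψ := by
  ext a
  refine LieSubalgebra.induction_of_le hx hy hz hle (p := fun a => φ a = ψ a) h1 h2 h3 ?_ ?_ ?_ ?_ a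
  · rw [map_zero, map_zero]
  · intro a b ha hb; rw [map_add, map_add, ha, hb]
  · intro r a ha; rw [map_smul, map_smul, ha]
  · intro a b ha hb; rw [LieHom.map_lie, LieHom.map_lie, ha, hb]

/-! ### Identities for `q`-integers. -/

section QInt

variable {q : ℂ}

theorem qInt_add (hq : q ≠ 0) (m n : ℤ) :
    qInt q (m + n) = q ^ n * qInt q m + q ^ (-m) * qInt q n := by
  simp only [qInt, neg_add, zpow_add₀ hq]
  rw [mul_div_assoc', mul_div_assoc', ← add_div]
  congr 1
  have := zpow_ne_zero m hq
  have := zpow_ne_zero n hq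
  simp only [zpow_neg]
  field_simp
  ring

theorem qInt_zero : qInt q 0 = 0 := by simp [qInt]

theorem qInt_neg (n : ℤ) : qInt q (-n) = -qInt q n := by
  simp only [qInt, neg_neg]; rw [← neg_div, neg_sub]

theorem qInt_inv (n : ℤ) : qInt q⁻¹ n = qInt q n := by
  simp only [qInt, inv_zpow', neg_neg, inv_inv]
  rw [← neg_sub (q ^ n), ← neg_sub q, neg_div_neg_eq]

theorem sub_inv_ne_zero_of_sq_ne_one (hq : q ≠ 0) (hq2 : q ^ 2 ≠ 1) : q - q⁻¹ ≠ 0 := by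
  intro h
  apply hq2
  field_simp at h
  linear_combination h

theorem qInt_one (hq : q ≠ 0) (hq2 : q ^ 2 ≠ 1) : qInt q 1 = 1 := by
  simp [qInt, div_self (sub_inv_ne_zero_of_sq_ne_one hq hq2)]

theorem qInt_three (hq : q ≠ 0) (hq2 : q ^ 2 ≠ 1) : qInt q 3 = q ^ (2 : ℤ) + 1 + q ^ (-2 : ℤ) := by
  rw [qInt, div_eq_iff (sub_inv_ne_zero_of_sq_ne_one hq hq2), zpow_neg, zpow_neg]
  norm_cast
  field_simp
  ring

theorem qInt_eq_zero_iff (hq : q ≠ 0) (hq2 : q ^ 2 ≠ 1) (n : ℤ) :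
    qInt q n = 0 ↔ (q ^ 2) ^ n = 1 := by
  have h := zpow_ne_zero n hq
  rw [qInt, div_eq_zero_iff, or_iff_left (sub_inv_ne_zero_of_sq_ne_one hq hq2), sub_eq_zero,
    zpow_neg, ← div_eq_one_iff_eq (inv_ne_zero h), div_inv_eq_mul, ← zpow_natCast, ← zpow_mul,
    ← zpow_add₀ hq, Nat.cast_two, two_mul]

theorem qFactorial_succ (n : ℕ) : qFactorial q (n + 1) = qFactorial q n * qInt q (n + 1) := by
  rw [qFactorial, Finset.prod_range_succ, ← qFactorial]

theorem qFactorial_zero : qFactorial q 0 = 1 := rfl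

end QInt

/-! ### Iterated `q`-commutators and the `q`-Serre relation. -/

section QCommutators

variable {R : Type*} [Ring R] [Algebra ℂ R]

/-- The cubic `q`-Serre expression in `E` and `X`. -/
noncomputable def qSerre (q : ℂ) (E X : R) : R :=
  E ^ 3 * X - qInt q 3 • (E ^ 2 * X * E) + qInt q 3 • (E * X * E ^ 2) - X * E ^ 3

/-- The `q`-commutator `E y - q^w y E`. -/
noncomputable def qComm (q : ℂ) (E : R) (w : ℤ) (y : R) : R := E * y - q ^ w • (y * E)

/-- The iterated `q`-commutator with `E`, where the weight `w` increases by `2` at each step. -/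
noncomputable def qad (q : ℂ) (E : R) : ℕ → ℤ → R → R
  | 0, _, y => y
  | m + 1, w, y => qad q E m (w + 2) (qComm q E w y)

/-- Left and right multiplication by `E` commute, and the Serre cubic in them factors with roots `q
^ (-2)`, `1`, `q ^ 2`, because `[3]` is the sum of these. -/
theorem qad_three {q : ℂ} (hq : q ≠ 0) (hq2 : q ^ 2 ≠ 1) (E X : R) :
    qad q E 3 (-2) X = qSerre q E X := by
  have h1 : q ^ (2 : ℤ) * q ^ (-2 : ℤ) = 1 := by rw [← zpow_add₀ hq]; simp
  simp only [qad, qComm, qSerre, qInt_three hq hq2]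
  norm_num only
  simp only [zpow_zero, one_smul, mul_sub, sub_mul, smul_sub, mul_smul_comm, smul_mul_assoc,
    smul_smul, h1, pow_succ, pow_zero, one_mul, mul_assoc]
  module

/-- A twisted Leibniz rule, under which weights add. -/
theorem qComm_mul {q : ℂ} (hq : q ≠ 0) (E : R) (w v : ℤ) (x y : R) :
    qComm q E (w + v) (x * y) = qComm q E w x * y + q ^ w • (x * qComm q E v y) := by
  simp only [qComm, mul_sub, sub_mul, smul_sub, zpow_add₀ hq, mul_smul_comm, smul_mul_assoc,
    smul_smul, mul_assoc]
  abel

theorem qad_linear (q : ℂ) (E : R) (m : ℕ) :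
    ∀ (w : ℤ) (a b : ℂ) (x y : R), qad q E m w (a • x + b • y) =
      a • qad q E m w x + b • qad q E m w y := by
  induction m with
  | zero => intros; rfl
  | succ m ih =>
    intro w a b x y
    rw [qad, qad, qad, ← ih]
    congr 1
    simp only [qComm, mul_add, add_mul, smul_add, smul_sub, mul_smul_comm, smul_mul_assoc]
    rw [smul_comm a, smul_comm b]
    abel

theorem qad_zero_right (q : ℂ) (E : R) (m : ℕ) (w : ℤ) : qad q E m w 0 = 0 := by
  simpa using qad_linear q E m w 0 0 0 0

/-- By the Leibniz rule each step falls on one of the factors; among `a + b + 1` steps, more than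
`a` fall on `x` or more than `b` on `y`. -/
theorem qad_mul_eq_zero {q : ℂ} (hq : q ≠ 0) (E : R) (n : ℕ) :
    ∀ (a b : ℕ) (w v : ℤ) (x y : R), a + b = n → qad q E (a + 1) w x = 0 →
      qad q E (b + 1) v y = 0 → qad q E (n + 1) (w + v) (x * y) = 0 := by
  induction n with
  | zero =>
    intro a b w v x y h hx hy
    obtain ⟨rfl, rfl⟩ : a = 0 ∧ b = 0 := by omega
    simp only [qad] at hx hy ⊢
    rw [qComm_mul hq, hx, hy]; simp
  | succ n ih =>
    intro a b w v x y h hx hy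
    rw [qad, qComm_mul hq, ← one_smul ℂ (qComm q E w x * y), qad_linear]
    have h1 : qad q E (n + 1) (w + v + 2) (qComm q E w x * y) = 0 := by
      rcases a with _ | a
      · rw [show qComm q E w x = 0 from hx, zero_mul, qad_zero_right]
      · rw [show w + v + 2 = w + 2 + v by ring]
        exact ih a b _ _ _ _ (by omega) hx hy
    have h2 : qad q E (n + 1) (w + v + 2) (x * qComm q E v y) = 0 := by
      rcases b with _ | b
      · rw [show qComm q E v y = 0 from hy, mul_zero, qad_zero_right]
      · rw [show w + v + 2 = w + (v + 2) by ring]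
        exact ih a b _ _ _ _ (by omega) hx hy
    rw [h1, h2]; simp

/-- Each factor `X` absorbs at most two steps before it is annihilated. -/
theorem qad_pow_eq_zero {q : ℂ} (hq : q ≠ 0) (hq2 : q ^ 2 ≠ 1) {E X : R} (h : qSerre q E X = 0)
    (n : ℕ) : qad q E (2 * n + 1) (-2 * n) (X ^ n) = 0 := by
  induction n with
  | zero => simp [qad, qComm]
  | succ n ih =>
    rw [pow_succ, show (-2 * ((n + 1 : ℕ) : ℤ)) = -2 * n + -2 by push_cast; ring]
    exact qad_mul_eq_zero hq E (2 * (n + 1)) (2 * n) 2 _ _ _ _ (by ring) ih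
      ((qad_three hq hq2 E X).trans h)

theorem qad_eq_zero_of_le {q : ℂ} {E : R} {m n : ℕ} (hmn : m ≤ n) :
    ∀ {w : ℤ} {y : R}, qad q E m w y = 0 → qad q E n w y = 0 := by
  induction m generalizing n with
  | zero =>
    intro w y h
    rw [show y = 0 from h, qad_zero_right]
  | succ m ih =>
    intro w y h
    obtain ⟨n, rfl⟩ : ∃ k, n = k + 1 := ⟨n - 1, by omega⟩
    exact ih (n := n) (by omega) (show qad q E m (w + 2) (qComm q E w y) = 0 from h)

theorem qad_succ' (q : ℂ) (E : R) (m : ℕ) :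
    ∀ (w : ℤ) (y : R), qad q E (m + 1) w y = qComm q E (w + 2 * m) (qad q E m w y) := by
  induction m with
  | zero => intro w y; simp [qad]
  | succ m ih =>
    intro w y
    rw [qad, ih, qad]
    congr 1
    push_cast; ring

/-- Meant for the two summands of a coproduct. Moving `E` through the iterated `q`-commutators of
`X'` with `E'` produces exactly the weight that is subtracted, so only `E'` contributes. The same
holds for `E'` on `X` once the linear factors of the cubic are taken in the opposite order. -/
theorem qSerre_add {q : ℂ} (hq : q ≠ 0) (hq2 : q ^ 2 ≠ 1) {E X E' X' : R}
    (h1 : qSerre q E X = 0) (h2 : qSerre q E' X' = 0)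
    (hE : E * E' = q ^ (2 : ℤ) • (E' * E)) (hEX : E * X' = q ^ (-2 : ℤ) • (X' * E))
    (hXE : X * E' = q ^ (-2 : ℤ) • (E' * X)) : qSerre q (E + E') (X + X') = 0 := by
  have h22 : q ^ (2 : ℤ) * q ^ (-2 : ℤ) = 1 := by rw [← zpow_add₀ hq]; simp
  have h22' : q ^ (-2 : ℤ) * q ^ (2 : ℤ) = 1 := by rw [mul_comm]; exact h22
  have hXE' : E' * X = q ^ (2 : ℤ) • (X * E') := by rw [hXE, smul_smul, h22, one_smul]
  have hE' : E' * E = q ^ (-2 : ℤ) • (E * E') := by rw [hE, smul_smul, h22', one_smul]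
  -- `E` is invisible in the iterated `q`-commutators of `X'`
  have key1 : ∀ (w : ℤ) (y : R), E * y = q ^ w • (y * E) →
      qComm q (E + E') w y = qComm q E' w y ∧
        E * qComm q E' w y = q ^ (w + 2) • (qComm q E' w y * E) := by
    intro w y h
    constructor
    · simp only [qComm, add_mul, mul_add, smul_add, h]; abel
    · simp only [qComm, mul_sub, sub_mul, smul_sub, mul_smul_comm, smul_mul_assoc]
      rw [← mul_assoc, ← mul_assoc, hE, h, smul_mul_assoc, smul_mul_assoc, mul_assoc, mul_assoc, h,
        hE, mul_smul_comm, mul_smul_comm, smul_smul, smul_smul, zpow_add₀ hq]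
      simp only [mul_assoc]
      module
  have key2 : ∀ (w : ℤ) (y : R), E' * y = q ^ (-w) • (y * E') →
      qComm q (E + E') (-w) y = qComm q E (-w) y ∧
        E' * qComm q E (-w) y = q ^ (-(w + 2)) • (qComm q E (-w) y * E') := by
    intro w y h
    constructor
    · simp only [qComm, add_mul, mul_add, smul_add, h]; abel
    · simp only [qComm, mul_sub, sub_mul, smul_sub, mul_smul_comm, smul_mul_assoc]
      rw [← mul_assoc, ← mul_assoc, hE', h, smul_mul_assoc, smul_mul_assoc, mul_assoc, mul_assoc, h,
        hE', mul_smul_comm, mul_smul_comm, smul_smul, smul_smul, neg_add, zpow_add₀ hq]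
      simp only [mul_assoc]
      module
  have lin : qSerre q (E + E') (X + X') = qSerre q (E + E') X + qSerre q (E + E') X' := by
    simp only [qSerre, mul_add, add_mul, smul_add]; abel
  -- The linear factors of the cubic commute, so the weights may also run through `2, 0, -2`.
  have comm3 : ∀ E X : R, qComm q E (-2) (qComm q E 0 (qComm q E 2 X)) = qSerre q E X := by
    intro E X
    simp only [qComm, qSerre, qInt_three hq hq2]
    simp only [zpow_zero, one_smul, mul_sub, sub_mul, smul_sub, mul_smul_comm, smul_mul_assoc,
      smul_smul, h22', pow_succ, pow_zero, one_mul, mul_assoc]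
    module
  have s2 : qSerre q (E + E') X' = 0 := by
    obtain ⟨a1, b1⟩ := key1 _ _ hEX
    obtain ⟨a2, b2⟩ := key1 _ _ b1
    obtain ⟨a3, b3⟩ := key1 _ _ b2
    rw [← qad_three hq hq2]
    simp only [qad]
    rw [a1, a2, a3, ← h2, ← qad_three hq hq2]
    rfl
  have s1 : qSerre q (E + E') X = 0 := by
    obtain ⟨a1, b1⟩ := key2 (-2) X (by rw [hXE']; rfl)
    obtain ⟨a2, b2⟩ := key2 (-2 + 2) _ b1
    obtain ⟨a3, b3⟩ := key2 (-2 + 2 + 2) _ b2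
    rw [← comm3]
    rw [show -(-2 : ℤ) = 2 by rfl] at a1 a2 a3
    rw [show -(-2 + 2 : ℤ) = 0 by rfl] at a2 a3
    rw [show -(-2 + 2 + 2 : ℤ) = -2 by rfl] at a3
    rw [a1, a2, a3, comm3, h1]
  rw [lin, s1, s2, add_zero]

end QCommutators

/-! ### Divided powers and `q`-binomial expansions. -/

section DividedPowers

variable {R : Type*} [Ring R] [Algebra ℂ R] {q : ℂ}

/-- The divided power `E^n / [n]!`. -/
noncomputable def divPow (q : ℂ) (E : R) (n : ℕ) : R := (qFactorial q n)⁻¹ • E ^ n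

theorem divPow_zero (q : ℂ) (E : R) : divPow q E 0 = 1 := by simp [divPow, qFactorial_zero]

theorem qFactorial_ne_zero_of_le {m n : ℕ} (hmn : m ≤ n) (hn : qFactorial q n ≠ 0) :
    qFactorial q m ≠ 0 := by
  rw [qFactorial, Finset.prod_ne_zero_iff] at hn ⊢
  exact fun j hj => hn j (Finset.range_mono hmn hj)

theorem qInt_ne_zero_of_qFactorial {n : ℕ} (hn : qFactorial q (n + 1) ≠ 0) :
    qInt q (n + 1) ≠ 0 := by
  rw [qFactorial_succ] at hn
  exact right_ne_zero_of_mul hn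

theorem mul_divPow {n : ℕ} (hn : qInt q (n + 1) ≠ 0) (E : R) :
    E * divPow q E n = qInt q (n + 1) • divPow q E (n + 1) := by
  rw [divPow, divPow, qFactorial_succ, mul_inv, smul_smul, mul_smul_comm, ← pow_succ',
    mul_left_comm, mul_inv_cancel₀ hn, mul_one]

theorem divPow_mul {n : ℕ} (hn : qInt q (n + 1) ≠ 0) (E : R) :
    divPow q E n * E = qInt q (n + 1) • divPow q E (n + 1) := by
  rw [divPow, divPow, qFactorial_succ, mul_inv, smul_smul, smul_mul_assoc, ← pow_succ,
    mul_left_comm, mul_inv_cancel₀ hn, mul_one]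

theorem divPow_mul_divPow {m n : ℕ} (h : qFactorial q (m + n) ≠ 0) (E : R) :
    divPow q E m * divPow q E n =
      (qFactorial q (m + n) / (qFactorial q m * qFactorial q n)) • divPow q E (m + n) := by
  rw [divPow, divPow, divPow, smul_mul_smul_comm, ← pow_add, smul_smul]
  congr 1
  field_simp

theorem sum_antidiagonal_succ_add {M : Type*} [AddCommMonoid M] (m : ℕ) (f g : ℕ × ℕ → M)
    (hf : f (0, m + 1) = 0) (hg : g (m + 1, 0) = 0) :
    ∑ p ∈ Finset.HasAntidiagonal.antidiagonal (m + 1), (f p + g p) =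
      ∑ p ∈ Finset.HasAntidiagonal.antidiagonal m, (f (p.1 + 1, p.2) + g (p.1, p.2 + 1)) := by
  rw [Finset.sum_add_distrib, Finset.sum_add_distrib, Finset.Nat.sum_antidiagonal_succ (f := f),
    Finset.Nat.sum_antidiagonal_succ' (f := g), hf, hg, zero_add, zero_add]

/-- An iterated `q`-commutator is a product of linear factors in left and right multiplication by
`E`. The `q`-binomial theorem expands it, and divided powers absorb the binomial coefficients; the
induction splits `[m + 1]` over the two exponents. -/
theorem qad_eq_sum (hq : q ≠ 0) (E : R) (w : ℤ) (y : R) (m : ℕ) (hm : qFactorial q m ≠ 0) :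
    (qFactorial q m)⁻¹ • qad q E m w y = ∑ p ∈ Finset.HasAntidiagonal.antidiagonal m,
      ((-1) ^ p.2 * q ^ ((p.2 : ℤ) * (w + m - 1))) • (divPow q E p.1 * y * divPow q E p.2) := by
  induction m with
  | zero => simp [qad, divPow_zero, qFactorial_zero]
  | succ m ih =>
    have hm' := qFactorial_ne_zero_of_le (Nat.le_succ m) hm
    have hm1 := qInt_ne_zero_of_qFactorial hm
    have hint : ∀ i ≤ m, qInt q (i + 1) ≠ 0 := fun i hi =>
      qInt_ne_zero_of_qFactorial (qFactorial_ne_zero_of_le (by omega) hm)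
    have lin : ∀ (c : ℂ) (x : R), qComm q E (w + 2 * m) (c • x) = c • qComm q E (w + 2 * m) x := by
      intro c x
      simp only [qComm, smul_sub, mul_smul_comm, smul_mul_assoc]; rw [smul_comm c]
    apply smul_right_injective _ hm1
    dsimp only
    rw [qad_succ', qFactorial_succ, mul_inv, smul_smul, mul_left_comm, mul_inv_cancel₀ hm1, mul_one,
      ← lin, ih hm', Finset.smul_sum]
    have e1 : ∀ p ∈ Finset.HasAntidiagonal.antidiagonal (m + 1),
        qInt q (m + 1) • (((-1) ^ p.2 * q ^ ((p.2 : ℤ) * (w + (m + 1 : ℕ) - 1))) •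
          (divPow q E p.1 * y * divPow q E p.2)) =
        ((-1) ^ p.2 * q ^ ((p.2 : ℤ) * (w + m - 1)) * qInt q p.1) •
          (divPow q E p.1 * y * divPow q E p.2) +
        ((-1) ^ p.2 * q ^ ((p.2 : ℤ) * (w + m) + p.1) * qInt q p.2) •
          (divPow q E p.1 * y * divPow q E p.2) := by
      intro p hp
      rw [Finset.HasAntidiagonal.mem_antidiagonal] at hp
      rw [smul_smul, ← add_smul]
      congr 1
      rw [show ((m : ℤ) + 1) = (p.2 : ℤ) + p.1 by omega, qInt_add hq, zpow_add₀ hq _ (p.1 : ℤ),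
        show (p.2 : ℤ) * (w + m - 1) = (p.2 : ℤ) * (w + m) + -p.2 by ring, zpow_add₀ hq _ (-(p.2 : ℤ)),
        show (p.2 : ℤ) * (w + (m + 1 : ℕ) - 1) = (p.2 : ℤ) * (w + m) by push_cast; ring]
      ring
    rw [Finset.sum_congr rfl e1, sum_antidiagonal_succ_add m
      (fun p => ((-1) ^ p.2 * q ^ ((p.2 : ℤ) * (w + m - 1)) * qInt q p.1) •
          (divPow q E p.1 * y * divPow q E p.2))
      (fun p => ((-1) ^ p.2 * q ^ ((p.2 : ℤ) * (w + m) + p.1) * qInt q p.2) •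
          (divPow q E p.1 * y * divPow q E p.2)) (by simp [qInt_zero]) (by simp [qInt_zero]),
      qComm, Finset.mul_sum, Finset.sum_mul, Finset.smul_sum, ← Finset.sum_sub_distrib]
    refine Finset.sum_congr rfl fun p hp => ?_
    rw [Finset.HasAntidiagonal.mem_antidiagonal] at hp
    rw [mul_smul_comm, smul_mul_assoc, ← mul_assoc, ← mul_assoc, mul_divPow (hint _ (by omega)),
      mul_assoc _ (divPow q E p.2), divPow_mul (hint _ (by omega)), mul_smul_comm, smul_mul_assoc,
      smul_mul_assoc, smul_smul, smul_smul, smul_smul, sub_eq_add_neg, ← neg_smul]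
    congr 2
    · rw [show ((p.2 + 1 : ℕ) : ℤ) * (w + m) + p.1 = (w + 2 * m) + (p.2 : ℤ) * (w + m - 1) by
        push_cast; rw [show (m : ℤ) = p.1 + p.2 by omega]; ring, zpow_add₀ hq (w + 2 * m) ((p.2 : ℤ) * (w + m - 1))]
      push_cast; ring

/-- The `q`-binomial theorem. In divided powers only powers of `q` remain as coefficients, so the
expansion is harmless in the limit at a root of unity. -/
theorem divPow_add (hq : q ≠ 0) {E E' : R} (h : E * E' = q ^ (2 : ℤ) • (E' * E)) (m : ℕ)
    (hm : qFactorial q m ≠ 0) : divPow q (E + E') m = ∑ p ∈ Finset.HasAntidiagonal.antidiagonal m,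
      q ^ (-((p.1 : ℤ) * p.2)) • (divPow q E p.1 * divPow q E' p.2) := by
  have h' : E' * E = q ^ (-2 : ℤ) • (E * E') := by
    rw [h, smul_smul, ← zpow_add₀ hq]; simp
  have hpow : ∀ i : ℕ, E' * E ^ i = q ^ (-2 * (i : ℤ)) • (E ^ i * E') := by
    intro i
    induction i with
    | zero => simp
    | succ i ih =>
      rw [pow_succ, ← mul_assoc, ih, smul_mul_assoc, mul_assoc, h', mul_smul_comm, smul_smul,
        ← zpow_add₀ hq, mul_assoc]
      congr 2; push_cast; ring
  have hdiv : ∀ i : ℕ, E' * divPow q E i = q ^ (-2 * (i : ℤ)) • (divPow q E i * E') := by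
    intro i
    rw [divPow, mul_smul_comm, hpow, smul_comm, smul_mul_assoc]
  induction m with
  | zero => simp [divPow_zero]
  | succ m ih =>
    have hm' := qFactorial_ne_zero_of_le (Nat.le_succ m) hm
    have hm1 := qInt_ne_zero_of_qFactorial hm
    have hint : ∀ i ≤ m, qInt q (i + 1) ≠ 0 := fun i hi =>
      qInt_ne_zero_of_qFactorial (qFactorial_ne_zero_of_le (by omega) hm)
    apply smul_right_injective _ hm1
    dsimp only
    rw [← mul_divPow hm1, ih hm', Finset.smul_sum]
    have e1 : ∀ p ∈ Finset.HasAntidiagonal.antidiagonal (m + 1),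
        qInt q (m + 1) • (q ^ (-((p.1 : ℤ) * p.2)) • (divPow q E p.1 * divPow q E' p.2)) =
        (q ^ (-((p.1 : ℤ) * p.2) + p.2) * qInt q p.1) • (divPow q E p.1 * divPow q E' p.2) +
        (q ^ (-((p.1 : ℤ) * p.2) + -p.1) * qInt q p.2) • (divPow q E p.1 * divPow q E' p.2) := by
      intro p hp
      rw [Finset.HasAntidiagonal.mem_antidiagonal] at hp
      rw [smul_smul, ← add_smul]
      congr 1
      rw [show ((m : ℤ) + 1) = (p.1 : ℤ) + p.2 by omega, qInt_add hq, zpow_add₀ hq _ (p.2 : ℤ),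
        zpow_add₀ hq _ (-(p.1 : ℤ))]
      ring
    rw [Finset.sum_congr rfl e1, sum_antidiagonal_succ_add m
      (fun p => (q ^ (-((p.1 : ℤ) * p.2) + p.2) * qInt q p.1) •
        (divPow q E p.1 * divPow q E' p.2))
      (fun p => (q ^ (-((p.1 : ℤ) * p.2) + -p.1) * qInt q p.2) •
        (divPow q E p.1 * divPow q E' p.2)) (by simp [qInt_zero]) (by simp [qInt_zero]),
      Finset.mul_sum]
    refine Finset.sum_congr rfl fun p hp => ?_
    rw [Finset.HasAntidiagonal.mem_antidiagonal] at hp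
    rw [mul_smul_comm, add_mul, smul_add, ← mul_assoc, ← mul_assoc, hdiv, smul_mul_assoc,
      mul_assoc _ E', mul_divPow (hint _ (by omega)), mul_divPow (hint _ (by omega)), mul_smul_comm,
      smul_mul_assoc, smul_smul, smul_smul, smul_smul]
    congr 2
    · congr 2; push_cast; ring
    · rw [← zpow_add₀ hq]; congr 2; push_cast; ring

/-- The alternating sum of the first `n + 1` coefficients of the `q`-binomial theorem. -/
theorem sum_qBinomial (hq : q ≠ 0) (t : ℤ) (n : ℕ)
    (hn : qFactorial q n ≠ 0) :
    ∑ l ∈ Finset.range (n + 1), (-1) ^ l * q ^ ((l : ℤ) * (1 - t)) *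
        ∏ k ∈ Finset.range l, (qInt q (t - k) / qInt q (k + 1)) =
      (-1) ^ n * q ^ (-((n : ℤ) * t)) *
        ∏ k ∈ Finset.range n, (qInt q (t - 1 - k) / qInt q (k + 1)) := by
  induction n with
  | zero => simp
  | succ n ih =>
    have hn1 := qInt_ne_zero_of_qFactorial hn
    rw [Finset.sum_range_succ, ih (qFactorial_ne_zero_of_le (Nat.le_succ n) hn),
      Finset.prod_range_succ' (fun k => qInt q (t - k) / qInt q (k + 1)),
      Finset.prod_range_succ (fun k => qInt q (t - 1 - k) / qInt q (k + 1))]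
    have e1 : (∏ k ∈ Finset.range n, (qInt q (t - (k + 1 : ℕ)) / qInt q ((k + 1 : ℕ) + 1))) *
        (qInt q (t - (0 : ℕ)) / qInt q ((0 : ℕ) + 1)) =
        (∏ k ∈ Finset.range n, (qInt q (t - 1 - k) / qInt q (k + 1))) *
          (qInt q t / qInt q (n + 1)) := by
      rw [Finset.prod_div_distrib, Finset.prod_div_distrib, div_mul_div_comm, div_mul_div_comm]
      congr 1
      · congr 1
        · refine Finset.prod_congr rfl fun k _ => ?_
          congr 1; push_cast; ring
        · simp
      · rw [← Finset.prod_range_succ' (fun k : ℕ => qInt q ((k : ℤ) + 1)),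
          Finset.prod_range_succ]
    rw [e1]
    set P := ∏ k ∈ Finset.range n, (qInt q (t - 1 - k) / qInt q (k + 1))
    -- With this splitting, the first part of the new term cancels the previous partial sum.
    have e2 : qInt q t = q ^ (t - 1 - n) * qInt q (n + 1) + q ^ (-((n : ℤ) + 1)) *
        qInt q (t - 1 - n) := by
      rw [← qInt_add hq]; congr 1; ring
    have e3 : q ^ (-((n : ℤ) * t)) = q ^ (((n + 1 : ℕ) : ℤ) * (1 - t)) * q ^ (t - 1 - n) := by
      rw [← zpow_add₀ hq]; congr 1; push_cast; ring
    have e4 : q ^ (-(((n + 1 : ℕ) : ℤ) * t)) = q ^ (((n + 1 : ℕ) : ℤ) * (1 - t)) *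
        q ^ (-((n : ℤ) + 1)) := by
      rw [← zpow_add₀ hq]; congr 1; push_cast; ring
    rw [e2, e3, e4]
    field_simp
    ring

end DividedPowers

/-! ### The higher order `q`-Serre relation. -/

section HigherSerre

variable {R : Type*} [Ring R] [Algebra ℂ R] {q : ℂ}

theorem qFactorial_add (q : ℂ) (r j : ℕ) : qFactorial q (r + j) =
    qFactorial q r * ∏ k ∈ Finset.range j, qInt q (r + k + 1) := by
  rw [qFactorial, Finset.prod_range_add, ← qFactorial]
  push_cast
  rfl

theorem qFactorial_div {r j : ℕ} (h : qFactorial q (r + j) ≠ 0) :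
    qFactorial q (r + j) / (qFactorial q r * qFactorial q j) =
      ∏ k ∈ Finset.range j, (qInt q ((r + j : ℕ) - k) / qInt q (k + 1)) := by
  have hr := qFactorial_ne_zero_of_le (Nat.le_add_right r j) h
  rw [qFactorial_add, mul_div_mul_left _ _ hr, Finset.prod_div_distrib, ← qFactorial,
    ← Finset.prod_range_reflect]
  congr 1
  refine Finset.prod_congr rfl fun k hk => ?_
  rw [Finset.mem_range] at hk
  congr 1
  omega

/-- Since `3 * N - j > 2 * N`, the iterated `q`-commutator of length `3 * N - j` annihilates the
divided power of `X`. Its expansion is multiplied on the right by the `j`th divided power of `E`;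
merging the two right-hand divided powers produces the `q`-binomial of `t` over `j`. -/
theorem sum_divPow_mul_divPow_eq_zero (hq : q ≠ 0) (hq2 : q ^ 2 ≠ 1) {E X : R}
    (h : qSerre q E X = 0) {N j : ℕ} (hj : j < N) (hN : qFactorial q (3 * N) ≠ 0) :
    ∑ t ∈ Finset.range (3 * N + 1), ((-1) ^ t * q ^ ((t : ℤ) * (N - 1)) *
      ((-1) ^ j * q ^ ((j : ℤ) * (1 - t)) *
        ∏ k ∈ Finset.range j, (qInt q (t - k) / qInt q (k + 1)))) •
      (divPow q E (3 * N - t) * divPow q X N * divPow q E t) = 0 := by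
  have hm : qFactorial q (3 * N - j) ≠ 0 := qFactorial_ne_zero_of_le (Nat.sub_le _ _) hN
  have h0 : qad q E (3 * N - j) (-2 * N) (divPow q X N) = 0 := by
    have h1 := qad_linear q E (3 * N - j) (-2 * N) (qFactorial q N)⁻¹ 0 (X ^ N) 0
    rw [zero_smul, add_zero, zero_smul, add_zero,
      qad_eq_zero_of_le (by omega) (qad_pow_eq_zero hq hq2 h N), smul_zero] at h1
    exact h1
  have h1 := qad_eq_sum hq E (-2 * N) (divPow q X N) _ hm
  rw [h0, smul_zero, ← Finset.Nat.sum_antidiagonal_swap,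
    Finset.Nat.sum_antidiagonal_eq_sum_range_succ_mk] at h1
  rw [show 3 * N + 1 = j + (3 * N - j).succ by omega, Finset.sum_range_add]
  -- For `t < j` the `q`-binomial contains the factor `[0]`.
  have z : ∀ t ∈ Finset.range j, ((-1) ^ t * q ^ ((t : ℤ) * (N - 1)) *
      ((-1) ^ j * q ^ ((j : ℤ) * (1 - t)) *
        ∏ k ∈ Finset.range j, (qInt q (t - k) / qInt q (k + 1)))) •
      (divPow q E (3 * N - t) * divPow q X N * divPow q E t) = 0 := by
    intro t ht
    rw [Finset.prod_eq_zero ht (by rw [sub_self, qInt_zero, zero_div]), mul_zero, mul_zero, zero_smul]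
  rw [Finset.sum_eq_zero z, zero_add]
  have h2 := congrArg (fun x => (q ^ ((j : ℤ) * (N - j)) : ℂ) • (x * divPow q E j)) h1
  simp only [zero_mul, smul_zero, Finset.sum_mul, Finset.smul_sum] at h2
  rw [h2]
  refine Finset.sum_congr rfl fun r hr => ?_
  rw [Finset.mem_range] at hr
  have hrj : qFactorial q (r + j) ≠ 0 := qFactorial_ne_zero_of_le (by omega) hN
  simp only [Prod.fst_swap, Prod.snd_swap]
  rw [smul_mul_assoc, mul_assoc _ (divPow q E r), divPow_mul_divPow hrj, qFactorial_div hrj,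
    mul_smul_comm, smul_smul, smul_smul, add_comm j r, show 3 * N - (r + j) = 3 * N - j - r by omega]
  congr 1
  have e1 : q ^ (((r + j : ℕ) : ℤ) * (N - 1)) * q ^ ((j : ℤ) * (1 - (r + j : ℕ))) =
      q ^ ((j : ℤ) * (N - j)) * q ^ ((r : ℤ) * (-2 * N + (3 * N - j : ℕ) - 1)) := by
    rw [← zpow_add₀ hq, ← zpow_add₀ hq]
    congr 1
    push_cast [show j ≤ 3 * N by omega]
    ring
  have e2 : (-1 : ℂ) ^ (r + j) * (-1) ^ j = (-1) ^ r := by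
    rw [pow_add, mul_assoc, ← mul_pow]; simp
  linear_combination ((-1) ^ (r + j) * (-1) ^ j *
    ∏ k ∈ Finset.range j, (qInt q ((r + j : ℕ) - k) / qInt q (k + 1))) * e1 +
    (q ^ ((j : ℤ) * (N - j)) * q ^ ((r : ℤ) * (-2 * N + (3 * N - j : ℕ) - 1)) *
    ∏ k ∈ Finset.range j, (qInt q ((r + j : ℕ) - k) / qInt q (k + 1))) * e2

/-- The higher order `q`-Serre relation for divided powers. -/
theorem sum_divPow_eq_zero (hq : q ≠ 0) (hq2 : q ^ 2 ≠ 1) {E X : R}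
    (h : qSerre q E X = 0) {n : ℕ} (hN : qFactorial q (3 * (n + 1)) ≠ 0) :
    ∑ t ∈ Finset.range (3 * (n + 1) + 1),
      ((-1) ^ t * ∏ k ∈ Finset.range n, (qInt q (t - 1 - k) / qInt q (k + 1))) •
      (divPow q E (3 * (n + 1) - t) * divPow q X (n + 1) * divPow q E t) = 0 := by
  -- The sum of all these relations over `j ≤ n` has truncated `q`-binomial sums as coefficients. By
  -- `sum_qBinomial` they become, up to sign, the `q`-binomials of `t - 1` over `n`, which at the
  -- root of unity detect divisibility of `t` by `n + 1`.
  have h1 : ∑ j ∈ Finset.range (n + 1), ∑ t ∈ Finset.range (3 * (n + 1) + 1),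
      ((-1) ^ t * q ^ ((t : ℤ) * ((n + 1 : ℕ) - 1)) *
      ((-1) ^ j * q ^ ((j : ℤ) * (1 - t)) *
        ∏ k ∈ Finset.range j, (qInt q (t - k) / qInt q (k + 1)))) •
      (divPow q E (3 * (n + 1) - t) * divPow q X (n + 1) * divPow q E t) = 0 :=
    Finset.sum_eq_zero fun j hj =>
      sum_divPow_mul_divPow_eq_zero hq hq2 h (Finset.mem_range.1 hj) hN
  rw [Finset.sum_comm] at h1
  have h2 := congrArg (fun x => ((-1) ^ n : ℂ) • x) h1
  simp only [smul_zero] at h2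
  rw [← h2, Finset.smul_sum]
  refine Finset.sum_congr rfl fun t _ => ?_
  rw [← Finset.sum_smul, ← Finset.mul_sum,
    sum_qBinomial hq t n (qFactorial_ne_zero_of_le (by omega) hN), smul_smul]
  congr 1
  have e1 : q ^ ((t : ℤ) * ((n + 1 : ℕ) - 1)) * q ^ (-((n : ℤ) * t)) = 1 := by
    rw [← zpow_add₀ hq, ← zpow_zero q]; congr 1; push_cast; ring
  have e2 : (-1 : ℂ) ^ n * (-1) ^ n = 1 := by rw [← mul_pow]; simp
  linear_combination (-(-1) ^ t * (-1) ^ n * (-1) ^ n *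
      ∏ k ∈ Finset.range n, (qInt q (t - 1 - k) / qInt q (k + 1))) * e1 -
    ((-1) ^ t * ∏ k ∈ Finset.range n, (qInt q (t - 1 - k) / qInt q (k + 1))) * e2

end HigherSerre

/-! ### `q`-integers and `q`-factorials near a root of unity. -/

section QIntLimits

variable {q₀ : ℂ} {N : ℕ}

theorem continuousAt_qInt {q : ℂ} (hq : q ≠ 0) (hq2 : q ^ 2 ≠ 1) (n : ℤ) :
    ContinuousAt (fun q => qInt q n) q := by
  unfold qInt
  refine ContinuousAt.div₀ ?_ ?_ (sub_inv_ne_zero_of_sq_ne_one hq hq2)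
  · exact (continuousAt_zpow₀ q n (Or.inl hq)).sub (continuousAt_zpow₀ q (-n) (Or.inl hq))
  · exact continuousAt_id.sub (continuousAt_inv₀ hq)

theorem continuousAt_qFactorial {q : ℂ} (hq : q ≠ 0) (hq2 : q ^ 2 ≠ 1) (n : ℕ) :
    ContinuousAt (fun q => qFactorial q n) q := by
  unfold qFactorial
  exact tendsto_finsetProd _ fun k _ => continuousAt_qInt hq hq2 _

theorem eventually_pow_ne_one (q₀ : ℂ) {n : ℕ} (hn : 0 < n) : ∀ᶠ q in 𝓝[≠] q₀, q ^ n ≠ 1 := by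
  have hfin : {q : ℂ | q ^ n = 1}.Finite := by
    refine (Polynomial.nthRootsFinset n (1 : ℂ)).finite_toSet.subset fun q hq => ?_
    simpa [Polynomial.mem_nthRootsFinset hn] using hq
  have h := (hfin.subset (Set.sdiff_subset (t := {q₀}))).isClosed.isOpen_compl.mem_nhds
    (show q₀ ∈ ({q : ℂ | q ^ n = 1} \ {q₀})ᶜ by simp)
  rw [eventually_nhdsWithin_iff]
  filter_upwards [h] with q hq hq' h1
  exact hq ⟨h1, hq'⟩

theorem eventually_qFactorial_ne_zero (hq₀ : q₀ ≠ 0) (n : ℕ) :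
    ∀ᶠ q in 𝓝[≠] q₀, q ≠ 0 ∧ q ^ 2 ≠ 1 ∧ qFactorial q n ≠ 0 := by
  have h0 : ∀ᶠ q in 𝓝[≠] q₀, q ≠ 0 :=
    (continuousAt_id.eventually_ne hq₀).filter_mono nhdsWithin_le_nhds
  have h1 : ∀ᶠ q in 𝓝[≠] q₀, ∀ k ∈ Finset.range n, q ^ (2 * (k + 1)) ≠ 1 := by
    rw [Filter.eventually_all_finset]
    exact fun k _ => eventually_pow_ne_one q₀ (by omega)
  filter_upwards [h0, eventually_pow_ne_one q₀ two_pos, h1] with q hq hq2 hk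
  refine ⟨hq, hq2, ?_⟩
  rw [qFactorial, Finset.prod_ne_zero_iff]
  intro k hk'
  rw [Ne, qInt_eq_zero_iff hq hq2]
  have := hk k hk'
  rw [pow_mul] at this
  exact_mod_cast this

theorem qInt_ne_zero_of_lt (hq₀ : q₀ ≠ 0) (hN : 2 ≤ N) (hp : IsPrimitiveRoot (q₀ ^ 2) N) {n : ℤ}
    (hn : ¬ (N : ℤ) ∣ n) : qInt q₀ n ≠ 0 := by
  have hq2 : q₀ ^ 2 ≠ 1 := hp.ne_one (by omega)
  rw [Ne, qInt_eq_zero_iff hq₀ hq2, hp.zpow_eq_one_iff_dvd]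
  exact hn

theorem qFactorial_ne_zero_of_lt (hq₀ : q₀ ≠ 0) (hN : 2 ≤ N) (hp : IsPrimitiveRoot (q₀ ^ 2) N)
    {n : ℕ} (hn : n < N) : qFactorial q₀ n ≠ 0 := by
  rw [qFactorial, Finset.prod_ne_zero_iff]
  intro k hk
  rw [Finset.mem_range] at hk
  refine qInt_ne_zero_of_lt hq₀ hN hp fun h => ?_
  have := Int.le_of_dvd (by omega) h
  omega

theorem qInt_mul_eq_zero (hq₀ : q₀ ≠ 0) (hN : 2 ≤ N) (hp : IsPrimitiveRoot (q₀ ^ 2) N) (a : ℤ) :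
    qInt q₀ (a * N) = 0 := by
  rw [qInt_eq_zero_iff hq₀ (hp.ne_one (by omega)), hp.zpow_eq_one_iff_dvd]
  exact dvd_mul_left _ _

theorem pow_sq_eq_one (hε : q₀ ^ N = (-1) ^ (N + 1)) : (q₀ ^ N) ^ 2 = 1 := by
  rw [hε, ← pow_mul, mul_comm, pow_mul]; simp

theorem pow_pow_eq_one (hε : q₀ ^ N = (-1) ^ (N + 1)) : (q₀ ^ N) ^ N = 1 := by
  rw [hε, ← pow_mul]
  exact Even.neg_one_pow (by rw [mul_comm]; exact Nat.even_mul_succ_self N)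

theorem zpow_mul_eq (hε : q₀ ^ N = (-1) ^ (N + 1)) (a : ℕ) :
    q₀ ^ (-((a : ℤ) * N)) = (q₀ ^ N) ^ a := by
  have h : (q₀ ^ N) ^ a * (q₀ ^ N) ^ a = 1 := by
    rw [← pow_add, ← two_mul, pow_mul, pow_sq_eq_one hε, one_pow]
  rw [zpow_neg, mul_comm, zpow_mul, zpow_natCast, zpow_natCast]
  exact inv_eq_of_mul_eq_one_left h

theorem qInt_mul_add (hq₀ : q₀ ≠ 0) (hN : 2 ≤ N) (hp : IsPrimitiveRoot (q₀ ^ 2) N)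
    (hε : q₀ ^ N = (-1) ^ (N + 1)) (a : ℕ) (j : ℤ) :
    qInt q₀ (a * N + j) = (q₀ ^ N) ^ a * qInt q₀ j := by
  rw [qInt_add hq₀, qInt_mul_eq_zero hq₀ hN hp, mul_zero, zero_add, zpow_mul_eq hε]

/-- Numerator and denominator both vanish at `q₀`. Dividing the addition formula for `[(a + 1) N]`
by `[N]` gives a recursion in `a` without singularity. -/
theorem tendsto_qInt_mul_div (hq₀ : q₀ ≠ 0) (hε : q₀ ^ N = (-1) ^ (N + 1)) (a : ℕ)
    (hN : 1 ≤ N) :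
    Tendsto (fun q => qInt q (a * N) / qInt q N) (𝓝[≠] q₀) (𝓝 (a * (q₀ ^ N) ^ (a + 1))) := by
  induction a with
  | zero => simp [qInt_zero]
  | succ a ih =>
    have h1 : Tendsto (fun q : ℂ => q ^ N * (qInt q (a * N) / qInt q N) + q ^ (-((a : ℤ) * N)))
        (𝓝[≠] q₀) (𝓝 (q₀ ^ N * (a * (q₀ ^ N) ^ (a + 1)) + q₀ ^ (-((a : ℤ) * N)))) := by
      refine Tendsto.add (Tendsto.mul ?_ ih) ?_
      · exact ((continuous_pow N).tendsto q₀).mono_left nhdsWithin_le_nhds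
      · exact (continuousAt_zpow₀ q₀ _ (Or.inl hq₀)).tendsto.mono_left nhdsWithin_le_nhds
    have e1 : q₀ ^ N * (a * (q₀ ^ N) ^ (a + 1)) + q₀ ^ (-((a : ℤ) * N)) =
        ((a + 1 : ℕ) : ℂ) * (q₀ ^ N) ^ (a + 1 + 1) := by
      have h2 : (q₀ ^ N) ^ (a + 1 + 1) = (q₀ ^ N) ^ a := by
        rw [add_assoc, pow_add, pow_sq_eq_one hε, mul_one]
      rw [zpow_mul_eq hε, h2, mul_left_comm, ← pow_succ', h2]
      push_cast; ring
    rw [← e1]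
    refine h1.congr' ?_
    filter_upwards [eventually_qFactorial_ne_zero hq₀ N] with q ⟨hq, hq2, hfac⟩
    obtain ⟨n, rfl⟩ : ∃ n, N = n + 1 := ⟨N - 1, by omega⟩
    have hN0 : qInt q (n + 1 : ℕ) ≠ 0 := by exact_mod_cast qInt_ne_zero_of_qFactorial hfac
    rw [show ((a + 1 : ℕ) : ℤ) * (n + 1 : ℕ) = a * (n + 1 : ℕ) + (n + 1 : ℕ) by push_cast; ring,
      qInt_add hq (a * (n + 1 : ℕ))]
    field_simp
    norm_cast
    ring

/-- Put `ε = q₀ ^ N`. Of the `N` quotients, `N - 1` are regular and contribute `ε ^ a` each, while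
the last is `0 / 0` and contributes `(a + 1) ε ^ (a + 2)`. The signs cancel because `ε ^ 2 = 1` and
`ε ^ N = 1`. -/
theorem tendsto_qFactorial_div (hq₀ : q₀ ≠ 0) (hN : 2 ≤ N) (hp : IsPrimitiveRoot (q₀ ^ 2) N)
    (hε : q₀ ^ N = (-1) ^ (N + 1)) (a : ℕ) :
    Tendsto (fun q => qFactorial q ((a + 1) * N) / (qFactorial q (a * N) * qFactorial q N))
      (𝓝[≠] q₀) (𝓝 (a + 1)) := by
  have hq2 : q₀ ^ 2 ≠ 1 := hp.ne_one (by omega)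
  obtain ⟨n, rfl⟩ : ∃ n, N = n + 1 := ⟨N - 1, by omega⟩
  set ε := q₀ ^ (n + 1) with hεdef
  have h1 : Tendsto (fun q => (∏ k ∈ Finset.range n,
      (qInt q ((a : ℤ) * (n + 1 : ℕ) + (k + 1)) / qInt q (k + 1))) *
      (qInt q ((a + 1 : ℕ) * (n + 1 : ℕ)) / qInt q (n + 1 : ℕ))) (𝓝[≠] q₀)
      (𝓝 ((∏ k ∈ Finset.range n, ε ^ a) * (((a + 1 : ℕ) : ℂ) * ε ^ (a + 1 + 1)))) := by
    refine Tendsto.mul (tendsto_finsetProd _ fun k hk => ?_)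
      (tendsto_qInt_mul_div hq₀ hε (a + 1) (by omega))
    have hk0 : qInt q₀ (k + 1) ≠ 0 := by
      refine qInt_ne_zero_of_lt hq₀ hN hp fun h => ?_
      have := Int.le_of_dvd (by omega) h
      rw [Finset.mem_range] at hk
      push_cast at this
      omega
    have h2 : qInt q₀ ((a : ℤ) * (n + 1 : ℕ) + (k + 1)) / qInt q₀ (k + 1) = ε ^ a := by
      rw [qInt_mul_add hq₀ hN hp hε, mul_div_cancel_right₀ _ hk0]
    rw [← h2]
    exact ((continuousAt_qInt hq₀ hq2 _).div₀ (continuousAt_qInt hq₀ hq2 _) hk0).tendsto.mono_left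
      nhdsWithin_le_nhds
  have h3 : (∏ k ∈ Finset.range n, ε ^ a) * (((a + 1 : ℕ) : ℂ) * ε ^ (a + 1 + 1)) = a + 1 := by
    have h4 : (ε ^ a) ^ (n + 1) = 1 := by
      rw [← pow_mul, mul_comm, pow_mul, hεdef, pow_pow_eq_one hε, one_pow]
    have h5 : ε ^ 2 = 1 := pow_sq_eq_one hε
    rw [Finset.prod_const, Finset.card_range, add_assoc a, pow_add ε a, h5, mul_one, mul_left_comm,
      ← pow_succ, h4]
    push_cast; ring
  rw [h3] at h1
  refine h1.congr' ?_
  filter_upwards [eventually_qFactorial_ne_zero hq₀ ((a + 1) * (n + 1))] with q ⟨hq, hq2, hfac⟩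
  have hfac' := qFactorial_ne_zero_of_le (show a * (n + 1) ≤ (a + 1) * (n + 1) by gcongr; omega) hfac
  rw [show (a + 1) * (n + 1) = a * (n + 1) + (n + 1) by ring, qFactorial_add,
    mul_div_mul_left _ _ hfac', qFactorial, ← Finset.prod_div_distrib, Finset.prod_range_succ]
  refine congrArg₂ (· * ·) (Finset.prod_congr rfl fun k _ => ?_) ?_
  · congr 2
  · congr 2; push_cast; ring

end QIntLimits

/-! ### The Serre relation for limits of divided powers. -/

section SerreLimit

variable {R ι : Type*} [Ring R] [Algebra ℂ R] [TopologicalSpace R] [IsTopologicalRing R]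
  [ContinuousSMul ℂ R] {q₀ : ℂ} {N : ℕ} {l : Filter ι} {Q : ι → ℂ} {E X : ι → R} {E₀ Y Z : R}

/-- Passing from `a * N` to `(a + 1) * N` multiplies by the `N`th divided power and divides by a
scalar tending to `a + 1`; this produces the factorial. -/
theorem tendsto_divPow_mul (hq₀ : q₀ ≠ 0) (hN : 2 ≤ N) (hp : IsPrimitiveRoot (q₀ ^ 2) N)
    (hε : q₀ ^ N = (-1) ^ (N + 1)) (hQ : Tendsto Q l (𝓝[≠] q₀))
    (hY : Tendsto (fun s => divPow (Q s) (E s) N) l (𝓝 Y)) (a : ℕ) :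
    Tendsto (fun s => divPow (Q s) (E s) (a * N)) l (𝓝 ((a.factorial : ℂ)⁻¹ • Y ^ a)) := by
  induction a with
  | zero => simpa [divPow_zero] using tendsto_const_nhds
  | succ a ih =>
    have ha : (a + 1 : ℂ) ≠ 0 := by exact_mod_cast Nat.succ_ne_zero a
    have h1 := (((tendsto_qFactorial_div hq₀ hN hp hε a).comp hQ).inv₀ ha).smul (ih.mul hY)
    rw [smul_mul_assoc, smul_smul, ← pow_succ, ← mul_inv] at h1
    rw [Nat.factorial_succ]
    push_cast
    refine h1.congr' ?_
    filter_upwards [hQ.eventually (eventually_qFactorial_ne_zero hq₀ ((a + 1) * N))]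
      with s ⟨hq, hq2, hfac⟩
    have e : (a + 1) * N = a * N + N := by ring
    rw [e] at hfac
    have h2 := qFactorial_ne_zero_of_le (Nat.le_add_right _ _) hfac
    have h3 := qFactorial_ne_zero_of_le (Nat.le_add_left _ _) hfac
    rw [divPow_mul_divPow hfac, smul_smul, Function.comp_apply, e, inv_mul_cancel₀, one_smul]
    exact div_ne_zero hfac (mul_ne_zero h2 h3)

/-- Only the `q`-integers at multiples of `N` vanish in the limit. Those indices are covered by the
powers of `Y`; at the others division by `[m + 1]` is continuous. -/
theorem exists_tendsto_divPow (hq₀ : q₀ ≠ 0) (hN : 2 ≤ N) (hp : IsPrimitiveRoot (q₀ ^ 2) N)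
    (hε : q₀ ^ N = (-1) ^ (N + 1)) (hQ : Tendsto Q l (𝓝[≠] q₀)) (hE : Tendsto E l (𝓝 E₀))
    (hY : Tendsto (fun s => divPow (Q s) (E s) N) l (𝓝 Y)) (m : ℕ) :
    ∃ W, Tendsto (fun s => divPow (Q s) (E s) m) l (𝓝 W) := by
  have hq2 : q₀ ^ 2 ≠ 1 := hp.ne_one (by omega)
  induction m with
  | zero => exact ⟨1, by simpa [divPow_zero] using tendsto_const_nhds⟩
  | succ m ih =>
    by_cases hdvd : N ∣ m + 1
    · obtain ⟨a, ha⟩ := hdvd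
      rw [ha, mul_comm]
      exact ⟨_, tendsto_divPow_mul hq₀ hN hp hε hQ hY a⟩
    · obtain ⟨W, hW⟩ := ih
      have hm : qInt q₀ (m + 1) ≠ 0 := qInt_ne_zero_of_lt hq₀ hN hp (by exact_mod_cast hdvd)
      have h1 := ((continuousAt_qInt hq₀ hq2 (m + 1)).tendsto.comp
        (hQ.mono_right nhdsWithin_le_nhds))
      refine ⟨_, ((h1.inv₀ hm).smul (hE.mul hW)).congr' ?_⟩
      filter_upwards [h1.eventually_ne hm] with s hs
      rw [Function.comp_apply] at hs ⊢
      rw [mul_divPow hs, smul_smul, inv_mul_cancel₀ hs, one_smul]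

/-- In the limit of the higher Serre relation only `t = 0, N, 2N, 3N` survive. The divided powers
there are `Y ^ a / a!`, so the coefficients are, up to sign, the binomials of `3` divided by `6`. -/
theorem serre_of_tendsto_divPow [T2Space R] [l.NeBot] (hq₀ : q₀ ≠ 0) (hN : 2 ≤ N)
    (hp : IsPrimitiveRoot (q₀ ^ 2) N) (hε : q₀ ^ N = (-1) ^ (N + 1))
    (hQ : Tendsto Q l (𝓝[≠] q₀)) (hE : Tendsto E l (𝓝 E₀))
    (hY : Tendsto (fun s => divPow (Q s) (E s) N) l (𝓝 Y))
    (hZ : Tendsto (fun s => divPow (Q s) (X s) N) l (𝓝 Z))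
    (hS : ∀ᶠ s in l, qSerre (Q s) (E s) (X s) = 0) :
    Y ^ 3 * Z - (3 : ℂ) • (Y ^ 2 * Z * Y) + (3 : ℂ) • (Y * Z * Y ^ 2) - Z * Y ^ 3 = 0 := by
  have hq2 : q₀ ^ 2 ≠ 1 := hp.ne_one (by omega)
  choose W hW using exists_tendsto_divPow hq₀ hN hp hε hQ hE hY
  have hWa : ∀ a, W (a * N) = (a.factorial : ℂ)⁻¹ • Y ^ a := fun a =>
    tendsto_nhds_unique (hW _) (tendsto_divPow_mul hq₀ hN hp hε hQ hY a)
  obtain ⟨n, rfl⟩ : ∃ n, N = n + 1 := ⟨N - 1, by omega⟩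
  set c : ℂ → ℕ → ℂ := fun q t =>
    (-1) ^ t * ∏ k ∈ Finset.range n, (qInt q (t - 1 - k) / qInt q (k + 1)) with hc
  have hk0 : ∀ k ∈ Finset.range n, qInt q₀ (k + 1) ≠ 0 := by
    intro k hk
    refine qInt_ne_zero_of_lt hq₀ hN hp fun h => ?_
    have := Int.le_of_dvd (by omega) h
    rw [Finset.mem_range] at hk
    push_cast at this
    omega
  have hct : ∀ t, Tendsto (fun s => c (Q s) t) l (𝓝 (c q₀ t)) := by
    intro t
    have : ContinuousAt (fun q => c q t) q₀ := by
      simp only [hc]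
      exact continuousAt_const.mul (tendsto_finsetProd _ fun k hk =>
        (continuousAt_qInt hq₀ hq2 _).div₀ (continuousAt_qInt hq₀ hq2 _) (hk0 k hk))
    exact this.tendsto.comp (hQ.mono_right nhdsWithin_le_nhds)
  have h1 : Tendsto (fun s => ∑ t ∈ Finset.range (3 * (n + 1) + 1), c (Q s) t •
      (divPow (Q s) (E s) (3 * (n + 1) - t) * divPow (Q s) (X s) (n + 1) * divPow (Q s) (E s) t)) l
      (𝓝 (∑ t ∈ Finset.range (3 * (n + 1) + 1), c q₀ t • (W (3 * (n + 1) - t) * Z * W t))) :=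
    tendsto_finsetSum _ fun t _ => (hct t).smul (((hW _).mul hZ).mul (hW t))
  have h2 : ∑ t ∈ Finset.range (3 * (n + 1) + 1), c q₀ t • (W (3 * (n + 1) - t) * Z * W t) = 0 := by
    refine tendsto_nhds_unique (h1.congr' ?_) (tendsto_const_nhds (x := (0 : R)))
    filter_upwards [hS, hQ.eventually (eventually_qFactorial_ne_zero hq₀ (3 * (n + 1)))]
      with s hs ⟨hq, hq2, hfac⟩
    exact sum_divPow_eq_zero hq hq2 hs hfac
  have hc0 : ∀ t : ℕ, ¬ (n + 1) ∣ t → c q₀ t = 0 := by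
    intro t ht
    simp only [hc]
    have hr : t % (n + 1) ≠ 0 := fun h => ht (Nat.dvd_of_mod_eq_zero h)
    have hlt : t % (n + 1) < n + 1 := Nat.mod_lt t (Nat.succ_pos n)
    -- If `n + 1` does not divide `t`, one of `t - 1, …, t - n` is a multiple of `n + 1`; it occurs
    -- at this `k`.
    rw [Finset.prod_eq_zero (i := t % (n + 1) - 1) (Finset.mem_range.2 (by omega)), mul_zero]
    have e : (t : ℤ) - 1 - (t % (n + 1) - 1 : ℕ) = (t / (n + 1) : ℕ) * ((n + 1 : ℕ) : ℤ) := by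
      have := Nat.div_add_mod t (n + 1)
      have h' : (t : ℤ) = (n + 1 : ℕ) * (t / (n + 1) : ℕ) + (t % (n + 1) : ℕ) := by
        exact_mod_cast this.symm
      rw [Nat.cast_sub (by omega), h']
      push_cast
      ring
    rw [e, qInt_mul_eq_zero hq₀ hN hp, zero_div]
  have hca : ∀ a : ℕ, c q₀ (a * (n + 1)) = (-1) ^ n * (-1) ^ a := by
    intro a
    have hf : ∀ k ∈ Finset.range n, qInt q₀ ((a * (n + 1) : ℕ) - 1 - k) / qInt q₀ (k + 1) =
        -(q₀ ^ (n + 1)) ^ a := by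
      intro k hk
      rw [show (((a * (n + 1) : ℕ) : ℤ) - 1 - k) = a * (n + 1 : ℕ) + -(k + 1) by push_cast; ring,
        qInt_mul_add hq₀ hN hp hε, qInt_neg, mul_neg, neg_div, mul_div_cancel_right₀ _ (hk0 k hk)]
    simp only [hc]
    rw [Finset.prod_congr rfl hf, Finset.prod_const, Finset.card_range,
      neg_pow ((q₀ ^ (n + 1)) ^ a), ← pow_mul (q₀ ^ (n + 1))]
    have e1 : ((q₀ ^ (n + 1)) ^ (a * n) : ℂ) = (-1) ^ (a * (n + 1 + 1) * n) := by
      rw [hε, ← pow_mul]; ring_nf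
    rw [e1, mul_left_comm, ← pow_add]
    congr 1
    rw [show a * (n + 1) + a * (n + 1 + 1) * n = a + a * (n * (n + 1) + 2 * n) by ring, pow_add]
    have : Even (a * (n * (n + 1) + 2 * n)) :=
      Even.mul_left ((Nat.even_mul_succ_self n).add (even_two_mul n)) a
    rw [this.neg_one_pow, mul_one]
  have h3 : ∑ a ∈ Finset.range 4,
      c q₀ (a * (n + 1)) • (W (3 * (n + 1) - a * (n + 1)) * Z * W (a * (n + 1))) = 0 := by
    rw [← h2]
    have hinj : ∀ a ∈ Finset.range 4, ∀ b ∈ Finset.range 4, a * (n + 1) = b * (n + 1) → a = b :=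
      fun a _ b _ h => Nat.eq_of_mul_eq_mul_right (Nat.succ_pos n) h
    rw [← Finset.sum_image (f := fun t => c q₀ t • (W (3 * (n + 1) - t) * Z * W t)) hinj]
    refine Finset.sum_subset ?_ ?_
    · intro t ht
      obtain ⟨a, ha, rfl⟩ := Finset.mem_image.1 ht
      rw [Finset.mem_range] at ha ⊢
      have : a * (n + 1) ≤ 3 * (n + 1) := Nat.mul_le_mul_right _ (by omega)
      omega
    · intro t ht ht'
      rw [hc0 t, zero_smul]
      rintro ⟨a, rfl⟩
      refine ht' (Finset.mem_image.2 ⟨a, ?_, mul_comm _ _⟩)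
      rw [Finset.mem_range] at ht ⊢
      by_contra h
      have : (n + 1) * 4 ≤ (n + 1) * a := Nat.mul_le_mul_left _ (by omega)
      omega
  -- The factor `6` clears the factorials, and `(-1) ^ n` removes the common sign of the
  -- coefficients.
  have h4 := congrArg (fun x => ((6 : ℂ) * (-1) ^ n) • x) h3
  have hsq : ((-1 : ℂ) ^ n) * (-1) ^ n = 1 := by rw [← mul_pow]; simp
  simp only [← Nat.sub_mul, Finset.sum_range_succ, Finset.sum_range_zero, hca, hWa, smul_zero,
    zero_add, smul_add, smul_mul_assoc, mul_smul_comm, smul_smul] at h4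
  norm_num [Nat.factorial] at h4
  have e : ∀ x : ℂ, 6 * (-1) ^ n * ((-1) ^ n * x) = 6 * x := fun x => by
    linear_combination 6 * x * hsq
  simp only [e] at h4
  norm_num at h4
  rw [← h4]
  abel

end SerreLimit

/-! ### Intertwining relations and the coproduct. -/

section Chain

variable {R : Type*} [Ring R] [Algebra ℂ R]

/-- The intertwining relations between the entries `a, b; c, d` of a monodromy matrix and an
element `F` with group-like `K`. -/
structure ChainRel (p ζ : ℂ) (a b c d F K K' : R) : Prop where
  mul_inv : K * K' = 1
  inv_mul : K' * K = 1
  FK : F * K = p • (K * F)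
  bK : b * K = p • (K * b)
  Kc : K * c = p • (c * K)
  aK : a * K = K * a
  dK : d * K = K * d
  aF : a * F = p • (F * a) - ζ • (b * K)
  dF : p • (d * F) = F * d + (p * ζ) • (b * K')
  cF : c * F = F * c + ζ • (K' * a - K * d)
  bF : b * F = F * b

namespace ChainRel

variable {p ζ : ℂ} {a b c d F K K' : R}

theorem conj_inv (h : ChainRel p ζ a b c d F K K') {x y : R} {r : ℂ} (hx : x * K = r • (K * y)) :
    K' * x = r • (y * K') := by
  calc K' * x = K' * (x * K) * K' := by rw [mul_assoc, mul_assoc, h.mul_inv, mul_one]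
    _ = r • (y * K') := by
      rw [hx, mul_smul_comm, ← mul_assoc, h.inv_mul, one_mul, smul_mul_assoc]

theorem invF (h : ChainRel p ζ a b c d F K K') : K' * F = p • (F * K') := h.conj_inv h.FK

theorem invb (h : ChainRel p ζ a b c d F K K') : K' * b = p • (b * K') := h.conj_inv h.bK

theorem inva (h : ChainRel p ζ a b c d F K K') : a * K' = K' * a := by
  have := h.conj_inv (r := 1) (y := a) (by rw [one_smul, h.aK])
  rw [this, one_smul]

theorem invd (h : ChainRel p ζ a b c d F K K') : d * K' = K' * d := by
  have := h.conj_inv (r := 1) (y := d) (by rw [one_smul, h.dK])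
  rw [this, one_smul]

theorem cinv (h : ChainRel p ζ a b c d F K K') : c * K' = p • (K' * c) := by
  calc c * K' = K' * (K * c) * K' := by rw [← mul_assoc K', h.inv_mul, one_mul]
    _ = p • (K' * c) := by
      rw [h.Kc, mul_smul_comm, smul_mul_assoc, mul_assoc, mul_assoc, h.mul_inv, mul_one]

theorem one (p ζ : ℂ) : ChainRel p ζ (1 : R) 0 0 1 0 1 1 := by
  constructor <;> simp

/-- This is compatibility with the coproduct. Elements of different factors commute, so every
product separates into one part per factor; the relations of each factor bring both sides to the
same normal order, and coefficients are compared. -/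
theorem mul (hp : p ≠ 0) {a₁ b₁ c₁ d₁ F₁ K₁ K₁' a₂ b₂ c₂ d₂ F₂ K₂ K₂' : R}
    (h₁ : ChainRel p ζ a₁ b₁ c₁ d₁ F₁ K₁ K₁') (h₂ : ChainRel p ζ a₂ b₂ c₂ d₂ F₂ K₂ K₂') {S₁ S₂ : Set R}
    (hS : ∀ x ∈ S₁, ∀ y ∈ S₂, x * y = y * x) (m₁ : {a₁, b₁, c₁, d₁, F₁, K₁, K₁'} ⊆ S₁)
    (m₂ : {a₂, b₂, c₂, d₂, F₂, K₂, K₂'} ⊆ S₂) :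
    ChainRel p ζ (a₁ * a₂ + b₁ * c₂) (a₁ * b₂ + b₁ * d₂) (c₁ * a₂ + d₁ * c₂) (c₁ * b₂ + d₁ * d₂)
      (F₁ * K₂' + K₁ * F₂) (K₁ * K₂) (K₁' * K₂') := by
  simp only [Set.insert_subset_iff, Set.singleton_subset_iff] at m₁ m₂
  obtain ⟨ma, mb, mc, md, mF, mK, mK'⟩ := m₁
  obtain ⟨na, nb, nc, nd, nF, nK, nK'⟩ := m₂
  have mm : ∀ x y z w : R, z ∈ S₁ → y ∈ S₂ → x * y * (z * w) = x * z * (y * w) := by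
    intro x y z w hz hy
    rw [mul_assoc, ← mul_assoc y, ← hS z hz y hy, mul_assoc, mul_assoc]
  have e1 : p * p⁻¹ = 1 := mul_inv_cancel₀ hp
  have cK₁ : c₁ * K₁ = p⁻¹ • (K₁ * c₁) := by rw [h₁.Kc, smul_smul, mul_comm, e1, one_smul]
  have cK₂ : c₂ * K₂ = p⁻¹ • (K₂ * c₂) := by rw [h₂.Kc, smul_smul, mul_comm, e1, one_smul]
  have bi₁ : b₁ * K₁' = p⁻¹ • (K₁' * b₁) := by rw [h₁.invb, smul_smul, mul_comm, e1, one_smul]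
  have bi₂ : b₂ * K₂' = p⁻¹ • (K₂' * b₂) := by rw [h₂.invb, smul_smul, mul_comm, e1, one_smul]
  have dF₁ : d₁ * F₁ = p⁻¹ • (F₁ * d₁) + ζ • (b₁ * K₁') := by
    have := congrArg (fun x => p⁻¹ • x) h₁.dF
    simp only [smul_smul, smul_add, mul_comm p⁻¹ p, e1, one_smul] at this
    rw [this, ← mul_assoc, mul_comm p⁻¹ p, e1, one_mul]
  have dF₂ : d₂ * F₂ = p⁻¹ • (F₂ * d₂) + ζ • (b₂ * K₂') := by
    have := congrArg (fun x => p⁻¹ • x) h₂.dF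
    simp only [smul_smul, smul_add, mul_comm p⁻¹ p, e1, one_smul] at this
    rw [this, ← mul_assoc, mul_comm p⁻¹ p, e1, one_mul]
  constructor
  case mul_inv => rw [mm _ _ _ _ mK' nK, h₁.mul_inv, h₂.mul_inv, one_mul]
  case inv_mul => rw [mm _ _ _ _ mK nK', h₁.inv_mul, h₂.inv_mul, one_mul]
  all_goals
    simp only [mul_add, add_mul, mul_sub, mm, ma, mb, mc, md, mF, mK, mK', na, nb, nc, nd, nF, nK, nK',
      h₁.FK, h₂.FK, h₁.bK, h₂.bK, cK₁, cK₂, h₁.aK, h₂.aK, h₁.dK, h₂.dK, h₁.aF, h₂.aF, dF₁, dF₂,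
      h₁.cF, h₂.cF, h₁.bF, h₂.bF, h₁.inva, h₂.inva, h₂.invd, h₂.cinv, bi₁, bi₂,
      h₂.inv_mul, h₂.mul_inv,
      smul_mul_assoc, mul_smul_comm, smul_add, smul_sub, sub_mul, smul_smul]
  all_goals (match_scalars <;> field_simp <;> ring)

end ChainRel

end Chain

/-! ### Relations, Serre identities and limits along a list of sites. -/

section ChainList

variable {R ι : Type*} [Ring R] [Algebra ℂ R]

/-- The iterated coproduct `∑ᵢ K ⋯ K Fᵢ K' ⋯ K'` along a list of sites. -/
def chainSum (F K K' : ι → R) : List ι → R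
  | [] => 0
  | i :: l => F i * (l.map K').prod + K i * chainSum F K K' l

theorem chainSum_mem {A : Subalgebra ℂ R} {F K K' : ι → R} {l : List ι} (hF : ∀ i ∈ l, F i ∈ A)
    (hK : ∀ i ∈ l, K i ∈ A) (hK' : ∀ i ∈ l, K' i ∈ A) : chainSum F K K' l ∈ A := by
  induction l with
  | nil => exact zero_mem A
  | cons i l ih =>
    simp only [List.forall_mem_cons] at hF hK hK'
    refine add_mem (mul_mem hF.1 (list_prod_mem ?_)) (mul_mem hK.1 (ih hF.2 hK.2 hK'.2))
    simpa using hK'.2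

theorem list_prod_apply_mem {A : Subalgebra ℂ R} {M : ι → Matrix (Fin 2) (Fin 2) R} {l : List ι}
    (hM : ∀ i ∈ l, ∀ x y, M i x y ∈ A) (x y : Fin 2) : (l.map M).prod x y ∈ A := by
  induction l generalizing x y with
  | nil =>
    rw [List.map_nil, List.prod_nil, Matrix.one_apply]
    split_ifs
    exacts [one_mem A, zero_mem A]
  | cons i l ih =>
    simp only [List.forall_mem_cons] at hM
    rw [List.map_cons, List.prod_cons, Matrix.mul_apply]
    exact sum_mem fun z _ => mul_mem (hM.1 x z) (ih hM.2 z y)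

/-- Sets of elements attached to different sites commute. -/
def SitesCommute (S : ι → Set R) : Prop :=
  ∀ i j, i ≠ j → ∀ x ∈ S i, ∀ y ∈ S j, x * y = y * x

theorem SitesCommute.mem_centralizer {S : ι → Set R} (hS : SitesCommute S) {i : ι} {l : List ι}
    (hi : i ∉ l) {j : ι} (hj : j ∈ l) {x : R} (hx : x ∈ S j) :
    x ∈ Subalgebra.centralizer ℂ (S i) := by
  rw [Subalgebra.mem_centralizer_iff]
  intro g hg
  exact hS i j (fun h => hi (h ▸ hj)) g hg x hx

/-- Induction with `ChainRel.mul`. The remaining sites enter through the centralizer of site `i`, a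
subalgebra that contains their monodromy entries and iterated coproducts. -/
theorem ChainRel.list {p ζ : ℂ} (hp : p ≠ 0) {S : ι → Set R} (hS : SitesCommute S)
    {M : ι → Matrix (Fin 2) (Fin 2) R} {F K K' : ι → R} (hM : ∀ i x y, M i x y ∈ S i)
    (hF : ∀ i, F i ∈ S i) (hK : ∀ i, K i ∈ S i) (hK' : ∀ i, K' i ∈ S i)
    (h : ∀ i, ChainRel p ζ (M i 0 0) (M i 0 1) (M i 1 0) (M i 1 1) (F i) (K i) (K' i))
    {l : List ι} (hl : l.Nodup) :
    ChainRel p ζ ((l.map M).prod 0 0) ((l.map M).prod 0 1) ((l.map M).prod 1 0)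
      ((l.map M).prod 1 1) (chainSum F K K' l) (l.map K).prod (l.map K').prod := by
  induction l with
  | nil => simpa [chainSum] using ChainRel.one (R := R) p ζ
  | cons i l ih =>
    obtain ⟨hi, hl⟩ := List.nodup_cons.1 hl
    simp only [List.map_cons, List.prod_cons, Matrix.mul_apply, Fin.sum_univ_two, chainSum]
    have hc : ∀ {j : ι}, j ∈ l → ∀ {x : R}, x ∈ S j → x ∈ Subalgebra.centralizer ℂ (S i) :=
      fun hj _ hx => hS.mem_centralizer hi hj hx
    have hT := fun x y => list_prod_apply_mem (l := l) (M := M)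
      (A := Subalgebra.centralizer ℂ (S i)) (fun j hj x y => hc hj (hM j x y)) x y
    refine (h i).mul hp (ih hl) (S₁ := S i) (S₂ := Subalgebra.centralizer ℂ (S i)) ?_ ?_ ?_
    · intro x hx y hy
      exact (Subalgebra.mem_centralizer_iff ℂ).1 hy x hx
    · simp only [Set.insert_subset_iff, Set.singleton_subset_iff]
      exact ⟨hM _ _ _, hM _ _ _, hM _ _ _, hM _ _ _, hF i, hK i, hK' i⟩
    · simp only [Set.insert_subset_iff, Set.singleton_subset_iff]
      refine ⟨hT _ _, hT _ _, hT _ _, hT _ _, chainSum_mem (fun j hj => hc hj (hF j))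
        (fun j hj => hc hj (hK j)) (fun j hj => hc hj (hK' j)), list_prod_mem ?_, list_prod_mem ?_⟩
      · simpa using fun j hj => hc hj (hK j)
      · simpa using fun j hj => hc hj (hK' j)

theorem qSerre_mul_commute (q : ℂ) {E X u v : R} (h1 : Commute E u) (h2 : Commute E v)
    (h3 : Commute X u) (h5 : Commute u v) :
    qSerre q (E * u) (X * v) = qSerre q E X * (u ^ 3 * v) := by
  have e3 : (E * u) ^ 3 = E ^ 3 * u ^ 3 := h1.mul_pow 3
  have e2 : (E * u) ^ 2 = E ^ 2 * u ^ 2 := h1.mul_pow 2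
  have x1 : E ^ 3 * u ^ 3 * (X * v) = E ^ 3 * X * (u ^ 3 * v) :=
    (h3.symm.pow_left 3).mul_mul_mul_comm _ _
  have x2 : E ^ 2 * u ^ 2 * (X * v) * (E * u) = E ^ 2 * X * E * (u ^ 3 * v) := by
    rw [(h3.symm.pow_left 2).mul_mul_mul_comm,
      (show Commute (u ^ 2 * v) E from ((h1.symm.pow_left 2).mul_left h2.symm)).mul_mul_mul_comm,
      mul_assoc (u ^ 2), ← h5.eq, ← mul_assoc (u ^ 2), ← pow_succ]
  have x3 : E * u * (X * v) * (E ^ 2 * u ^ 2) = E * X * E ^ 2 * (u ^ 3 * v) := by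
    rw [h3.symm.mul_mul_mul_comm,
      (show Commute (u * v) (E ^ 2) from (h1.symm.mul_left h2.symm).pow_right 2).mul_mul_mul_comm,
      mul_assoc u, ← (h5.pow_left 2).eq, ← mul_assoc u, ← pow_succ']
  have x4 : X * v * (E ^ 3 * u ^ 3) = X * E ^ 3 * (u ^ 3 * v) := by
    rw [(h2.symm.pow_right 3).mul_mul_mul_comm, (h5.pow_left 3).eq]
  rw [qSerre, qSerre, e3, e2, x1, x2, x3, x4, sub_mul, add_mul, sub_mul, smul_mul_assoc,
    smul_mul_assoc]

theorem conj_inv_of_mul {x K K' : R} {r : ℂ} (h1 : K * K' = 1) (h2 : K' * K = 1)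
    (hx : x * K = r • (K * x)) : K' * x = r • (x * K') := by
  calc K' * x = K' * (x * K) * K' := by rw [mul_assoc, mul_assoc, h1, mul_one]
    _ = r • (x * K') := by
      rw [hx, mul_smul_comm, ← mul_assoc, h2, one_mul, smul_mul_assoc]

theorem eq_inv_smul_of_eq_smul {r : ℂ} (hr : r ≠ 0) {x y : R} (h : x = r • y) : y = r⁻¹ • x := by
  rw [h, smul_smul, inv_mul_cancel₀ hr, one_smul]

/-- Both chain operators split into a part from the first site and a part from the rest. Each part
satisfies the Serre relation, up to commuting group-like factors, and mixed products commute up to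
`p ^ 2` or `p ^ (-2)`, which is the situation of `qSerre_add`. -/
theorem qSerre_chainSum {p : ℂ} (hp : p ≠ 0) (hp2 : p ^ 2 ≠ 1) {S : ι → Set R}
    (hS : SitesCommute S) {B C K K' : ι → R} (hB : ∀ i, B i ∈ S i) (hC : ∀ i, C i ∈ S i)
    (hK : ∀ i, K i ∈ S i) (hK' : ∀ i, K' i ∈ S i) (h1 : ∀ i, K i * K' i = 1)
    (h2 : ∀ i, K' i * K i = 1) (hBK : ∀ i, B i * K i = p • (K i * B i))
    (hCK : ∀ i, C i * K' i = p • (K' i * C i))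
    (hl : ∀ l : List ι, l.Nodup → (l.map K).prod * (l.map K').prod = 1 ∧
      (l.map K').prod * (l.map K).prod = 1 ∧
      chainSum B K K' l * (l.map K).prod = p • ((l.map K).prod * chainSum B K K' l) ∧
      chainSum C K' K l * (l.map K').prod = p • ((l.map K').prod * chainSum C K' K l))
    (hser : ∀ i, qSerre p (B i) (C i) = 0) {l : List ι} (hnd : l.Nodup) :
    qSerre p (chainSum B K K' l) (chainSum C K' K l) = 0 := by
  induction l with
  | nil => simp [chainSum, qSerre]
  | cons i l ih =>
    obtain ⟨hi, hnd⟩ := List.nodup_cons.1 hnd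
    obtain ⟨g1, g2, gB, gC⟩ := hl l hnd
    have hpp : p * p = p ^ (2 : ℤ) := by norm_cast; ring
    have hpi : p ^ (-2 : ℤ) = (p * p)⁻¹ := by rw [hpp, zpow_neg]
    have hpp0 : p * p ≠ 0 := mul_ne_zero hp hp
    have hc : ∀ {j : ι}, j ∈ l → ∀ {x : R}, x ∈ S j → x ∈ Subalgebra.centralizer ℂ (S i) :=
      fun hj _ hx => hS.mem_centralizer hi hj hx
    have comm : ∀ {x y : R}, x ∈ S i → y ∈ Subalgebra.centralizer ℂ (S i) → Commute x y :=
      fun hx hy => (Subalgebra.mem_centralizer_iff ℂ).1 hy _ hx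
    have mB : chainSum B K K' l ∈ Subalgebra.centralizer ℂ (S i) :=
      chainSum_mem (fun j hj => hc hj (hB j)) (fun j hj => hc hj (hK j)) (fun j hj => hc hj (hK' j))
    have mC : chainSum C K' K l ∈ Subalgebra.centralizer ℂ (S i) :=
      chainSum_mem (fun j hj => hc hj (hC j)) (fun j hj => hc hj (hK' j)) (fun j hj => hc hj (hK j))
    have mK : (l.map K).prod ∈ Subalgebra.centralizer ℂ (S i) :=
      list_prod_mem (by simpa using fun j hj => hc hj (hK j))
    have mK' : (l.map K').prod ∈ Subalgebra.centralizer ℂ (S i) :=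
      list_prod_mem (by simpa using fun j hj => hc hj (hK' j))
    have gB' := conj_inv_of_mul g1 g2 gB
    have gC' := conj_inv_of_mul g2 g1 gC
    have iB' := conj_inv_of_mul (h1 i) (h2 i) (hBK i)
    have iC' := conj_inv_of_mul (h2 i) (h1 i) (hCK i)
    set Bl := chainSum B K K' l
    set Cl := chainSum C K' K l
    set Kl := (l.map K).prod
    set Kl' := (l.map K').prod
    have s1 : qSerre p (B i * Kl') (C i * Kl) = 0 := by
      rw [qSerre_mul_commute p (comm (hB i) mK') (comm (hB i) mK) (comm (hC i) mK')
        (show Kl' * Kl = Kl * Kl' by rw [g1, g2]), hser i, zero_mul]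
    have s2 : qSerre p (K i * Bl) (K' i * Cl) = 0 := by
      rw [(comm (hK i) mB).eq, (comm (hK' i) mC).eq, qSerre_mul_commute p (comm (hK i) mB).symm
        (comm (hK' i) mB).symm (comm (hK i) mC).symm
        (show K i * K' i = K' i * K i by rw [h1, h2]), ih hnd, zero_mul]
    refine qSerre_add hp hp2 s1 s2 ?_ ?_ ?_
    · rw [(comm (hK i) mK').symm.mul_mul_mul_comm, (comm (hB i) mB).symm.mul_mul_mul_comm, hBK i, gB',
        smul_mul_smul_comm, hpp]
    · rw [(comm (hK' i) mK').symm.mul_mul_mul_comm, (comm (hB i) mC).symm.mul_mul_mul_comm, iB', gC,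
        smul_mul_smul_comm, hpi, smul_smul, inv_mul_cancel₀ hpp0, one_smul]
    · rw [(comm (hK i) mK).symm.mul_mul_mul_comm, (comm (hC i) mB).symm.mul_mul_mul_comm, iC', gB,
        smul_mul_smul_comm, hpi, smul_smul, inv_mul_cancel₀ hpp0, one_smul]

theorem divPow_mul_commute (q : ℂ) {E u : R} (h : Commute E u) (m : ℕ) :
    divPow q (E * u) m = divPow q E m * u ^ m := by
  rw [divPow, divPow, h.mul_pow, smul_mul_assoc]

theorem tendsto_chainSum {R ι 𝕊 : Type*} [Ring R] [TopologicalSpace R] [IsTopologicalRing R] {f : Filter 𝕊}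
    {F K K' : ι → 𝕊 → R} {F₀ K₀ K₀' : ι → R} (hF : ∀ i, Tendsto (F i) f (𝓝 (F₀ i)))
    (hK : ∀ i, Tendsto (K i) f (𝓝 (K₀ i))) (hK' : ∀ i, Tendsto (K' i) f (𝓝 (K₀' i))) (l : List ι) :
    Tendsto (fun s => chainSum (fun i => F i s) (fun i => K i s) (fun i => K' i s) l) f
      (𝓝 (chainSum F₀ K₀ K₀' l)) := by
  induction l with
  | nil => exact tendsto_const_nhds
  | cons i l ih => exact ((hF i).mul (tendsto_list_prod l fun i _ => hK' i)).add ((hK i).mul ih)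

/-- By `divPow_add`, a divided power of a coproduct is a finite sum of products of divided powers of
lower or equal order on the first site and on the rest, so convergence passes from the sites to the
chain. -/
theorem exists_tendsto_divPow_chainSum {𝕊 : Type*} [TopologicalSpace R] [IsTopologicalRing R]
    [ContinuousSMul ℂ R] {f : Filter 𝕊} {P : 𝕊 → ℂ} {p : ℂ} (hp : p ≠ 0) (hP : Tendsto P f (𝓝 p))
    {S : ι → Set R} (hS : SitesCommute S) {F K K' : ι → 𝕊 → R} (hF : ∀ i s, F i s ∈ S i)
    (hK : ∀ i s, K i s ∈ S i) (hK' : ∀ i s, K' i s ∈ S i) {K₀ K₀' : ι → R}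
    (tK : ∀ i, Tendsto (K i) f (𝓝 (K₀ i))) (tK' : ∀ i, Tendsto (K' i) f (𝓝 (K₀' i)))
    {N : ℕ} (tF : ∀ i, ∀ m ≤ N, ∃ W, Tendsto (fun s => divPow (P s) (F i s) m) f (𝓝 W))
    (hfac : ∀ᶠ s in f, P s ≠ 0 ∧ qFactorial (P s) N ≠ 0)
    (hFK : ∀ᶠ s in f, ∀ i, F i s * K i s = P s • (K i s * F i s))
    (hl : ∀ᶠ s in f, ∀ l : List ι, l.Nodup → (l.map fun i => K' i s).prod *
        chainSum (fun i => F i s) (fun i => K i s) (fun i => K' i s) l =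
      P s • (chainSum (fun i => F i s) (fun i => K i s) (fun i => K' i s) l *
        (l.map fun i => K' i s).prod)) {l : List ι} (hnd : l.Nodup) :
    ∀ m ≤ N, ∃ W, Tendsto (fun s =>
      divPow (P s) (chainSum (fun i => F i s) (fun i => K i s) (fun i => K' i s) l) m) f (𝓝 W) := by
  induction l with
  | nil =>
    intro m _
    rcases m with _ | m
    · exact ⟨1, by simpa [divPow_zero] using tendsto_const_nhds⟩
    · exact ⟨0, by simpa [chainSum, divPow] using tendsto_const_nhds⟩
  | cons i l ih =>
    intro m hm
    obtain ⟨hi, hnd⟩ := List.nodup_cons.1 hnd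
    choose W₁ hW₁ using tF i
    choose W₂ hW₂ using ih hnd
    have hc : ∀ {j : ι}, j ∈ l → ∀ {x : R}, x ∈ S j → x ∈ Subalgebra.centralizer ℂ (S i) :=
      fun hj _ hx => hS.mem_centralizer hi hj hx
    have comm : ∀ {x y : R}, x ∈ S i → y ∈ Subalgebra.centralizer ℂ (S i) → Commute x y :=
      fun hx hy => (Subalgebra.mem_centralizer_iff ℂ).1 hy _ hx
    have mF : ∀ s, chainSum (fun i => F i s) (fun i => K i s) (fun i => K' i s) l ∈
        Subalgebra.centralizer ℂ (S i) := fun s =>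
      chainSum_mem (fun j hj => hc hj (hF j s)) (fun j hj => hc hj (hK j s))
        (fun j hj => hc hj (hK' j s))
    have mK' : ∀ s, (l.map fun i => K' i s).prod ∈ Subalgebra.centralizer ℂ (S i) := fun s =>
      list_prod_mem (by simpa using fun j hj => hc hj (hK' j s))
    -- The summation set is `attach`ed since the chosen limits depend on the proofs that both
    -- indices are at most `N`.
    have key : ∀ᶠ s in f, ∑ x ∈ (Finset.HasAntidiagonal.antidiagonal m).attach,
        P s ^ (-((x.1.1 : ℤ) * x.1.2)) •
          (divPow (P s) (F i s) x.1.1 * (l.map fun i => K' i s).prod ^ x.1.1 *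
            (divPow (P s) (chainSum (fun i => F i s) (fun i => K i s) (fun i => K' i s) l) x.1.2 *
              K i s ^ x.1.2)) =
        divPow (P s) (chainSum (fun i => F i s) (fun i => K i s) (fun i => K' i s) (i :: l)) m := by
      filter_upwards [hfac, hFK, hl] with s ⟨hs0, hs⟩ hFK hl
      have hls := hl l hnd
      rw [chainSum, divPow_add hs0 ?_ m (qFactorial_ne_zero_of_le hm hs), Finset.sum_attach
        (Finset.HasAntidiagonal.antidiagonal m) (fun x : ℕ × ℕ => P s ^ (-((x.1 : ℤ) * x.2)) •
          (divPow (P s) (F i s) x.1 * (l.map fun i => K' i s).prod ^ x.1 *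
            (divPow (P s) (chainSum (fun i => F i s) (fun i => K i s) (fun i => K' i s) l) x.2 *
              K i s ^ x.2)))]
      · refine Finset.sum_congr rfl fun x _ => ?_
        rw [divPow_mul_commute _ (comm (hF i s) (mK' s)), (comm (hK i s) (mF s)).eq,
          divPow_mul_commute _ (comm (hK i s) (mF s)).symm]
      · rw [(comm (hK i s) (mK' s)).symm.mul_mul_mul_comm,
          (comm (hF i s) (mF s)).symm.mul_mul_mul_comm, hFK i, hls, smul_mul_smul_comm]
        congr 1
        norm_cast; ring
    have hle : ∀ x ∈ Finset.HasAntidiagonal.antidiagonal m, x.1 ≤ N ∧ x.2 ≤ N := by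
      intro x hx
      rw [Finset.HasAntidiagonal.mem_antidiagonal] at hx
      omega
    refine ⟨_, Tendsto.congr' key (tendsto_finsetSum _ fun x _ => Tendsto.smul
      ((continuousAt_zpow₀ p _ (Or.inl hp)).tendsto.comp hP)
      (((hW₁ x.1.1 (hle x.1 x.2).1).mul ((tendsto_list_prod l fun i _ => tK' i).pow _)).mul
        ((hW₂ x.1.2 (hle x.1 x.2).2).mul ((tK i).pow _))))⟩

/-- The intertwining relations at a single site. -/
theorem chainRel_site {p g w v : ℂ} (hg : g ≠ 0) (hw : w ≠ 0) {κ κ' F G : R} (h1 : κ * κ' = 1)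
    (h2 : κ' * κ = 1) (hF : F * κ = p • (κ * F)) (hG : κ * G = p • (G * κ))
    (hGF : (p - p⁻¹) • (G * F - F * G) = κ ^ 2 - κ' ^ 2) (hp : p ≠ 0) :
    ChainRel p (v * w) (g⁻¹ • (w • κ - w⁻¹ • κ')) ((p - p⁻¹) • F) ((p - p⁻¹) • G)
      (g • (w • κ' - w⁻¹ • κ)) (v • F) (g⁻¹ • κ) (g • κ') := by
  have hF' : κ' * F = p • (F * κ') := conj_inv_of_mul h1 h2 hF
  have hF1 : κ * F = p⁻¹ • (F * κ) := eq_inv_smul_of_eq_smul hp hF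
  have hGF' : (p - p⁻¹) • (G * F) = (p - p⁻¹) • (F * G) + (κ ^ 2 - κ' ^ 2) := by
    rw [← hGF, smul_sub]; abel
  constructor
  case cF =>
    rw [smul_mul_smul_comm, smul_mul_smul_comm, mul_comm v, mul_smul, mul_comm _ v, mul_smul, mul_smul, smul_comm _ v, hGF']
    simp only [smul_mul_assoc, mul_smul_comm, mul_sub, smul_sub, smul_smul, h1, h2, smul_add, pow_two]
    match_scalars <;> field_simp <;> ring
  all_goals
    simp only [smul_mul_assoc, mul_smul_comm, mul_sub, sub_mul, smul_sub, smul_smul, h1, h2, hF', hF1, hG]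
    try (match_scalars <;> field_simp <;> ring)

end ChainList

/-! ### Operators on tensor factors. -/

section Sites

variable {N L : ℕ}

theorem tensorOp_apply (X : Fin L → Matrix (Fin N) (Fin N) ℂ) (ρ σ : Config N L) :
    tensorOp X ρ σ = ∏ i, X i (ρ i) (σ i) := rfl

theorem tensorOp_mul (X Y : Fin L → Matrix (Fin N) (Fin N) ℂ) :
    tensorOp X * tensorOp Y = tensorOp fun i => X i * Y i := by
  ext ρ σ
  simp only [Matrix.mul_apply, tensorOp_apply, Finset.prod_univ_sum, Fintype.piFinset_univ,
    Finset.prod_mul_distrib]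

theorem tensorOp_one : tensorOp (fun _ => 1 : Fin L → Matrix (Fin N) (Fin N) ℂ) = 1 := by
  ext ρ σ
  simp only [tensorOp_apply, Matrix.one_apply, Finset.prod_ite_zero, Finset.prod_const_one,
    Finset.mem_univ, true_implies, funext_iff]

theorem tensorOp_smul (r : Fin L → ℂ) (X : Fin L → Matrix (Fin N) (Fin N) ℂ) :
    tensorOp (fun i => r i • X i) = (∏ i, r i) • tensorOp X := by
  ext ρ σ
  simp only [tensorOp_apply, Matrix.smul_apply, smul_eq_mul, Finset.prod_mul_distrib]

theorem siteOp_apply (i : Fin L) (X : Matrix (Fin N) (Fin N) ℂ) (ρ σ : Config N L) :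
    siteOp i X ρ σ = X (ρ i) (σ i) * ∏ j ∈ Finset.univ.erase i,
      (1 : Matrix (Fin N) (Fin N) ℂ) (ρ j) (σ j) := by
  rw [siteOp, tensorOp_apply, ← Finset.mul_prod_erase _ _ (Finset.mem_univ i),
    Function.update_self]
  congr 1
  refine Finset.prod_congr rfl fun j hj => ?_
  rw [Function.update_of_ne (Finset.ne_of_mem_erase hj)]

/-- The action of operators on the `i`th tensor factor. -/
noncomputable def siteHom (i : Fin L) : Matrix (Fin N) (Fin N) ℂ →ₐ[ℂ] Op N L :=
  AlgHom.ofLinearMap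
    { toFun := siteOp i
      map_add' := fun X Y => by
        ext ρ σ
        simp only [Matrix.add_apply, siteOp_apply, add_mul]
      map_smul' := fun r X => by
        ext ρ σ
        simp only [Matrix.smul_apply, siteOp_apply, smul_eq_mul, mul_assoc, RingHom.id_apply] }
    (by
      change siteOp i 1 = 1
      rw [siteOp, Function.update_eq_self_iff.2 rfl, tensorOp_one])
    (fun X Y => by
      change siteOp i (X * Y) = siteOp i X * siteOp i Y
      rw [siteOp, siteOp, siteOp, tensorOp_mul]
      congr 1
      funext j
      rcases eq_or_ne j i with rfl | h
      · simp only [Function.update_self]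
      · simp only [Function.update_of_ne h, mul_one])

theorem siteHom_apply (i : Fin L) (X : Matrix (Fin N) (Fin N) ℂ) : siteHom i X = siteOp i X := rfl

theorem siteHom_mul_tensorOp (i : Fin L) (X : Matrix (Fin N) (Fin N) ℂ)
    (Y : Fin L → Matrix (Fin N) (Fin N) ℂ) :
    siteHom i X * tensorOp Y = tensorOp (Function.update Y i (X * Y i)) := by
  rw [siteHom_apply, siteOp, tensorOp_mul]
  congr 1
  funext j
  rcases eq_or_ne j i with rfl | h
  · simp only [Function.update_self]
  · simp only [Function.update_of_ne h, one_mul]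

theorem tensorOp_mul_siteHom (i : Fin L) (X : Matrix (Fin N) (Fin N) ℂ)
    (Y : Fin L → Matrix (Fin N) (Fin N) ℂ) :
    tensorOp Y * siteHom i X = tensorOp (Function.update Y i (Y i * X)) := by
  rw [siteHom_apply, siteOp, tensorOp_mul]
  congr 1
  funext j
  rcases eq_or_ne j i with rfl | h
  · simp only [Function.update_self]
  · simp only [Function.update_of_ne h, mul_one]

theorem siteHom_commute {i j : Fin L} (h : i ≠ j) (X Y : Matrix (Fin N) (Fin N) ℂ) :
    siteHom i X * siteHom j Y = siteHom j Y * siteHom i X := by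
  rw [siteHom_apply j, siteOp, siteHom_mul_tensorOp, tensorOp_mul_siteHom,
    Function.update_of_ne h, one_mul, mul_one]

theorem sitesCommute_range :
    SitesCommute fun i : Fin L => Set.range (siteHom (N := N) i) := by
  rintro i j h _ ⟨X, rfl⟩ _ ⟨Y, rfl⟩
  exact siteHom_commute h X Y

theorem list_prod_siteHom (X : Fin L → Matrix (Fin N) (Fin N) ℂ) {l : List (Fin L)}
    (hl : l.Nodup) :
    (l.map fun i => siteHom i (X i)).prod = tensorOp fun j => if j ∈ l then X j else 1 := by
  induction l with
  | nil => simp [tensorOp_one]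
  | cons i l ih =>
    obtain ⟨hi, hl⟩ := List.nodup_cons.1 hl
    rw [List.map_cons, List.prod_cons, ih hl, siteHom_mul_tensorOp, if_neg hi, mul_one]
    congr 1
    funext j
    rcases eq_or_ne j i with rfl | h
    · simp only [Function.update_self, List.mem_cons, true_or, if_true]
    · simp only [Function.update_of_ne h, List.mem_cons, h, false_or]

theorem finRange_prod_siteHom (X : Fin L → Matrix (Fin N) (Fin N) ℂ) :
    ((List.finRange L).map fun i => siteHom i (X i)).prod = tensorOp X := by
  rw [list_prod_siteHom X (List.nodup_finRange L)]
  simp only [List.mem_finRange, if_true]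

theorem chainSum_siteHom (F K K' : Fin L → Matrix (Fin N) (Fin N) ℂ) {l : List (Fin L)}
    (hl : l.Pairwise (· < ·)) :
    chainSum (fun i => siteHom i (F i)) (fun i => siteHom i (K i)) (fun i => siteHom i (K' i)) l =
      (l.map fun i => tensorOp fun j =>
        if j ∈ l then (if j < i then K j else if j = i then F j else K' j) else 1).sum := by
  induction l with
  | nil => rfl
  | cons i l ih =>
    obtain ⟨hi, hl⟩ := List.pairwise_cons.1 hl
    have hil : i ∉ l := fun h => lt_irrefl _ (hi i h)
    rw [chainSum, ih hl, list_prod_siteHom K' (hl.imp ne_of_lt), siteHom_mul_tensorOp,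
      List.map_cons, List.sum_cons, if_neg hil, mul_one]
    congr 1
    · congr 1
      funext j
      rcases eq_or_ne j i with rfl | h
      · simp
      · by_cases hj : j ∈ l
        · simp [h, hj, (hi j hj).not_gt]
        · simp [h, hj]
    · rw [← List.sum_map_mul_left]
      congr 1
      refine List.map_congr_left fun k hk => ?_
      rw [siteHom_mul_tensorOp, if_neg hil, mul_one]
      congr 1
      funext j
      rcases eq_or_ne j i with rfl | h
      · simp [hi k hk]
      · simp [h]

/-- Each site to the left contributes `g⁻¹` and each site to the right `g`; with `g = q ^ (±1/2)`
this is the position-dependent power of `q` in `bOp` and `cOp`. -/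
theorem prod_range_step {g x : ℂ} (hg : g ≠ 0) (a n : ℕ) (h : a < n) :
    (∏ j ∈ Finset.range n, if j < a then g⁻¹ else if j = a then x else g) =
      g ^ ((n : ℤ) - 1 - 2 * a) * x := by
  induction n, h using Nat.le_induction with
  | base =>
    rw [Finset.prod_range_succ, if_neg (lt_irrefl a), if_pos rfl,
      Finset.prod_congr rfl fun j hj => if_pos (Finset.mem_range.1 hj), Finset.prod_const,
      Finset.card_range]
    congr 1
    rw [← zpow_natCast, inv_zpow', Nat.succ_eq_add_one]
    congr 1
    push_cast
    ring
  | succ n hn ih =>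
    rw [Finset.prod_range_succ, ih, if_neg (by omega), if_neg (by omega), mul_right_comm,
      ← zpow_add_one₀ hg]
    congr 2
    push_cast
    ring

theorem chainSum_siteHom_smul {g : ℂ} (hg : g ≠ 0) (v : Fin L → ℂ) (κ κ' : Matrix (Fin N) (Fin N) ℂ)
    (F : Fin L → Matrix (Fin N) (Fin N) ℂ) :
    chainSum (fun i => siteHom i (v i • F i)) (fun i => siteHom i (g⁻¹ • κ))
        (fun i => siteHom i (g • κ')) (List.finRange L) =
      ∑ i : Fin L, (g ^ ((L : ℤ) - 1 - 2 * (i : ℕ)) * v i) •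
        tensorOp fun j => if j < i then κ else if j = i then F i else κ' := by
  rw [chainSum_siteHom _ (fun _ => g⁻¹ • κ) (fun _ => g • κ') (List.pairwise_lt_finRange L),
    ← Fin.sum_univ_def]
  refine Finset.sum_congr rfl fun i _ => ?_
  rw [← prod_range_step hg (i : ℕ) L i.2 (x := v i), ← Fin.prod_univ_eq_prod_range
    (fun j => if j < (i : ℕ) then g⁻¹ else if j = i then v i else g) L, ← tensorOp_smul]
  congr 1
  funext j
  simp only [List.mem_finRange, if_true, Fin.val_fin_lt, Fin.val_inj]
  split_ifs with h1 h2
  · rfl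
  · rw [h2]
  · rfl

end Sites

/-! ### Ordered products of two-by-two matrices. -/

section MatrixLists

variable {R ι : Type*} [Ring R]

theorem list_prod_upper (F K K' : ι → R) (l : List ι) :
    (l.map fun i => !![K i, F i; 0, K' i]).prod =
      !![(l.map K).prod, chainSum F K K' l; 0, (l.map K').prod] := by
  induction l with
  | nil => simp [chainSum, Matrix.one_fin_two]
  | cons i l ih =>
    rw [List.map_cons, List.prod_cons, ih, Matrix.mul_fin_two]
    simp [chainSum, add_comm]

theorem list_prod_rev {M M' : ι → Matrix (Fin 2) (Fin 2) R} (h : ∀ i x y, M' i x y = M i x.rev y.rev)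
    (l : List ι) (x y : Fin 2) : (l.map M').prod x y = (l.map M).prod x.rev y.rev := by
  induction l generalizing x y with
  | nil => simp [Matrix.one_apply, Fin.rev_inj]
  | cons i l ih =>
    simp only [List.map_cons, List.prod_cons, Matrix.mul_apply, h, ih]
    exact Equiv.sum_comp Fin.revPerm fun z => M i x.rev z * (l.map M).prod z y.rev

variable [Algebra ℂ R]

/-- Conjugation by one diagonal matrix at all sites: the inner factors telescope and only the outer
indices remain. -/
theorem list_prod_gauge {n : ℂ} (hn : n ≠ 0) (r : ι → ℂ) {M M' : ι → Matrix (Fin 2) (Fin 2) R}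
    (h : ∀ i x y, M' i x y = (r i * n ^ (((x : ℕ) : ℤ) - (y : ℕ))) • M i x y) (l : List ι)
    (x y : Fin 2) : (l.map M').prod x y =
      ((l.map r).prod * n ^ (((x : ℕ) : ℤ) - (y : ℕ))) • (l.map M).prod x y := by
  induction l generalizing x y with
  | nil =>
    rcases eq_or_ne x y with rfl | hxy
    · simp
    · simp [Matrix.one_apply_ne hxy]
  | cons i l ih =>
    simp only [List.map_cons, List.prod_cons, Matrix.mul_apply, h, ih, Finset.smul_sum,
      smul_mul_smul_comm]
    refine Finset.sum_congr rfl fun z _ => ?_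
    rw [mul_mul_mul_comm, ← zpow_add₀ hn, sub_add_sub_cancel]

theorem list_prod_neg (M : ι → Matrix (Fin 2) (Fin 2) R) (l : List ι) :
    (l.map fun i => -M i).prod = (-1 : ℂ) ^ l.length • (l.map M).prod := by
  induction l with
  | nil => simp
  | cons i l ih =>
    rw [List.map_cons, List.prod_cons, ih, List.map_cons, List.prod_cons, List.length_cons,
      pow_succ, mul_smul_comm, neg_mul, mul_neg_one, neg_smul, smul_neg]

end MatrixLists

/-! ### Abstract spin chains, their symmetries and the limits of the monodromy matrix. -/

/-- An inhomogeneous chain of `L` sites, each carrying a representation of `U_p(sl₂)` with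
lowering operator `F i`, raising operator `G i` and group-like elements `κ`, `κ'`. -/
structure SpinChain (N L : ℕ) where
  p : ℂ
  g : ℂ
  κ : Matrix (Fin N) (Fin N) ℂ
  κ' : Matrix (Fin N) (Fin N) ℂ
  F : Fin L → Matrix (Fin N) (Fin N) ℂ
  G : Fin L → Matrix (Fin N) (Fin N) ℂ
  y : Fin L → ℂ

namespace SpinChain

variable {N L : ℕ}

/-- The relations of `U_p(sl₂)` at each site. -/
structure Valid (X : SpinChain N L) : Prop where
  hp : X.p ≠ 0
  hp2 : X.p ^ 2 ≠ 1
  hg : X.g ≠ 0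
  hy : ∀ i, X.y i ≠ 0
  mul_inv : X.κ * X.κ' = 1
  inv_mul : X.κ' * X.κ = 1
  FK : ∀ i, X.F i * X.κ = X.p • (X.κ * X.F i)
  KG : ∀ i, X.κ * X.G i = X.p • (X.G i * X.κ)
  GF : ∀ i, (X.p - X.p⁻¹) • (X.G i * X.F i - X.F i * X.G i) = X.κ ^ 2 - X.κ' ^ 2

/-- The chain with `p` replaced by `p⁻¹`. -/
noncomputable def flip (X : SpinChain N L) : SpinChain N L :=
  ⟨X.p⁻¹, X.g, X.κ', X.κ, X.F, X.G, fun i => (X.y i)⁻¹⟩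

/-- The chain with the roles of the raising and lowering operators exchanged. -/
noncomputable def swap (X : SpinChain N L) : SpinChain N L :=
  ⟨X.p, X.g⁻¹, X.κ', X.κ, X.G, X.F, X.y⟩

theorem flip_swap (X : SpinChain N L) : X.swap.flip = X.flip.swap := rfl

theorem flip_flip (X : SpinChain N L) : X.flip.flip = X := by
  simp [flip]

theorem swap_swap (X : SpinChain N L) : X.swap.swap = X := by
  simp [swap]

theorem Valid.invF {X : SpinChain N L} (h : X.Valid) (i : Fin L) :
    X.κ' * X.F i = X.p • (X.F i * X.κ') := conj_inv_of_mul h.mul_inv h.inv_mul (h.FK i)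

theorem Valid.Ginv {X : SpinChain N L} (h : X.Valid) (i : Fin L) :
    X.G i * X.κ' = X.p • (X.κ' * X.G i) := by
  calc X.G i * X.κ' = X.κ' * (X.κ * X.G i) * X.κ' := by
        rw [← mul_assoc X.κ', h.inv_mul, one_mul]
    _ = X.p • (X.κ' * X.G i) := by
      rw [h.KG, mul_smul_comm, smul_mul_assoc, mul_assoc, mul_assoc, h.mul_inv, mul_one]

theorem Valid.flip {X : SpinChain N L} (h : X.Valid) : X.flip.Valid where
  hp := inv_ne_zero h.hp
  hp2 := by
    change X.p⁻¹ ^ 2 ≠ 1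
    rw [inv_pow]
    exact inv_ne_one.2 h.hp2
  hg := h.hg
  hy i := inv_ne_zero (h.hy i)
  mul_inv := h.inv_mul
  inv_mul := h.mul_inv
  FK i := eq_inv_smul_of_eq_smul h.hp (h.invF i)
  KG i := eq_inv_smul_of_eq_smul h.hp (h.Ginv i)
  GF i := by
    change (X.p⁻¹ - X.p⁻¹⁻¹) • (X.G i * X.F i - X.F i * X.G i) = X.κ' ^ 2 - X.κ ^ 2
    rw [inv_inv, ← neg_sub X.p, neg_smul, h.GF, neg_sub]

theorem Valid.swap {X : SpinChain N L} (h : X.Valid) : X.swap.Valid where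
  hp := h.hp
  hp2 := h.hp2
  hg := inv_ne_zero h.hg
  hy := h.hy
  mul_inv := h.inv_mul
  inv_mul := h.mul_inv
  FK := h.Ginv
  KG := h.invF
  GF i := by
    change (X.p - X.p⁻¹) • (X.F i * X.G i - X.G i * X.F i) = X.κ' ^ 2 - X.κ ^ 2
    rw [← neg_sub (X.G i * X.F i), smul_neg, h.GF, neg_sub]

/-- The `L`-operator at the site `i`. -/
noncomputable def mat (X : SpinChain N L) (t : ℂ) (i : Fin L) : Matrix (Fin 2) (Fin 2) (Op N L) :=
  !![X.g⁻¹ • siteHom i ((X.y i * t) • X.κ - (X.y i * t)⁻¹ • X.κ'),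
      (X.p - X.p⁻¹) • siteHom i (X.F i);
    (X.p - X.p⁻¹) • siteHom i (X.G i),
      X.g • siteHom i ((X.y i * t) • X.κ' - (X.y i * t)⁻¹ • X.κ)]

/-- The monodromy matrix. -/
noncomputable def mono (X : SpinChain N L) (t : ℂ) : Matrix (Fin 2) (Fin 2) (Op N L) :=
  ((List.finRange L).map (X.mat t)).prod

/-- The group-like element of the chain. -/
noncomputable def kOp (X : SpinChain N L) : Op N L :=
  ((List.finRange L).map fun i => siteHom i (X.g⁻¹ • X.κ)).prod

/-- The inverse of the group-like element of the chain. -/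
noncomputable def kOp' (X : SpinChain N L) : Op N L :=
  ((List.finRange L).map fun i => siteHom i (X.g • X.κ')).prod

/-- The lowering operator of the chain. -/
noncomputable def fOp (X : SpinChain N L) : Op N L :=
  chainSum (fun i => siteHom i ((X.y i)⁻¹ • X.F i)) (fun i => siteHom i (X.g⁻¹ • X.κ))
    (fun i => siteHom i (X.g • X.κ')) (List.finRange L)

/-- The normalization of the monodromy matrix. -/
noncomputable def norm (X : SpinChain N L) (t : ℂ) : ℂ := ∏ i, (X.y i * t - (X.y i * t)⁻¹)

theorem kOp_eq (X : SpinChain N L) : X.kOp = X.g⁻¹ ^ L • tensorOp fun _ => X.κ := by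
  rw [kOp, finRange_prod_siteHom, tensorOp_smul, Finset.prod_const, Finset.card_univ,
    Fintype.card_fin]

theorem kOp'_eq (X : SpinChain N L) : X.kOp' = X.g ^ L • tensorOp fun _ => X.κ' := by
  rw [kOp', finRange_prod_siteHom, tensorOp_smul, Finset.prod_const, Finset.card_univ,
    Fintype.card_fin]

theorem mono_swap (X : SpinChain N L) (t : ℂ) (x y : Fin 2) :
    X.swap.mono t x y = X.mono t x.rev y.rev := by
  refine list_prod_rev (fun i x y => ?_) _ x y
  fin_cases x <;> fin_cases y <;> simp [mat, swap]

/-- The flip changes the sign of every `L`-operator. It turns statements at infinity into statements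
at zero. -/
theorem mono_flip (X : SpinChain N L) (t : ℂ) : X.flip.mono t⁻¹ = (-1 : ℂ) ^ L • X.mono t := by
  have : X.flip.mat t⁻¹ = fun i => -X.mat t i := by
    funext i
    simp only [mat, flip, ← mul_inv, inv_inv, Matrix.neg_of, Matrix.neg_cons, Matrix.neg_empty,
      ← smul_neg, ← map_neg, neg_sub]
    simp only [show X.p⁻¹ - X.p = -(X.p - X.p⁻¹) from (neg_sub _ _).symm, neg_smul, map_neg,
      smul_neg]
  rw [mono, this, list_prod_neg, List.length_finRange, mono]

theorem norm_flip (X : SpinChain N L) (t : ℂ) : X.flip.norm t⁻¹ = (-1 : ℂ) ^ L * X.norm t := by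
  rw [norm, norm, ← Fin.prod_const, ← Finset.prod_mul_distrib]
  refine Finset.prod_congr rfl fun i _ => ?_
  simp only [flip, ← mul_inv, inv_inv]
  ring

theorem norm_swap (X : SpinChain N L) (t : ℂ) : X.swap.norm t = X.norm t := rfl

theorem Valid.chainRel_list {X : SpinChain N L} (h : X.Valid) {t : ℂ} (ht : t ≠ 0)
    {l : List (Fin L)} (hl : l.Nodup) :
    ChainRel X.p t ((l.map (X.mat t)).prod 0 0) ((l.map (X.mat t)).prod 0 1)
      ((l.map (X.mat t)).prod 1 0) ((l.map (X.mat t)).prod 1 1)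
      (chainSum (fun i => siteHom i ((X.y i)⁻¹ • X.F i)) (fun i => siteHom i (X.g⁻¹ • X.κ))
        (fun i => siteHom i (X.g • X.κ')) l)
      (l.map fun i => siteHom i (X.g⁻¹ • X.κ)).prod (l.map fun i => siteHom i (X.g • X.κ')).prod := by
  refine ChainRel.list h.hp sitesCommute_range (fun i x y => ?_) (fun i => ⟨_, rfl⟩)
    (fun i => ⟨_, rfl⟩) (fun i => ⟨_, rfl⟩) (fun i => ?_) hl
  · fin_cases x <;> fin_cases y
    exacts [⟨_, map_smul _ X.g⁻¹ _⟩, ⟨_, map_smul _ (X.p - X.p⁻¹) _⟩,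
      ⟨_, map_smul _ (X.p - X.p⁻¹) _⟩, ⟨_, map_smul _ X.g _⟩]
  · have hw : X.y i * t ≠ 0 := mul_ne_zero (h.hy i) ht
    -- The choice of `v` makes `v * w = t` at every site; the induction along the chain needs this
    -- common value.
    have := chainRel_site (R := Op N L) (p := X.p) (v := (X.y i)⁻¹) h.hg hw (κ := siteHom i X.κ)
      (κ' := siteHom i X.κ') (F := siteHom i (X.F i)) (G := siteHom i (X.G i))
      (by rw [← map_mul, h.mul_inv, map_one]) (by rw [← map_mul, h.inv_mul, map_one])
      (by rw [← map_mul, h.FK, map_smul, map_mul]) (by rw [← map_mul, h.KG, map_smul, map_mul])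
      (by simp only [← map_mul, ← map_sub, ← map_smul, ← map_pow, h.GF]) h.hp
    rw [inv_mul_cancel_left₀ (h.hy i)] at this
    simp only [mat, map_smul, map_sub] at this ⊢
    exact this

theorem Valid.chainRel {X : SpinChain N L} (h : X.Valid) {t : ℂ} (ht : t ≠ 0) :
    ChainRel X.p t (X.mono t 0 0) (X.mono t 0 1) (X.mono t 1 0) (X.mono t 1 1) X.fOp X.kOp X.kOp' :=
  h.chainRel_list ht (List.nodup_finRange L)

/-- Normalizing each site and gauging with ratio `t⁻¹ * (p - p⁻¹)` keeps the diagonal and upper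
right entries finite, while the lower left entry is of order `t⁻²`. The limiting product of
triangular matrices is computed by `list_prod_upper`. -/
theorem tendsto_mono {X : SpinChain N L} (h : X.Valid) (x y : Fin 2) :
    Tendsto (fun t => ((X.norm t)⁻¹ * (t⁻¹ * (X.p - X.p⁻¹)) ^ (((x : ℕ) : ℤ) - (y : ℕ))) •
      X.mono t x y) (Bornology.cobounded ℂ)
      (𝓝 ((!![X.kOp, X.fOp; 0, X.kOp'] : Matrix (Fin 2) (Fin 2) (Op N L)) x y)) := by
  have hη : X.p - X.p⁻¹ ≠ 0 := sub_inv_ne_zero_of_sq_ne_one h.hp h.hp2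
  have hw : ∀ i, Tendsto (fun t => (X.y i * t)⁻¹) (Bornology.cobounded ℂ) (𝓝 0) := by
    intro i
    simpa [mul_inv, mul_comm] using tendsto_inv₀_cobounded.const_mul (X.y i)⁻¹
  have hr : ∀ i, Tendsto (fun t => (1 - (X.y i * t)⁻¹ ^ 2)⁻¹) (Bornology.cobounded ℂ) (𝓝 1) := by
    intro i
    have := ((hw i).pow 2).const_sub 1
    simpa using this.inv₀ (by simp)
  have e1 : ∀ w : ℂ, w ≠ 0 → (w - w⁻¹)⁻¹ * w = (1 - w⁻¹ ^ 2)⁻¹ := by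
    intro w hw
    have : w - w⁻¹ = w * (1 - w⁻¹ ^ 2) := by field_simp
    rw [this, mul_inv, mul_right_comm, inv_mul_cancel₀ hw, one_mul]
  have e2 : ∀ w : ℂ, w ≠ 0 → (w - w⁻¹)⁻¹ = w⁻¹ * (1 - w⁻¹ ^ 2)⁻¹ := by
    intro w hw
    rw [← e1 w hw, mul_comm, mul_assoc, mul_inv_cancel₀ hw, mul_one]
  have hne : ∀ᶠ t : ℂ in Bornology.cobounded ℂ, t ≠ 0 :=
    Bornology.eventually_ne_cobounded 0
  have site : ∀ i, Tendsto (fun t => (!![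
      siteHom i (X.g⁻¹ • ((1 - (X.y i * t)⁻¹ ^ 2)⁻¹ • X.κ -
        ((X.y i * t)⁻¹ ^ 2 * (1 - (X.y i * t)⁻¹ ^ 2)⁻¹) • X.κ')),
      siteHom i (((1 - (X.y i * t)⁻¹ ^ 2)⁻¹ * (X.y i)⁻¹) • X.F i);
      siteHom i (((X.p - X.p⁻¹) ^ 2 * t⁻¹ * (X.y i * t)⁻¹ * (1 - (X.y i * t)⁻¹ ^ 2)⁻¹) • X.G i),
      siteHom i (X.g • ((1 - (X.y i * t)⁻¹ ^ 2)⁻¹ • X.κ' -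
        ((X.y i * t)⁻¹ ^ 2 * (1 - (X.y i * t)⁻¹ ^ 2)⁻¹) • X.κ))] :
        Matrix (Fin 2) (Fin 2) (Op N L))) (Bornology.cobounded ℂ)
      (𝓝 !![siteHom i (X.g⁻¹ • X.κ), siteHom i ((X.y i)⁻¹ • X.F i); 0,
        siteHom i (X.g • X.κ')]) := by
    intro i
    have h2 := ((hw i).pow 2).mul (hr i)
    have h3 := ((tendsto_inv₀_cobounded (α := ℂ)).const_mul ((X.p - X.p⁻¹) ^ 2)).mul (hw i) |>.mul (hr i)
    simp only [mul_zero, zero_mul, zero_pow two_ne_zero] at h2 h3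
    simp only [map_smul, map_sub]
    refine tendsto_pi_nhds.2 (Fin.forall_fin_two.2 ⟨tendsto_pi_nhds.2 (Fin.forall_fin_two.2
      ⟨Tendsto.const_smul ?_ X.g⁻¹, ?_⟩), tendsto_pi_nhds.2 (Fin.forall_fin_two.2
      ⟨?_, Tendsto.const_smul ?_ X.g⟩)⟩)
    · simpa using ((hr i).smul_const (siteHom i X.κ)).sub (h2.smul_const (siteHom i X.κ'))
    · simpa using (((hr i).mul_const (X.y i)⁻¹).smul_const (siteHom i (X.F i)))
    · simpa using h3.smul_const (siteHom i (X.G i))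
    · simpa using ((hr i).smul_const (siteHom i X.κ')).sub (h2.smul_const (siteHom i X.κ))
  have lim := tendsto_list_prod (List.finRange L) fun i _ => site i
  rw [list_prod_upper] at lim
  have lim' := tendsto_pi_nhds.1 (tendsto_pi_nhds.1 lim x) y
  refine lim'.congr' ?_
  filter_upwards [hne] with t ht
  have hn : t⁻¹ * (X.p - X.p⁻¹) ≠ 0 := mul_ne_zero (inv_ne_zero ht) hη
  rw [list_prod_gauge hn (fun i => (X.y i * t - (X.y i * t)⁻¹)⁻¹) (M := X.mat t), ← Fin.prod_univ_def,
    Finset.prod_inv_distrib, norm, mono]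
  intro i x y
  have hw0 : X.y i * t ≠ 0 := mul_ne_zero (h.hy i) ht
  have hy : (X.y i)⁻¹ = t * (X.y i * t)⁻¹ := by
    rw [mul_inv, mul_left_comm, mul_inv_cancel₀ ht, mul_one]
  simp only [mat, map_smul, map_sub, ← e1 _ hw0, hy]
  generalize X.y i * t = w at hw0
  generalize (w - w⁻¹)⁻¹ = D
  generalize X.p - X.p⁻¹ = η at hη
  revert x y
  simp only [Fin.forall_fin_two, Matrix.of_apply, Matrix.cons_val', Matrix.cons_val_zero,
    Matrix.cons_val_one, Matrix.cons_val_fin_one, Fin.coe_ofNat_eq_mod, Nat.zero_mod, Nat.one_mod,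
    Nat.cast_zero, Nat.cast_one, sub_zero, sub_self, zero_sub, zpow_zero, zpow_one, zpow_neg_one]
  refine ⟨⟨?_, ?_⟩, ?_, ?_⟩
  all_goals match_scalars <;> field_simp

end SpinChain

/-! ### Serre relations and commutators of the chain operators. -/

theorem qSerre_smul_smul {R : Type*} [Ring R] [Algebra ℂ R] (q a b : ℂ) (E X : R) :
    qSerre q (a • E) (b • X) = (a ^ 3 * b) • qSerre q E X := by
  simp only [qSerre, smul_pow, smul_mul_smul_comm, smul_sub, smul_add]
  match_scalars <;> ring

/-- The `q`-Serre relation in a representation of `U_p(sl₂)`. -/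
theorem qSerre_site {R : Type*} [Ring R] [Algebra ℂ R] {p : ℂ} (hp : p ≠ 0) (hp2 : p ^ 2 ≠ 1)
    {κ κ' F G : R} (h1 : κ * κ' = 1) (h2 : κ' * κ = 1) (hF : F * κ = p • (κ * F))
    (hGF : (p - p⁻¹) • (G * F - F * G) = κ ^ 2 - κ' ^ 2) : qSerre p F G = 0 := by
  have hη : p - p⁻¹ ≠ 0 := sub_inv_ne_zero_of_sq_ne_one hp hp2
  have hF' : F * κ' = p⁻¹ • (κ' * F) := eq_inv_smul_of_eq_smul hp (conj_inv_of_mul h1 h2 hF)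
  -- The polynomial `r ^ 4 - (p ^ 2 + p ^ (-2)) r ^ 2 + 1` vanishes for `r ^ 2 = p ^ 2` and `r ^ 2 =
  -- p ^ (-2)`.
  have kill : ∀ {k : R} {r : ℂ}, r ≠ 0 → (r = p ∨ r = p⁻¹) → F * k = r • (k * F) →
      F ^ 2 * k ^ 2 - (p ^ 2 + (p ^ 2)⁻¹) • (F * k ^ 2 * F) + k ^ 2 * F ^ 2 = 0 := by
    intro k r hr0 hr hk
    have e1 : F * k ^ 2 = r ^ 2 • (k ^ 2 * F) := by
      rw [pow_two, ← mul_assoc, hk, smul_mul_assoc, mul_assoc, hk, mul_smul_comm, smul_smul,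
        ← mul_assoc, ← pow_two]
    have e2 : F ^ 2 * k ^ 2 = r ^ 4 • (k ^ 2 * F ^ 2) := by
      rw [pow_two F, mul_assoc, e1, mul_smul_comm, ← mul_assoc, e1, smul_mul_assoc, smul_smul,
        mul_assoc]
      congr 1
      ring
    rw [e2, e1, smul_mul_assoc, mul_assoc, ← pow_two F]
    match_scalars
    rcases hr with rfl | rfl <;> field_simp <;> ring
  have k1 := kill hp (Or.inl rfl) hF
  have k2 := kill (inv_ne_zero hp) (Or.inr rfl) hF'
  -- One linear factor of the Serre cubic is the ordinary commutator of `F` with `G`, here a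
  -- combination of `κ ^ 2` and `κ' ^ 2`; the two other factors annihilate both.
  have hD : (p - p⁻¹) • qSerre p F G = -(F ^ 2 * (κ ^ 2 - κ' ^ 2) -
      (p ^ 2 + (p ^ 2)⁻¹) • (F * (κ ^ 2 - κ' ^ 2) * F) + (κ ^ 2 - κ' ^ 2) * F ^ 2) := by
    rw [← hGF, qSerre, qInt_three hp hp2]
    simp only [mul_smul_comm, smul_mul_assoc, mul_sub, sub_mul, pow_succ, pow_zero, one_mul, mul_assoc]
    match_scalars <;> field_simp <;> ring
  have : (p - p⁻¹) • qSerre p F G = 0 := by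
    rw [hD, neg_eq_zero]
    calc _ = (F ^ 2 * κ ^ 2 - (p ^ 2 + (p ^ 2)⁻¹) • (F * κ ^ 2 * F) + κ ^ 2 * F ^ 2) -
        (F ^ 2 * κ' ^ 2 - (p ^ 2 + (p ^ 2)⁻¹) • (F * κ' ^ 2 * F) + κ' ^ 2 * F ^ 2) := by
          simp only [mul_sub, sub_mul, smul_sub]
          abel
      _ = 0 := by rw [k1, k2, sub_zero]
  exact (smul_eq_zero.1 this).resolve_left hη

namespace SpinChain

variable {N L : ℕ} {X : SpinChain N L}

theorem tendsto_mono_zero (h : X.Valid) (x y : Fin 2) :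
    Tendsto (fun t => ((X.norm t)⁻¹ * (t * (X.p⁻¹ - X.p)) ^ (((x : ℕ) : ℤ) - (y : ℕ))) •
      X.mono t x y) (𝓝[≠] 0)
      (𝓝 ((!![X.flip.kOp, X.flip.fOp; 0, X.flip.kOp'] : Matrix (Fin 2) (Fin 2) (Op N L)) x y)) := by
  refine ((tendsto_mono h.flip x y).comp tendsto_inv₀_nhdsNE_zero).congr fun t => ?_
  have e : ((-1 : ℂ) ^ L)⁻¹ * (-1) ^ L = 1 := inv_mul_cancel₀ (pow_ne_zero _ (by norm_num))
  simp only [Function.comp_apply, mono_flip, norm_flip, Matrix.smul_apply, smul_smul, inv_inv,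
    mul_inv, show X.flip.p = X.p⁻¹ from rfl]
  congr 1
  rw [mul_right_comm, mul_right_comm _ _ ((-1 : ℂ) ^ L), e, one_mul]

theorem kOp'_mul_flip_kOp (h : X.Valid) : X.kOp' * X.flip.kOp = (tensorOp fun _ => X.κ') ^ 2 := by
  rw [kOp'_eq, kOp_eq, smul_mul_smul_comm]
  change (X.g ^ L * X.g⁻¹ ^ L) • _ = _
  rw [← mul_pow, mul_inv_cancel₀ h.hg, one_pow, one_smul, pow_two]
  rfl

theorem kOp_mul_flip_kOp' (h : X.Valid) : X.kOp * X.flip.kOp' = (tensorOp fun _ => X.κ) ^ 2 := by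
  rw [kOp'_eq, kOp_eq, smul_mul_smul_comm]
  change (X.g⁻¹ ^ L * X.g ^ L) • _ = _
  rw [← mul_pow, inv_mul_cancel₀ h.hg, one_pow, one_smul, pow_two]
  rfl

/-- `X.fOp` commutes with the upper right entry of the monodromy matrix at every nonzero `t`, and
`X.flip.fOp` is the normalized limit of that entry at zero. -/
theorem fOp_flip_commute (h : X.Valid) : X.flip.fOp * X.fOp = X.fOp * X.flip.fOp := by
  have lim := tendsto_mono_zero h 0 1
  refine tendsto_nhds_unique (lim.mul_const X.fOp) ((lim.const_mul X.fOp).congr' ?_)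
  filter_upwards [self_mem_nhdsWithin] with t ht
  rw [smul_mul_assoc, mul_smul_comm, (h.chainRel ht).bF]

/-- The limit `t → 0` of the relation `cF`. The factor `t` on its right side cancels against the
normalization of the lower left entry, and the diagonal entries become group-like. -/
theorem fOp_swap_commutator (h : X.Valid) :
    (X.p⁻¹ - X.p) • (X.flip.swap.fOp * X.fOp - X.fOp * X.flip.swap.fOp) =
      (tensorOp fun _ => X.κ') ^ 2 - (tensorOp fun _ => X.κ) ^ 2 := by
  have hη : X.p⁻¹ - X.p ≠ 0 := by
    rw [← neg_sub]
    exact neg_ne_zero.2 (sub_inv_ne_zero_of_sq_ne_one h.hp h.hp2)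
  have lim := tendsto_mono_zero h.swap 0 1
  have lim0 := tendsto_mono_zero h 0 0
  have lim1 := tendsto_mono_zero h 1 1
  refine tendsto_nhds_unique (((lim.mul_const X.fOp).sub (lim.const_mul X.fOp)).const_smul
    (X.p⁻¹ - X.p)) ?_
  rw [← kOp'_mul_flip_kOp h, ← kOp_mul_flip_kOp' h]
  refine ((lim0.const_mul X.kOp').sub (lim1.const_mul X.kOp)).congr' ?_
  filter_upwards [self_mem_nhdsWithin] with t ht
  replace ht : t ≠ 0 := ht
  have hc := (h.chainRel ht).cF
  simp only [mono_swap, norm_swap, Fin.rev_zero, Fin.reduceLast, Fin.isValue]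
  change _ = (X.p⁻¹ - X.p) • (((X.norm t)⁻¹ * (t * (X.p⁻¹ - X.p)) ^ (-1 : ℤ)) • X.mono t 1 0 * X.fOp -
    X.fOp * ((X.norm t)⁻¹ * (t * (X.p⁻¹ - X.p)) ^ (-1 : ℤ)) • X.mono t 1 0)
  rw [smul_mul_assoc, mul_smul_comm, hc, sub_self, sub_self, zpow_zero, mul_smul_comm, mul_smul_comm, zpow_neg_one]
  generalize X.p⁻¹ - X.p = η at hη
  generalize (X.norm t)⁻¹ = r
  match_scalars <;> field_simp <;> ring

theorem qSerre_fOp (h : X.Valid) : qSerre X.p X.fOp X.swap.fOp = 0 := by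
  have e : X.swap.fOp = chainSum (fun i => siteHom i ((X.y i)⁻¹ • X.G i))
      (fun i => siteHom i (X.g • X.κ')) (fun i => siteHom i (X.g⁻¹ • X.κ)) (List.finRange L) := by
    simp only [fOp, swap, inv_inv]
  have hg := h.hg
  rw [e, fOp]
  refine qSerre_chainSum h.hp h.hp2 sitesCommute_range (fun i => ⟨_, rfl⟩) (fun i => ⟨_, rfl⟩)
    (fun i => ⟨_, rfl⟩) (fun i => ⟨_, rfl⟩) ?_ ?_ ?_ ?_ ?_ ?_ (List.nodup_finRange L)
  · intro i
    rw [← map_mul, smul_mul_smul_comm, inv_mul_cancel₀ hg, one_smul, h.mul_inv, map_one]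
  · intro i
    rw [← map_mul, smul_mul_smul_comm, mul_inv_cancel₀ hg, one_smul, h.inv_mul, map_one]
  · intro i
    rw [← map_mul, ← map_mul, ← map_smul, smul_mul_smul_comm, h.FK, smul_mul_smul_comm,
      smul_comm X.p, mul_comm]
  · intro i
    rw [← map_mul, ← map_mul, ← map_smul, smul_mul_smul_comm, h.Ginv, smul_mul_smul_comm,
      smul_comm X.p, mul_comm]
  · intro l hl
    have r1 := h.chainRel_list one_ne_zero hl
    have r2 := (h.swap.chainRel_list one_ne_zero hl).FK
    simp only [swap, inv_inv] at r2
    exact ⟨r1.mul_inv, r1.inv_mul, r1.FK, r2⟩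
  · intro i
    rw [map_smul, map_smul, qSerre_smul_smul, qSerre_site h.hp h.hp2 (κ := siteHom i X.κ)
      (κ' := siteHom i X.κ'), smul_zero]
    · rw [← map_mul, h.mul_inv, map_one]
    · rw [← map_mul, h.inv_mul, map_one]
    · rw [← map_mul, h.FK, map_smul, map_mul]
    · simp only [← map_mul, ← map_sub, ← map_smul, ← map_pow, h.GF]

end SpinChain

/-! ### The matrices at a single site. -/

section SiteMatrices

variable {N : ℕ} {s c a : ℂ}

theorem epsSign_mul_self (N : ℕ) : epsSign N * epsSign N = 1 := by
  unfold epsSign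
  split_ifs <;> norm_num

theorem ne_zero_of_sq_eq_epsSign (hc : c ^ 2 = epsSign N) : c ≠ 0 := by
  rintro rfl
  have := epsSign_mul_self N
  rw [← hc] at this
  norm_num at this

theorem kHalf_mul (hs : s ≠ 0) (hc : c ≠ 0) (m n : ℤ) :
    kHalf N s c m * kHalf N s c n = kHalf N s c (m + n) := by
  rw [kHalf, kHalf, kHalf, Matrix.diagonal_mul_diagonal]
  congr 1
  funext σ
  rw [zpow_add₀ (mul_ne_zero hc (zpow_ne_zero _ hs))]

theorem kHalf_zero : kHalf N s c 0 = 1 := by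
  simp [kHalf]

theorem fMat_mul_kHalf (hs : s ≠ 0) :
    fMat N s a * kHalf N s c 1 = s ^ 2 • (kHalf N s c 1 * fMat N s a) := by
  ext ρ σ
  simp only [kHalf, Matrix.mul_diagonal, Matrix.diagonal_mul, Matrix.smul_apply, fMat,
    Matrix.of_apply, zpow_one, smul_eq_mul]
  split_ifs with h
  · rw [h, show (N : ℤ) - 1 - 2 * (σ : ℕ) = ((N : ℤ) - 1 - 2 * ((σ : ℕ) + 1 : ℕ)) + (2 : ℕ) by
      push_cast; ring, zpow_add₀ hs, zpow_natCast]
    ring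
  · simp

theorem kHalf_mul_eMat (hs : s ≠ 0) :
    kHalf N s c 1 * eMat N s a = s ^ 2 • (eMat N s a * kHalf N s c 1) := by
  ext ρ σ
  simp only [kHalf, Matrix.mul_diagonal, Matrix.diagonal_mul, Matrix.smul_apply, eMat,
    Matrix.of_apply, zpow_one, smul_eq_mul]
  split_ifs with h
  · rw [← h, show (N : ℤ) - 1 - 2 * (ρ : ℕ) = ((N : ℤ) - 1 - 2 * ((ρ : ℕ) + 1 : ℕ)) + (2 : ℕ) by
      push_cast; ring, zpow_add₀ hs, zpow_natCast]
    ring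
  · simp

theorem eMat_mul_fMat (ha : a ≠ 0) : eMat N s a * fMat N s a = Matrix.diagonal fun σ : Fin N =>
    epsSign N * (qInt (s ^ 2) ((N : ℤ) - 1 - (σ : ℕ)) * qInt (s ^ 2) ((σ : ℕ) + 1)) := by
  ext ρ σ
  rw [Matrix.mul_apply]
  simp only [eMat, fMat, Matrix.of_apply]
  by_cases hσ : (σ : ℕ) + 1 < N
  · rw [Finset.sum_eq_single ⟨(σ : ℕ) + 1, hσ⟩]
    · rcases eq_or_ne ρ σ with rfl | h
      · rw [if_pos rfl, if_pos rfl, Matrix.diagonal_apply_eq]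
        push_cast
        rw [show (N : ℤ) - ((ρ : ℕ) + 1) = (N : ℤ) - 1 - (ρ : ℕ) by ring]
        field_simp
      · rw [if_neg fun h' => h (Fin.ext (Nat.succ_injective h')), zero_mul,
          Matrix.diagonal_apply_ne _ h]
    · intro τ _ hτ
      rw [if_neg fun h' => hτ (Fin.ext h'), mul_zero]
    · exact fun h => absurd (Finset.mem_univ _) h
  · rw [Finset.sum_eq_zero]
    · rcases eq_or_ne ρ σ with rfl | h
      · rw [Matrix.diagonal_apply_eq, show (N : ℤ) - 1 - (ρ : ℕ) = 0 by omega, qInt_zero, zero_mul,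
          mul_zero]
      · rw [Matrix.diagonal_apply_ne _ h]
    · intro τ _
      rw [if_neg (by omega : ¬(τ : ℕ) = σ + 1), mul_zero]

theorem fMat_mul_eMat (ha : a ≠ 0) : fMat N s a * eMat N s a = Matrix.diagonal fun σ : Fin N =>
    epsSign N * (qInt (s ^ 2) ((N : ℤ) - 1 - (σ : ℕ) + 1) * qInt (s ^ 2) (σ : ℕ)) := by
  ext ρ σ
  rw [Matrix.mul_apply]
  simp only [eMat, fMat, Matrix.of_apply]
  by_cases hσ : 0 < (σ : ℕ)
  · rw [Finset.sum_eq_single ⟨(σ : ℕ) - 1, by omega⟩]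
    · rcases eq_or_ne ρ σ with rfl | h
      · rw [if_pos (Nat.sub_add_cancel hσ).symm, if_pos (Nat.sub_add_cancel hσ),
          Matrix.diagonal_apply_eq]
        rw [show (((ρ : ℕ) - 1 : ℕ) : ℤ) + 1 = (ρ : ℕ) by omega,
          show (N : ℤ) - 1 - (ρ : ℕ) + 1 = (N : ℤ) - (ρ : ℕ) by ring]
        field_simp
      · rw [if_neg fun h' => h (Fin.ext (by simp only at h'; omega)), zero_mul,
          Matrix.diagonal_apply_ne _ h]
    · intro τ _ hτ
      rw [if_neg (fun h' => hτ (Fin.ext (by simp only; omega)) : ¬(τ : ℕ) + 1 = σ), mul_zero]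
    · exact fun h => absurd (Finset.mem_univ _) h
  · rw [Finset.sum_eq_zero]
    · rcases eq_or_ne ρ σ with rfl | h
      · rw [Matrix.diagonal_apply_eq, show ((ρ : ℕ) : ℤ) = 0 by omega, qInt_zero, mul_zero,
          mul_zero]
      · rw [Matrix.diagonal_apply_ne _ h]
    · intro τ _
      rw [if_neg (by omega : ¬(τ : ℕ) + 1 = σ), mul_zero]

theorem qInt_exchange {q : ℂ} (hq : q ≠ 0) (hq2 : q ^ 2 ≠ 1) (m n : ℤ) :
    (q - q⁻¹) * (qInt q n * qInt q (m + 1) - qInt q (n + 1) * qInt q m) =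
      q ^ (n - m) - q ^ (-(n - m)) := by
  have hη := sub_inv_ne_zero_of_sq_ne_one hq hq2
  simp only [qInt, neg_sub, neg_add, zpow_add₀ hq, zpow_sub₀ hq, zpow_neg, zpow_one]
  have hm := zpow_ne_zero m hq
  have hn := zpow_ne_zero n hq
  generalize q ^ m = x at hm
  generalize q ^ n = y at hn
  have hη2 : q ^ 2 - 1 ≠ 0 := sub_ne_zero.2 hq2
  field_simp
  ring

/-- Both products are diagonal and `qInt_exchange` gives the difference of their entries. The sign
in `e` appears on the right as `c ^ 2`, and equally as `c ^ (-2)` since it is its own inverse. -/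
theorem eMat_fMat_commutator (hs : s ≠ 0) (hs2 : (s ^ 2) ^ 2 ≠ 1) (hc : c ^ 2 = epsSign N)
    (ha : a ≠ 0) :
    (s ^ 2 - (s ^ 2)⁻¹) • (eMat N s a * fMat N s a - fMat N s a * eMat N s a) =
      kHalf N s c 1 ^ 2 - kHalf N s c (-1) ^ 2 := by
  have hc0 := ne_zero_of_sq_eq_epsSign hc
  have hci : (c⁻¹) ^ 2 = epsSign N := by
    rw [inv_pow, hc]
    exact inv_eq_of_mul_eq_one_left (epsSign_mul_self N)
  rw [eMat_mul_fMat ha, fMat_mul_eMat ha, kHalf, kHalf, Matrix.diagonal_pow,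
    Matrix.diagonal_pow, Matrix.diagonal_sub, Matrix.diagonal_sub, ← Matrix.diagonal_smul]
  congr 1
  funext σ
  simp only [Pi.smul_apply, Pi.pow_apply, smul_eq_mul, ← mul_sub, zpow_one, zpow_neg_one, mul_inv,
    mul_pow, hc, hci, ← zpow_neg]
  rw [mul_left_comm, qInt_exchange (pow_ne_zero 2 hs) hs2]
  simp only [← zpow_natCast, ← zpow_mul]
  congr 3 <;> ring

/-- The `k`th power lives on the `k`th subdiagonal, which is empty for `k = N`. -/
theorem pow_eq_zero_of_shift {A : Matrix (Fin N) (Fin N) ℂ}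
    (hA : ∀ ρ σ : Fin N, (ρ : ℕ) ≠ σ + 1 → A ρ σ = 0) : A ^ N = 0 := by
  have key : ∀ (k : ℕ) (ρ σ : Fin N), (ρ : ℕ) ≠ σ + k → (A ^ k) ρ σ = 0 := by
    intro k
    induction k with
    | zero =>
      intro ρ σ h
      rw [pow_zero, Matrix.one_apply_ne fun h' => h (by rw [h', add_zero])]
    | succ k ih =>
      intro ρ σ h
      rw [pow_succ, Matrix.mul_apply]
      refine Finset.sum_eq_zero fun τ _ => ?_
      by_cases h1 : (ρ : ℕ) = τ + k
      · rw [hA τ σ (by omega), mul_zero]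
      · rw [ih ρ τ h1, zero_mul]
  ext ρ σ
  exact key N ρ σ (by omega)

theorem fMat_pow (N : ℕ) (s a : ℂ) : fMat N s a ^ N = 0 :=
  pow_eq_zero_of_shift fun _ _ h => if_neg h

theorem eMat_pow (N : ℕ) (s a : ℂ) : eMat N s a ^ N = 0 := by
  rw [← Matrix.transpose_inj, Matrix.transpose_pow, Matrix.transpose_zero]
  exact pow_eq_zero_of_shift fun _ _ h => if_neg fun h' => h h'.symm

theorem hMat_mul_fMat : hMat N * fMat N s a = fMat N s a * hMat N + (-2 : ℂ) • fMat N s a := by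
  ext ρ σ
  simp only [hMat, Matrix.mul_diagonal, Matrix.diagonal_mul, Matrix.smul_apply, Matrix.add_apply,
    fMat, Matrix.of_apply, smul_eq_mul]
  split_ifs with h
  · rw [h]
    push_cast
    ring
  · simp

theorem hMat_mul_eMat : hMat N * eMat N s a = eMat N s a * hMat N + (2 : ℂ) • eMat N s a := by
  ext ρ σ
  simp only [hMat, Matrix.mul_diagonal, Matrix.diagonal_mul, Matrix.smul_apply, Matrix.add_apply,
    eMat, Matrix.of_apply, smul_eq_mul]
  split_ifs with h
  · rw [← h]
    push_cast
    ring
  · simp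

theorem hMat_mul_kHalf (m : ℤ) : hMat N * kHalf N s c m = kHalf N s c m * hMat N := by
  rw [hMat, kHalf, Matrix.diagonal_mul_diagonal, Matrix.diagonal_mul_diagonal]
  simp only [mul_comm]

end SiteMatrices

/-! ### The `τ₂`-model as a spin chain; its operators through `flip` and `swap`. -/

/-- The chain of the `τ₂`-model. -/
noncomputable def tauChain (N : ℕ) {L : ℕ} (s c : ℂ) (u α : Fin L → ℂ) : SpinChain N L :=
  ⟨s ^ 2, s, kHalf N s c 1, kHalf N s c (-1), fun i => fMat N s (α i), fun i => eMat N s (α i),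
    fun i => u i * s⟩

section TauChain

variable {N L : ℕ} {s c : ℂ} {u α : Fin L → ℂ}

theorem tauChain_valid (hu : ∀ i, u i ≠ 0) (hα : ∀ i, α i ≠ 0) (hc : c ^ 2 = epsSign N)
    (hs : s ≠ 0) (hs2 : (s ^ 2) ^ 2 ≠ 1) : (tauChain N s c u α).Valid where
  hp := pow_ne_zero 2 hs
  hp2 := hs2
  hg := hs
  hy i := mul_ne_zero (hu i) hs
  mul_inv := (kHalf_mul hs (ne_zero_of_sq_eq_epsSign hc) 1 (-1)).trans kHalf_zero
  inv_mul := (kHalf_mul hs (ne_zero_of_sq_eq_epsSign hc) (-1) 1).trans kHalf_zero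
  FK _ := fMat_mul_kHalf hs
  KG _ := kHalf_mul_eMat hs
  GF i := eMat_fMat_commutator hs hs2 hc (hα i)

theorem monodromy_eq (z : ℂ) : monodromy N s c u α z = (tauChain N s c u α).mono z := by
  rw [monodromy, SpinChain.mono, List.ofFn_eq_map]
  congr 2
  funext i
  rw [lOp, mul_right_comm]
  rfl

theorem mFactor_eq (z : ℂ) : mFactor s u z = (tauChain N s c u α).norm z := by
  refine Finset.prod_congr rfl fun i _ => ?_
  rw [mul_right_comm]
  rfl

theorem bOp_one_eq (hs : s ≠ 0) : bOp N s c u α 1 = (tauChain N s c u α).fOp := by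
  rw [SpinChain.fOp, tauChain, chainSum_siteHom_smul hs, bOp]
  refine Finset.sum_congr rfl fun i _ => ?_
  rw [zpow_neg_one, show (L : ℤ) + 1 - 2 * (((i : ℕ) : ℤ) + 1) = L - 1 - 2 * (i : ℕ) by ring]

theorem bOp_neg_one_eq (hs : s ≠ 0) : bOp N s c u α (-1) = (tauChain N s c u α).flip.fOp := by
  rw [SpinChain.fOp, SpinChain.flip, tauChain, chainSum_siteHom_smul hs, bOp]
  refine Finset.sum_congr rfl fun i _ => ?_
  rw [neg_neg, zpow_one, inv_inv,
    show (L : ℤ) + 1 - 2 * (((i : ℕ) : ℤ) + 1) = L - 1 - 2 * (i : ℕ) by ring]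

theorem cOp_one_eq (hs : s ≠ 0) : cOp N s c u α 1 = (tauChain N s c u α).swap.fOp := by
  rw [SpinChain.fOp, SpinChain.swap, tauChain, chainSum_siteHom_smul (inv_ne_zero hs), cOp]
  refine Finset.sum_congr rfl fun i _ => ?_
  rw [zpow_neg_one, inv_zpow',
    show -((L : ℤ) + 1) + 2 * (((i : ℕ) : ℤ) + 1) = -(L - 1 - 2 * (i : ℕ)) by ring]

theorem cOp_neg_one_eq (hs : s ≠ 0) : cOp N s c u α (-1) = (tauChain N s c u α).flip.swap.fOp := by
  rw [SpinChain.fOp, SpinChain.swap, SpinChain.flip, tauChain,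
    chainSum_siteHom_smul (inv_ne_zero hs), cOp]
  refine Finset.sum_congr rfl fun i _ => ?_
  rw [neg_neg, zpow_one, inv_inv, inv_zpow',
    show -((L : ℤ) + 1) + 2 * (((i : ℕ) : ℤ) + 1) = -(L - 1 - 2 * (i : ℕ)) by ring]

end TauChain

/-! ### The representation of the affine quantum algebra. -/

namespace SpinChain

variable {N L : ℕ} {X : SpinChain N L}

theorem flip_p : X.flip.p = X.p⁻¹ := rfl
theorem flip_κ : X.flip.κ = X.κ' := rfl
theorem flip_κ' : X.flip.κ' = X.κ := rfl
theorem swap_p : X.swap.p = X.p := rfl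
theorem swap_κ : X.swap.κ = X.κ' := rfl
theorem swap_κ' : X.swap.κ' = X.κ := rfl

theorem fOp_mul_tensorOp (h : X.Valid) :
    (X.fOp * tensorOp fun _ => X.κ) = X.p • ((tensorOp fun _ => X.κ) * X.fOp) := by
  have hg : X.g⁻¹ ^ L ≠ 0 := pow_ne_zero _ (inv_ne_zero h.hg)
  have := (h.chainRel one_ne_zero).FK
  rw [kOp_eq, mul_smul_comm, smul_mul_assoc, smul_comm] at this
  exact smul_right_injective _ hg this

theorem tensorOp_mul_inv (h : X.Valid) :
    (tensorOp fun _ => X.κ) * (tensorOp fun _ => X.κ') = (1 : Op N L) := by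
  rw [tensorOp_mul]
  simp only [h.mul_inv, tensorOp_one]

theorem tensorOp_inv_mul (h : X.Valid) :
    (tensorOp fun _ => X.κ') * (tensorOp fun _ => X.κ) = (1 : Op N L) := by
  rw [tensorOp_mul]
  simp only [h.inv_mul, tensorOp_one]

theorem sq_mul_inv_sq (h : X.Valid) :
    (tensorOp fun _ => X.κ) ^ 2 * (tensorOp fun _ => X.κ') ^ 2 = (1 : Op N L) := by
  have hc : Commute (tensorOp fun _ => X.κ : Op N L) (tensorOp fun _ => X.κ') :=
    (tensorOp_mul_inv h).trans (tensorOp_inv_mul h).symm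
  rw [← hc.mul_pow, tensorOp_mul_inv h, one_pow]

theorem inv_sq_mul_sq (h : X.Valid) :
    (tensorOp fun _ => X.κ') ^ 2 * (tensorOp fun _ => X.κ) ^ 2 = (1 : Op N L) :=
  by simpa only [flip_κ, flip_κ'] using sq_mul_inv_sq h.flip

theorem inv_sq_mul_fOp (h : X.Valid) :
    (tensorOp fun _ => X.κ') ^ 2 * X.fOp * (tensorOp fun _ => X.κ) ^ 2 = X.p ^ 2 • X.fOp := by
  have h1 := conj_inv_of_mul (tensorOp_mul_inv h) (tensorOp_inv_mul h) (fOp_mul_tensorOp h)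
  have h4 : (tensorOp fun _ => X.κ') ^ 2 * X.fOp =
      X.p ^ 2 • (X.fOp * (tensorOp fun _ => X.κ') ^ 2) := by
    rw [pow_two, mul_assoc, h1, mul_smul_comm, ← mul_assoc, h1, smul_mul_assoc, smul_smul,
      mul_assoc, ← pow_two]
  rw [h4, smul_mul_assoc, mul_assoc, inv_sq_mul_sq h, mul_one]

theorem sq_mul_fOp (h : X.Valid) :
    (tensorOp fun _ => X.κ) ^ 2 * X.fOp * (tensorOp fun _ => X.κ') ^ 2 = X.p⁻¹ ^ 2 • X.fOp := by
  rw [inv_pow]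
  refine eq_inv_smul_of_eq_smul (pow_ne_zero 2 h.hp) ?_
  calc X.fOp = (tensorOp fun _ => X.κ) ^ 2 * ((tensorOp fun _ => X.κ') ^ 2 * X.fOp *
        (tensorOp fun _ => X.κ) ^ 2) * (tensorOp fun _ => X.κ') ^ 2 := by
        rw [mul_assoc (_ ^ 2) X.fOp, ← mul_assoc (_ ^ 2) (_ ^ 2), sq_mul_inv_sq h, one_mul,
          mul_assoc, sq_mul_inv_sq h, mul_one]
    _ = _ := by rw [inv_sq_mul_fOp h, mul_smul_comm, smul_mul_assoc]

end SpinChain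

section Affine

variable {N L : ℕ} {s c : ℂ} {u α : Fin L → ℂ}

/-- The images of the Chevalley generators of `U_q'(ŝl₂)`. -/
noncomputable def SpinChain.affineGen (X : SpinChain N L) : AffGen → Op N L
  | .e 0 => X.fOp
  | .e 1 => X.swap.fOp
  | .f 0 => X.flip.swap.fOp
  | .f 1 => X.flip.fOp
  | .k 0 => (tensorOp fun _ => X.κ') ^ 2
  | .k 1 => (tensorOp fun _ => X.κ) ^ 2
  | .kinv 0 => (tensorOp fun _ => X.κ) ^ 2
  | .kinv 1 => (tensorOp fun _ => X.κ') ^ 2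

/-- Up to `flip` and `swap` there are only a few cases: the action of the group-likes on `fOp`, the
Serre relation `qSerre_fOp`, and the two commutators `fOp_flip_commute` and `fOp_swap_commutator`.
The flipped relations have `p⁻¹` in place of `p`, which leaves `[3]` unchanged. -/
theorem SpinChain.affineGen_rel {X : SpinChain N L} (h : X.Valid) ⦃x y : FreeAlgebra ℂ AffGen⦄
    (hxy : AffRel X.p x y) :
    FreeAlgebra.lift ℂ X.affineGen x = FreeAlgebra.lift ℂ X.affineGen y := by
  have hη : X.p - X.p⁻¹ ≠ 0 := sub_inv_ne_zero_of_sq_ne_one h.hp h.hp2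
  have p2 : X.p ^ (2 : ℤ) = X.p ^ 2 := by norm_cast
  have pm2 : X.p ^ (-2 : ℤ) = X.p⁻¹ ^ 2 := by rw [zpow_neg, p2, inv_pow]
  have s1 : qSerre X.p X.fOp X.swap.fOp = 0 := qSerre_fOp h
  have s2 : qSerre X.p X.swap.fOp X.fOp = 0 := by
    simpa only [swap_p, swap_swap] using qSerre_fOp h.swap
  have s3 : qSerre X.p⁻¹ X.flip.fOp X.flip.swap.fOp = 0 := by
    simpa only [flip_p] using qSerre_fOp h.flip
  have s4 : qSerre X.p⁻¹ X.flip.swap.fOp X.flip.fOp = 0 := by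
    simpa only [flip_p, swap_p, swap_swap] using qSerre_fOp h.flip.swap
  rw [qSerre] at s1 s2
  rw [qSerre, qInt_inv] at s3 s4
  have t1 := sq_mul_inv_sq h
  have t2 := inv_sq_mul_sq h
  have a1 := inv_sq_mul_fOp h
  have a2 := sq_mul_fOp h
  have b1 : (tensorOp fun _ => X.κ) ^ 2 * X.swap.fOp * (tensorOp fun _ => X.κ') ^ 2 =
    X.p ^ 2 • X.swap.fOp := by
    simpa only [swap_κ, swap_κ', swap_p] using inv_sq_mul_fOp h.swap
  have b2 : (tensorOp fun _ => X.κ') ^ 2 * X.swap.fOp * (tensorOp fun _ => X.κ) ^ 2 =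
    X.p⁻¹ ^ 2 • X.swap.fOp := by
    simpa only [swap_κ, swap_κ', swap_p] using sq_mul_fOp h.swap
  have c1 : (tensorOp fun _ => X.κ) ^ 2 * X.flip.fOp * (tensorOp fun _ => X.κ') ^ 2 =
    X.p⁻¹ ^ 2 • X.flip.fOp := by
    simpa only [flip_κ, flip_κ', flip_p] using inv_sq_mul_fOp h.flip
  have c2 : (tensorOp fun _ => X.κ') ^ 2 * X.flip.fOp * (tensorOp fun _ => X.κ) ^ 2 =
    X.p⁻¹⁻¹ ^ 2 • X.flip.fOp := by
    simpa only [flip_κ, flip_κ', flip_p] using sq_mul_fOp h.flip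
  have d1 : (tensorOp fun _ => X.κ') ^ 2 * X.flip.swap.fOp * (tensorOp fun _ => X.κ) ^ 2 =
    X.p⁻¹ ^ 2 • X.flip.swap.fOp := by
    simpa only [flip_κ, flip_κ', flip_p, swap_κ, swap_κ', swap_p] using
      inv_sq_mul_fOp h.flip.swap
  have d2 : (tensorOp fun _ => X.κ) ^ 2 * X.flip.swap.fOp * (tensorOp fun _ => X.κ') ^ 2 =
    X.p⁻¹⁻¹ ^ 2 • X.flip.swap.fOp := by
    simpa only [flip_κ, flip_κ', flip_p, swap_κ, swap_κ', swap_p] using sq_mul_fOp h.flip.swap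
  rw [inv_inv] at c2 d2
  have e1 := fOp_flip_commute h
  have e2 : X.flip.swap.fOp * X.swap.fOp = X.swap.fOp * X.flip.swap.fOp := by
    simpa only [flip_swap] using fOp_flip_commute h.swap
  have e3 : X.fOp * X.flip.swap.fOp - X.flip.swap.fOp * X.fOp =
      (X.p - X.p⁻¹)⁻¹ • ((tensorOp fun _ => X.κ') ^ 2 - (tensorOp fun _ => X.κ) ^ 2) := by
    rw [← fOp_swap_commutator h, ← neg_sub (X.fOp * _), ← neg_sub X.p, neg_smul_neg, smul_smul,
      inv_mul_cancel₀ hη, one_smul]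
  have e4 : X.swap.fOp * X.flip.fOp - X.flip.fOp * X.swap.fOp =
      (X.p - X.p⁻¹)⁻¹ • ((tensorOp fun _ => X.κ) ^ 2 - (tensorOp fun _ => X.κ') ^ 2) := by
    have := fOp_swap_commutator h.flip
    rw [flip_flip, flip_p, flip_κ, flip_κ'] at this
    rw [← this, inv_inv, smul_smul, inv_mul_cancel₀ hη, one_smul]
  induction hxy with
  | k_kinv i | kinv_k i =>
    revert i
    simp only [Fin.forall_fin_two, AffGen.free, map_mul, FreeAlgebra.lift_ι_apply, map_one, affineGen, t1, t2,
      and_self]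
  | k_k i j =>
    revert i j
    simp only [Fin.forall_fin_two, AffGen.free, map_mul, FreeAlgebra.lift_ι_apply, affineGen, t1,
      t2, and_self]
  | k_e i j | k_f i j =>
    revert i j
    simp only [Fin.forall_fin_two, AffGen.free, map_mul, map_smul, FreeAlgebra.lift_ι_apply,
      affineGen, Fin.isValue, zero_ne_one, one_ne_zero, if_true, if_false, p2, pm2, a1, a2, b1, b2,
      c1, c2, d1, d2, and_self]
  | e_f i j =>
    revert i j
    simp only [Fin.forall_fin_two, AffGen.free, map_mul, map_sub, map_smul, map_zero,
      FreeAlgebra.lift_ι_apply, affineGen, Fin.isValue, zero_ne_one, one_ne_zero, if_true, if_false,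
      e1, e2, e3, e4, sub_self, and_self]
  | serre_e i j hij | serre_f i j hij =>
    revert i j
    simp only [Fin.forall_fin_two, AffGen.free, map_mul, map_sub, map_add, map_pow, map_smul,
      map_zero, FreeAlgebra.lift_ι_apply, affineGen, s1, s2, s3, s4, ne_eq, not_true_eq_false,
      false_implies, implies_true, and_self]

theorem SpinChain.exists_affineHom {X : SpinChain N L} (h : X.Valid) :
    ∃ π : UqAffine X.p →ₐ[ℂ] Op N L, ∀ g, π (UqAffine.gen X.p g) = X.affineGen g := by
  refine ⟨RingQuot.liftAlgHom ℂ ⟨FreeAlgebra.lift ℂ X.affineGen, affineGen_rel h⟩, fun g => ?_⟩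
  rw [UqAffine.gen, RingQuot.liftAlgHom_mkAlgHom_apply, AffGen.free, FreeAlgebra.lift_ι_apply]

theorem aOp_sq_inv (hu : ∀ i, u i ≠ 0) (hα : ∀ i, α i ≠ 0) (hc : c ^ 2 = epsSign N)
    (hs : s ≠ 0) (hs2 : (s ^ 2) ^ 2 ≠ 1) :
    (aOp N L s c ^ 2)⁻¹ = (tensorOp fun _ => kHalf N s c (-1)) ^ 2 :=
  Matrix.inv_eq_left_inv (by
    simpa only [tauChain, aOp] using SpinChain.inv_sq_mul_sq (tauChain_valid hu hα hc hs hs2))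

theorem exists_affine_representation (hu : ∀ i, u i ≠ 0) (hα : ∀ i, α i ≠ 0)
    (hc : c ^ 2 = epsSign N) (hs : s ≠ 0) (hs2 : (s ^ 2) ^ 2 ≠ 1) :
    ∃ π : UqAffine (s ^ 2) →ₐ[ℂ] Op N L,
        π (UqAffine.gen _ (.k 0)) = (aOp N L s c ^ 2)⁻¹ ∧
        π (UqAffine.gen _ (.k 1)) = aOp N L s c ^ 2 ∧
        π (UqAffine.gen _ (.e 0)) = bOp N s c u α 1 ∧
        π (UqAffine.gen _ (.e 1)) = cOp N s c u α 1 ∧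
        π (UqAffine.gen _ (.f 0)) = cOp N s c u α (-1) ∧
        π (UqAffine.gen _ (.f 1)) = bOp N s c u α (-1) := by
  rw [aOp_sq_inv hu hα hc hs hs2, bOp_one_eq hs, bOp_neg_one_eq hs, cOp_one_eq hs,
    cOp_neg_one_eq hs]
  have hgen := SpinChain.exists_affineHom (tauChain_valid hu hα hc hs hs2)
  change ∃ π : UqAffine (s ^ 2) →ₐ[ℂ] Op N L, ∀ g, π (UqAffine.gen (s ^ 2) g) =
    (tauChain N s c u α).affineGen g at hgen
  obtain ⟨π, hπ⟩ := hgen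
  exact ⟨π, hπ _, hπ _, hπ _, hπ _, hπ _, hπ _⟩

theorem tendsto_monodromy (hu : ∀ i, u i ≠ 0) (hα : ∀ i, α i ≠ 0)
    (hc : c ^ 2 = epsSign N) (hs : s ≠ 0) (hs2 : (s ^ 2) ^ 2 ≠ 1) :
    Tendsto (fun z => (mFactor s u z * s ^ (-(L : ℤ)))⁻¹ • monodromy N s c u α z 0 0)
        (Bornology.cobounded ℂ) (𝓝 (aOp N L s c)) ∧
      Tendsto (fun z => (mFactor s u z * s ^ (L : ℤ))⁻¹ • monodromy N s c u α z 1 1)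
        (𝓝[≠] 0) (𝓝 (aOp N L s c)) ∧
      Tendsto (fun z => (mFactor s u z * nFactor s 1 z)⁻¹ • monodromy N s c u α z 0 1)
        (Bornology.cobounded ℂ) (𝓝 (bOp N s c u α 1)) ∧
      Tendsto (fun z => (mFactor s u z * nFactor s (-1) z)⁻¹ • monodromy N s c u α z 0 1)
        (𝓝[≠] 0) (𝓝 (bOp N s c u α (-1))) ∧
      Tendsto (fun z => (mFactor s u z * nFactor s 1 z)⁻¹ • monodromy N s c u α z 1 0)
        (Bornology.cobounded ℂ) (𝓝 (cOp N s c u α 1)) ∧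
      Tendsto (fun z => (mFactor s u z * nFactor s (-1) z)⁻¹ • monodromy N s c u α z 1 0)
        (𝓝[≠] 0) (𝓝 (cOp N s c u α (-1))) := by
  have h := tauChain_valid hu hα hc hs hs2
  have n1 : ∀ z, nFactor s 1 z = z⁻¹ * (s ^ 2 - (s ^ 2)⁻¹) := fun z => by
    rw [nFactor, Int.cast_one, one_mul, zpow_neg_one]
  have n2 : ∀ z, nFactor s (-1) z = z * ((s ^ 2)⁻¹ - s ^ 2) := fun z => by
    rw [nFactor, neg_neg, zpow_one]
    push_cast
    ring
  have hsL : s ^ L ≠ 0 := pow_ne_zero L hs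
  simp only [monodromy_eq, mFactor_eq (N := N) (c := c) (α := α), bOp_one_eq hs, bOp_neg_one_eq hs,
    cOp_one_eq hs, cOp_neg_one_eq hs, n1, n2]
  refine ⟨?_, ?_, ?_, ?_, ?_, ?_⟩
  · have e : aOp N L s c = s ^ L • (tauChain N s c u α).kOp := by
      rw [SpinChain.kOp_eq, smul_smul]
      change _ = (s ^ L * s⁻¹ ^ L) • _
      rw [← mul_pow, mul_inv_cancel₀ hs, one_pow, one_smul]
      rfl
    rw [e]
    refine ((SpinChain.tendsto_mono h 0 0).const_smul (s ^ L)).congr fun z => ?_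
    rw [sub_self, zpow_zero, mul_one, smul_smul, mul_inv, zpow_neg, inv_inv, zpow_natCast, mul_comm]
  · have e : aOp N L s c = s⁻¹ ^ L • (tauChain N s c u α).flip.kOp' := by
      rw [SpinChain.kOp'_eq, smul_smul]
      change _ = (s⁻¹ ^ L * s ^ L) • _
      rw [← mul_pow, inv_mul_cancel₀ hs, one_pow, one_smul]
      rfl
    rw [e]
    refine ((SpinChain.tendsto_mono_zero h 1 1).const_smul (s⁻¹ ^ L)).congr fun z => ?_
    rw [sub_self, zpow_zero, mul_one, smul_smul, mul_inv, zpow_natCast, inv_pow, mul_comm]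
  · refine (SpinChain.tendsto_mono h 0 1).congr fun z => ?_
    rw [mul_inv]
    rw [show (((0 : Fin 2) : ℕ) : ℤ) - ((1 : Fin 2) : ℕ) = -1 from rfl, zpow_neg_one]
    rfl
  · refine (SpinChain.tendsto_mono_zero h 0 1).congr fun z => ?_
    rw [mul_inv]
    rw [show (((0 : Fin 2) : ℕ) : ℤ) - ((1 : Fin 2) : ℕ) = -1 from rfl, zpow_neg_one]
    rfl
  · refine (SpinChain.tendsto_mono h.swap 0 1).congr fun z => ?_
    rw [mul_inv, SpinChain.mono_swap]
    rw [show (((0 : Fin 2) : ℕ) : ℤ) - ((1 : Fin 2) : ℕ) = -1 from rfl, zpow_neg_one]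
    rfl
  · refine (SpinChain.tendsto_mono_zero h.swap 0 1).congr fun z => ?_
    rw [mul_inv, SpinChain.mono_swap]
    rw [show (((0 : Fin 2) : ℕ) : ℤ) - ((1 : Fin 2) : ℕ) = -1 from rfl, zpow_neg_one]
    rfl

end Affine

/-! ### Moving divided powers past the monodromy entries. -/

section DividedRelations

variable {R : Type*} [Ring R] [Algebra ℂ R]

namespace ChainRel

variable {p ζ : ℂ} {a b c d F K K' : R}

/-- Since `b` commutes with `F` and `K` commutes with it up to `p`, all corrections are multiples of
one operator, and their coefficients add up to a `q`-integer. -/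
theorem a_mul_pow (h : ChainRel p ζ a b c d F K K') (hp : p ≠ 0) (hp2 : p ^ 2 ≠ 1) (n : ℕ) :
    a * F ^ (n + 1) = p ^ (n + 1) • (F ^ (n + 1) * a) -
      (ζ * qInt p ((n : ℤ) + 1)) • (F ^ n * (b * K)) := by
  induction n with
  | zero => simpa [qInt_one hp hp2] using h.aF
  | succ n ih =>
    have hKF : K * F = p⁻¹ • (F * K) := eq_inv_smul_of_eq_smul hp h.FK
    have e1 : F ^ n * (b * K) * F = p⁻¹ • (F ^ (n + 1) * (b * K)) := by
      rw [mul_assoc, mul_assoc b, hKF, mul_smul_comm, mul_smul_comm, ← mul_assoc b, h.bF, pow_succ,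
        mul_assoc, mul_assoc]
    have e2 : qInt p (((n + 1 : ℕ) : ℤ) + 1) = p ^ (n + 1) + p⁻¹ * qInt p ((n : ℤ) + 1) := by
      rw [show ((n + 1 : ℕ) : ℤ) + 1 = 1 + ((n + 1 : ℕ) : ℤ) by ring, qInt_add hp, qInt_one hp hp2,
        zpow_natCast, mul_one, zpow_neg_one]
      push_cast
      rfl
    rw [pow_succ F (n + 1), ← mul_assoc, ih, sub_mul, smul_mul_assoc, smul_mul_assoc, e1, mul_assoc,
      h.aF, e2, mul_sub, mul_smul_comm, mul_smul_comm, ← mul_assoc]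
    match_scalars <;> ring

theorem d_mul_pow (h : ChainRel p ζ a b c d F K K') (hp : p ≠ 0) (hp2 : p ^ 2 ≠ 1) (n : ℕ) :
    d * F ^ (n + 1) = p⁻¹ ^ (n + 1) • (F ^ (n + 1) * d) +
      (ζ * qInt p ((n : ℤ) + 1)) • (F ^ n * (b * K')) := by
  have hdF : d * F = p⁻¹ • (F * d) + ζ • (b * K') := by
    rw [eq_inv_smul_of_eq_smul hp h.dF.symm, smul_add, smul_smul, inv_mul_cancel_left₀ hp]
  induction n with
  | zero => simpa [qInt_one hp hp2] using hdF
  | succ n ih =>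
    have e1 : F ^ n * (b * K') * F = p • (F ^ (n + 1) * (b * K')) := by
      rw [mul_assoc, mul_assoc b, h.invF, mul_smul_comm, mul_smul_comm, ← mul_assoc b, h.bF,
        pow_succ, mul_assoc, mul_assoc]
    have e2 : qInt p (((n + 1 : ℕ) : ℤ) + 1) = p⁻¹ ^ (n + 1) + p * qInt p ((n : ℤ) + 1) := by
      rw [qInt_add hp, qInt_one hp hp2, zpow_neg, zpow_natCast, mul_one, zpow_one, inv_pow]
      push_cast
      ring
    rw [pow_succ F (n + 1), ← mul_assoc, ih, add_mul, smul_mul_assoc, smul_mul_assoc, e1, mul_assoc,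
      hdF, e2, mul_add, mul_smul_comm, mul_smul_comm, ← mul_assoc]
    match_scalars <;> ring

/-- The `q`-integer of the corrections cancels against the top factor of `[n + 1]!`, so only the
divided power of order `n` remains. The corrections from `a` and `d` combine to `K - K'`. -/
theorem trace_mul_divPow (h : ChainRel p ζ a b c d F K K') (hp : p ≠ 0) (hp2 : p ^ 2 ≠ 1) {n : ℕ}
    (hn : qFactorial p (n + 1) ≠ 0) :
    (a + d) * divPow p F (n + 1) = p ^ (n + 1) • (divPow p F (n + 1) * a) +
      p⁻¹ ^ (n + 1) • (divPow p F (n + 1) * d) - ζ • (divPow p F n * (b * (K - K'))) := by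
  rw [qFactorial_succ] at hn
  have h1 := left_ne_zero_of_mul hn
  have h2 := right_ne_zero_of_mul hn
  simp only [divPow, mul_smul_comm, smul_mul_assoc, add_mul, h.a_mul_pow hp hp2,
    h.d_mul_pow hp hp2, qFactorial_succ, mul_sub]
  match_scalars <;> field_simp

theorem divPow_mul_K (h : ChainRel p ζ a b c d F K K') (n : ℕ) :
    divPow p F n * K = p ^ n • (K * divPow p F n) := by
  have : F ^ n * K = p ^ n • (K * F ^ n) := by
    induction n with
    | zero => simp
    | succ n ih =>
      rw [pow_succ, mul_assoc, h.FK, mul_smul_comm, ← mul_assoc, ih, smul_mul_assoc, smul_smul,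
        mul_assoc, ← pow_succ']
  rw [divPow, smul_mul_assoc, this, mul_smul_comm, smul_comm]

theorem K'_mul_divPow (h : ChainRel p ζ a b c d F K K') (n : ℕ) :
    K' * divPow p F n = p ^ n • (divPow p F n * K') := by
  have : K' * F ^ n = p ^ n • (F ^ n * K') := by
    induction n with
    | zero => simp
    | succ n ih =>
      rw [pow_succ, ← mul_assoc, ih, smul_mul_assoc, mul_assoc, h.invF, mul_smul_comm, smul_smul,
        mul_assoc, ← pow_succ]
  rw [divPow, mul_smul_comm, this, smul_mul_assoc, smul_comm]

end ChainRel

theorem weight_mul {H x y : R} {r t : ℂ} (hx : H * x = x * H + r • x) (hy : H * y = y * H + t • y) :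
    H * (x * y) = x * y * H + (r + t) • (x * y) := by
  rw [← mul_assoc, hx, add_mul, mul_assoc, hy, mul_add, smul_mul_assoc, mul_smul_comm, ← mul_assoc]
  module

theorem weight_add {H x y : R} {r : ℂ} (hx : H * x = x * H + r • x) (hy : H * y = y * H + r • y) :
    H * (x + y) = (x + y) * H + r • (x + y) := by
  rw [mul_add, hx, hy, add_mul]
  module

theorem weight_divPow {H x : R} {r : ℂ} (hx : H * x = x * H + r • x) (p : ℂ) (n : ℕ) :
    H * divPow p x n = divPow p x n * H + (n * r) • divPow p x n := by
  have : H * x ^ n = x ^ n * H + (n * r) • x ^ n := by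
    induction n with
    | zero => simp
    | succ n ih =>
      rw [pow_succ, weight_mul ih hx, Nat.cast_succ, add_one_mul]
  rw [divPow, mul_smul_comm, this, smul_mul_assoc, smul_add, smul_comm]

theorem weight_list_prod {ι M : Type*} [Monoid M] {H : M} {K : ι → M}
    (hK : ∀ i, H * K i = K i * H) (l : List ι) :
    H * (l.map K).prod = (l.map K).prod * H := by
  refine Commute.list_prod_right _ _ fun x hx => ?_
  obtain ⟨i, _, rfl⟩ := List.mem_map.1 hx
  exact hK i

theorem weight_chainSum {ι : Type*} {H : R} {r : ℂ} {F K K' : ι → R}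
    (hF : ∀ i, H * F i = F i * H + r • F i) (hK : ∀ i, H * K i = K i * H)
    (hK' : ∀ i, H * K' i = K' i * H) (l : List ι) :
    H * chainSum F K K' l = chainSum F K K' l * H + r • chainSum F K K' l := by
  induction l with
  | nil => simp [chainSum]
  | cons i l ih =>
    refine weight_add ?_ ?_
    · have := weight_mul (hF i) (t := 0) (by rw [weight_list_prod hK' l, zero_smul, add_zero])
      rwa [add_zero] at this
    · have := weight_mul (r := 0) (by rw [hK i, zero_smul, add_zero]) ih
      rwa [zero_add] at this

theorem weight_list_matrix {ι : Type*} {H : R} {r : ℂ} {M : ι → Matrix (Fin 2) (Fin 2) R}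
    (hM : ∀ i x y, H * M i x y = M i x y * H + (r * ((y : ℕ) - (x : ℕ))) • M i x y) (l : List ι)
    (x y : Fin 2) :
    H * (l.map M).prod x y = (l.map M).prod x y * H + (r * ((y : ℕ) - (x : ℕ))) • (l.map M).prod x y := by
  induction l generalizing x y with
  | nil =>
    rcases eq_or_ne x y with rfl | hxy
    · simp
    · simp [Matrix.one_apply_ne hxy]
  | cons i l ih =>
    simp only [List.map_cons, List.prod_cons, Matrix.mul_apply, Fin.sum_univ_two]
    refine weight_add ?_ ?_
    all_goals
      convert weight_mul (hM i x _) (ih _ y) using 3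
      ring

end DividedRelations

/-! ### The grading by `H`. -/

section Weights

variable {N L : ℕ}

theorem hOp_mul_siteHom (i : Fin L) {A : Matrix (Fin N) (Fin N) ℂ} {w : ℂ}
    (hA : hMat N * A = A * hMat N + w • A) :
    hOp N L * siteHom i A = siteHom i A * hOp N L + ((N : ℂ)⁻¹ * w) • siteHom i A := by
  rw [← sub_eq_iff_eq_add', hOp, smul_mul_assoc, mul_smul_comm, ← smul_sub, Finset.mul_sum,
    Finset.sum_mul, ← Finset.sum_sub_distrib, Finset.sum_eq_single i, mul_smul]
  · rw [← siteHom_apply, ← map_mul, ← map_mul, ← map_sub, hA, add_sub_cancel_left, map_smul]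
  · intro j _ hj
    rw [← siteHom_apply, siteHom_commute hj, sub_self]
  · exact fun h => absurd (Finset.mem_univ _) h

namespace SpinChain

/-- `F`, `G`, `κ`, `κ'` have weights `w`, `-w`, `0`, `0`. -/
structure Graded (X : SpinChain N L) (w : ℂ) : Prop where
  hF : ∀ i, hMat N * X.F i = X.F i * hMat N + w • X.F i
  hG : ∀ i, hMat N * X.G i = X.G i * hMat N + (-w) • X.G i
  hκ : hMat N * X.κ = X.κ * hMat N
  hκ' : hMat N * X.κ' = X.κ' * hMat N

variable {X : SpinChain N L} {w : ℂ}

theorem Graded.flip (h : X.Graded w) : X.flip.Graded w := ⟨h.hF, h.hG, h.hκ', h.hκ⟩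

theorem Graded.swap (h : X.Graded w) : X.swap.Graded (-w) :=
  ⟨h.hG, by rw [neg_neg]; exact h.hF, h.hκ', h.hκ⟩

theorem Graded.zero_smul {A : Matrix (Fin N) (Fin N) ℂ} (h : hMat N * A = A * hMat N) (r : ℂ)
    (i : Fin L) : hOp N L * siteHom i (r • A) = siteHom i (r • A) * hOp N L := by
  have := hOp_mul_siteHom (L := L) i (A := r • A) (w := 0)
    (by rw [mul_smul_comm, h, smul_mul_assoc, _root_.zero_smul, add_zero])
  rwa [mul_zero, _root_.zero_smul, add_zero] at this

theorem Graded.hOp_mul_fOp (h : X.Graded w) :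
    hOp N L * X.fOp = X.fOp * hOp N L + ((N : ℂ)⁻¹ * w) • X.fOp :=
  weight_chainSum
    (fun i => hOp_mul_siteHom i (by rw [mul_smul_comm, h.hF, smul_add, smul_mul_assoc, smul_comm]))
    (fun i => Graded.zero_smul h.hκ _ i) (fun i => Graded.zero_smul h.hκ' _ i) _

theorem Graded.hOp_mul_kOp (h : X.Graded w) : hOp N L * X.kOp = X.kOp * hOp N L :=
  weight_list_prod (fun i => Graded.zero_smul h.hκ _ i) _

theorem Graded.hOp_mul_kOp' (h : X.Graded w) : hOp N L * X.kOp' = X.kOp' * hOp N L :=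
  weight_list_prod (fun i => Graded.zero_smul h.hκ' _ i) _

theorem Graded.hOp_mul_trace (h : X.Graded w) (t : ℂ) :
    hOp N L * (X.mono t).trace = (X.mono t).trace * hOp N L := by
  have key := weight_list_matrix (H := hOp N L) (r := (N : ℂ)⁻¹ * w) (M := X.mat t) ?_ (List.finRange L)
  · rw [Matrix.trace_fin_two, mul_add, add_mul]
    have h0 := key 0 0
    have h1 := key 1 1
    simp only [sub_self, mul_zero, _root_.zero_smul, add_zero] at h0 h1
    exact congrArg₂ (· + ·) h0 h1
  · intro i x y
    have hk : ∀ a b : ℂ, hMat N * (a • X.κ - b • X.κ') = (a • X.κ - b • X.κ') * hMat N := by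
      intro a b
      rw [mul_sub, sub_mul, mul_smul_comm, mul_smul_comm, smul_mul_assoc, smul_mul_assoc, h.hκ, h.hκ']
    have hk' : ∀ a b : ℂ, hMat N * (a • X.κ' - b • X.κ) = (a • X.κ' - b • X.κ) * hMat N := by
      intro a b
      rw [mul_sub, sub_mul, mul_smul_comm, mul_smul_comm, smul_mul_assoc, smul_mul_assoc, h.hκ, h.hκ']
    revert x y
    simp only [Fin.forall_fin_two, mat, Matrix.of_apply, Matrix.cons_val', Matrix.cons_val_zero,
      Matrix.cons_val_one, Matrix.cons_val_fin_one, Fin.coe_ofNat_eq_mod, Nat.zero_mod, Nat.one_mod,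
      Nat.cast_zero, Nat.cast_one, sub_zero, sub_self, zero_sub, mul_zero, _root_.zero_smul, add_zero,
      mul_one, neg_zero]
    refine ⟨⟨?_, ?_⟩, ?_, ?_⟩
    · rw [← map_smul, Graded.zero_smul (hk _ _)]
    · rw [mul_smul_comm, hOp_mul_siteHom i (h.hF i), smul_add, smul_mul_assoc, smul_comm]
    · rw [mul_smul_comm, hOp_mul_siteHom i (h.hG i), smul_add, smul_mul_assoc, smul_comm, mul_neg,
        mul_neg_one]
    · rw [← map_smul, Graded.zero_smul (hk' _ _)]

end SpinChain

end Weights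

/-! ### Limits of the chain operators at the root of unity. -/

theorem qFactorial_inv (q : ℂ) (n : ℕ) : qFactorial q⁻¹ n = qFactorial q n := by
  simp only [qFactorial, qInt_inv]

/-- A family of chains near `s₀` in which `p` tends to a root of unity without being constant. -/
structure SpinChain.Deformation {N L : ℕ} (X : ℂ → SpinChain N L) (s₀ : ℂ) : Prop where
  two_le : 2 ≤ N
  root : IsPrimitiveRoot ((X s₀).p ^ 2) N
  sign : (X s₀).p ^ N = (-1) ^ (N + 1)
  valid : (X s₀).Valid
  valid' : ∀ᶠ s in 𝓝[≠] s₀, (X s).Valid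
  tendsto_p : Tendsto (fun s => (X s).p) (𝓝[≠] s₀) (𝓝[≠] (X s₀).p)
  tendsto_g : Tendsto (fun s => (X s).g) (𝓝[≠] s₀) (𝓝 (X s₀).g)
  tendsto_κ : Tendsto (fun s => (X s).κ) (𝓝[≠] s₀) (𝓝 (X s₀).κ)
  tendsto_κ' : Tendsto (fun s => (X s).κ') (𝓝[≠] s₀) (𝓝 (X s₀).κ')
  tendsto_F : ∀ i, Tendsto (fun s => (X s).F i) (𝓝[≠] s₀) (𝓝 ((X s₀).F i))
  tendsto_G : ∀ i, Tendsto (fun s => (X s).G i) (𝓝[≠] s₀) (𝓝 ((X s₀).G i))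
  tendsto_y : ∀ i, Tendsto (fun s => (X s).y i) (𝓝[≠] s₀) (𝓝 ((X s₀).y i))
  F_pow : ∀ s i, (X s).F i ^ N = 0
  G_pow : ∀ s i, (X s).G i ^ N = 0

namespace SpinChain.Deformation

variable {N L : ℕ} {X : ℂ → SpinChain N L} {s₀ : ℂ}

theorem flip (h : Deformation X s₀) : Deformation (fun s => (X s).flip) s₀ where
  two_le := h.two_le
  root := by
    rw [flip_p, inv_pow]
    exact h.root.inv
  sign := by
    rw [flip_p, inv_pow, h.sign, ← inv_pow, inv_neg_one]
  valid := h.valid.flip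
  valid' := h.valid'.mono fun _ hs => hs.flip
  tendsto_p := by
    have hp := h.valid.hp
    refine tendsto_nhdsWithin_iff.2 ⟨(h.tendsto_p.mono_right nhdsWithin_le_nhds).inv₀ hp, ?_⟩
    filter_upwards [tendsto_nhdsWithin_iff.1 h.tendsto_p |>.2] with s hs
    exact fun h' => hs (inv_injective h')
  tendsto_g := h.tendsto_g
  tendsto_κ := h.tendsto_κ'
  tendsto_κ' := h.tendsto_κ
  tendsto_F := h.tendsto_F
  tendsto_G := h.tendsto_G
  tendsto_y i := (h.tendsto_y i).inv₀ (h.valid.hy i)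
  F_pow := h.F_pow
  G_pow := h.G_pow

theorem swap (h : Deformation X s₀) : Deformation (fun s => (X s).swap) s₀ where
  two_le := h.two_le
  root := h.root
  sign := h.sign
  valid := h.valid.swap
  valid' := h.valid'.mono fun _ hs => hs.swap
  tendsto_p := h.tendsto_p
  tendsto_g := h.tendsto_g.inv₀ h.valid.hg
  tendsto_κ := h.tendsto_κ'
  tendsto_κ' := h.tendsto_κ
  tendsto_F := h.tendsto_G
  tendsto_G := h.tendsto_F
  tendsto_y := h.tendsto_y
  F_pow := h.G_pow
  G_pow := h.F_pow

theorem tendsto_site {A : ℂ → Matrix (Fin N) (Fin N) ℂ} {A₀ : Matrix (Fin N) (Fin N) ℂ}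
    {f : Filter ℂ} (hA : Tendsto A f (𝓝 A₀)) (i : Fin L) :
    Tendsto (fun s => siteHom i (A s)) f (𝓝 (siteHom i A₀)) :=
  ((siteHom (N := N) i).toLinearMap.continuous_of_finiteDimensional.tendsto A₀).comp hA

theorem tendsto_K (h : Deformation X s₀) (i : Fin L) :
    Tendsto (fun s => siteHom i ((X s).g⁻¹ • (X s).κ)) (𝓝[≠] s₀)
      (𝓝 (siteHom i ((X s₀).g⁻¹ • (X s₀).κ))) :=
  tendsto_site ((h.tendsto_g.inv₀ h.valid.hg).smul h.tendsto_κ) i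

theorem tendsto_K' (h : Deformation X s₀) (i : Fin L) :
    Tendsto (fun s => siteHom i ((X s).g • (X s).κ')) (𝓝[≠] s₀)
      (𝓝 (siteHom i ((X s₀).g • (X s₀).κ'))) :=
  tendsto_site (h.tendsto_g.smul h.tendsto_κ') i

theorem tendsto_kOp (h : Deformation X s₀) :
    Tendsto (fun s => (X s).kOp) (𝓝[≠] s₀) (𝓝 (X s₀).kOp) :=
  tendsto_list_prod _ fun i _ => h.tendsto_K i

theorem tendsto_kOp' (h : Deformation X s₀) :
    Tendsto (fun s => (X s).kOp') (𝓝[≠] s₀) (𝓝 (X s₀).kOp') :=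
  tendsto_list_prod _ fun i _ => h.tendsto_K' i

theorem tendsto_fOp (h : Deformation X s₀) :
    Tendsto (fun s => (X s).fOp) (𝓝[≠] s₀) (𝓝 (X s₀).fOp) :=
  tendsto_chainSum (fun i => tendsto_site
      (((h.tendsto_y i).inv₀ (h.valid.hy i)).smul (h.tendsto_F i)) i) h.tendsto_K h.tendsto_K' _

theorem tendsto_mono (h : Deformation X s₀) {t : ℂ} (ht : t ≠ 0) :
    Tendsto (fun s => (X s).mono t) (𝓝[≠] s₀) (𝓝 ((X s₀).mono t)) := by
  refine tendsto_list_prod _ fun i _ => ?_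
  have hy := (h.tendsto_y i).mul_const t
  have hy' := hy.inv₀ (mul_ne_zero (h.valid.hy i) ht)
  have hp := h.tendsto_p.mono_right nhdsWithin_le_nhds
  have hη := hp.sub (hp.inv₀ h.valid.hp)
  refine tendsto_pi_nhds.2 (Fin.forall_fin_two.2 ⟨tendsto_pi_nhds.2 (Fin.forall_fin_two.2 ⟨?_, ?_⟩),
    tendsto_pi_nhds.2 (Fin.forall_fin_two.2 ⟨?_, ?_⟩)⟩)
  · exact (h.tendsto_g.inv₀ h.valid.hg).smul
      (tendsto_site ((hy.smul h.tendsto_κ).sub (hy'.smul h.tendsto_κ')) i)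
  · exact hη.smul (tendsto_site (h.tendsto_F i) i)
  · exact hη.smul (tendsto_site (h.tendsto_G i) i)
  · exact h.tendsto_g.smul
      (tendsto_site ((hy.smul h.tendsto_κ').sub (hy'.smul h.tendsto_κ)) i)

/-- At one site the factorial `[m]!` stays nonzero for `m < N`, and for `m = N` the divided power is
zero because `F ^ N = 0`. -/
theorem exists_tendsto_divPow (h : Deformation X s₀) {m : ℕ} (hm : m ≤ N) :
    ∃ W, Tendsto (fun s => divPow (X s).p (X s).fOp m) (𝓝[≠] s₀) (𝓝 W) := by
  have hp0 := h.valid.hp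
  refine exists_tendsto_divPow_chainSum (P := fun s => (X s).p) hp0
    (h.tendsto_p.mono_right nhdsWithin_le_nhds) (sitesCommute_range (N := N) (L := L))
    (F := fun i s => siteHom i (((X s).y i)⁻¹ • (X s).F i))
    (K := fun i s => siteHom i ((X s).g⁻¹ • (X s).κ)) (K' := fun i s => siteHom i ((X s).g • (X s).κ'))
    (fun i s => ⟨_, rfl⟩) (fun i s => ⟨_, rfl⟩) (fun i s => ⟨_, rfl⟩) h.tendsto_K h.tendsto_K'
    (fun i m hm => ?_) ?_ ?_ ?_ (List.nodup_finRange L) m hm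
  · rcases hm.lt_or_eq with hm | rfl
    · refine ⟨_, Tendsto.smul (((continuousAt_qFactorial hp0 h.valid.hp2 m).tendsto.comp
        (h.tendsto_p.mono_right nhdsWithin_le_nhds)).inv₀ ?_) ((tendsto_site
          (((h.tendsto_y i).inv₀ (h.valid.hy i)).smul (h.tendsto_F i)) i).pow m)⟩
      exact qFactorial_ne_zero_of_lt hp0 h.two_le h.root hm
    · refine ⟨0, tendsto_const_nhds.congr fun s => ?_⟩
      rw [divPow, ← map_pow, smul_pow, h.F_pow, smul_zero, map_zero, smul_zero]
  · exact (h.tendsto_p.eventually (eventually_qFactorial_ne_zero hp0 N)).mono fun s hs =>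
      ⟨hs.1, hs.2.2⟩
  · refine h.valid'.mono fun s hs i => ?_
    have := (hs.chainRel_list one_ne_zero (List.nodup_singleton i)).FK
    simpa [chainSum] using this
  · exact h.valid'.mono fun s hs l hl => (hs.chainRel_list one_ne_zero hl).invF

theorem serre (h : Deformation X s₀) {Y Z : Op N L}
    (hY : Tendsto (fun s => divPow (X s).p (X s).fOp N) (𝓝[≠] s₀) (𝓝 Y))
    (hZ : Tendsto (fun s => divPow (X s).p (X s).swap.fOp N) (𝓝[≠] s₀) (𝓝 Z)) :
    ⁅Y, ⁅Y, ⁅Y, Z⁆⁆⁆ = 0 := by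
  have := serre_of_tendsto_divPow h.valid.hp h.two_le h.root h.sign h.tendsto_p h.tendsto_fOp hY hZ
    (h.valid'.mono fun s hs => qSerre_fOp hs)
  rw [← this]
  simp only [LieRing.of_associative_ring_bracket, mul_sub, sub_mul, pow_succ, pow_zero, one_mul,
    mul_assoc]
  module

theorem sign_mul_self (h : Deformation X s₀) : (X s₀).p ^ N * (X s₀).p ^ N = 1 := by
  rw [← pow_two, pow_sq_eq_one h.sign]

theorem mul_kOp (h : Deformation X s₀) {Y : Op N L}
    (hY : Tendsto (fun s => divPow (X s).p (X s).fOp N) (𝓝[≠] s₀) (𝓝 Y)) :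
    Y * (X s₀).kOp = (X s₀).p ^ N • ((X s₀).kOp * Y) := by
  have hp := (h.tendsto_p.mono_right nhdsWithin_le_nhds).pow N
  refine tendsto_nhds_unique (hY.mul h.tendsto_kOp) ((hp.smul (h.tendsto_kOp.mul hY)).congr' ?_)
  exact h.valid'.mono fun s hs => ((hs.chainRel one_ne_zero).divPow_mul_K N).symm

theorem kOp'_mul (h : Deformation X s₀) {Y : Op N L}
    (hY : Tendsto (fun s => divPow (X s).p (X s).fOp N) (𝓝[≠] s₀) (𝓝 Y)) :
    (X s₀).kOp' * Y = (X s₀).p ^ N • (Y * (X s₀).kOp') := by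
  have hp := (h.tendsto_p.mono_right nhdsWithin_le_nhds).pow N
  refine tendsto_nhds_unique (h.tendsto_kOp'.mul hY) ((hp.smul (hY.mul h.tendsto_kOp')).congr' ?_)
  exact h.valid'.mono fun s hs => ((hs.chainRel one_ne_zero).K'_mul_divPow N).symm

/-- Limit of `trace_mul_divPow`. As `p ^ N` is a sign, it equals `p ^ (-N)`, so the `a` and `d`
terms recombine to the trace. -/
theorem trace_mul (h : Deformation X s₀) {Y : Op N L}
    (hY : Tendsto (fun s => divPow (X s).p (X s).fOp N) (𝓝[≠] s₀) (𝓝 Y)) {t : ℂ} (ht : t ≠ 0) :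
    ∃ W, ((X s₀).mono t).trace * Y = (X s₀).p ^ N • (Y * ((X s₀).mono t).trace) -
      W * ((X s₀).kOp - (X s₀).kOp') := by
  obtain ⟨n, rfl⟩ : ∃ n, N = n + 1 := ⟨N - 1, by have := h.two_le; omega⟩
  obtain ⟨W, hW⟩ := h.exists_tendsto_divPow n.le_succ
  have hp := h.tendsto_p.mono_right nhdsWithin_le_nhds
  have hm := fun x y => tendsto_pi_nhds.1 (tendsto_pi_nhds.1 (h.tendsto_mono ht) x) y
  refine ⟨t • (W * (X s₀).mono t 0 1), ?_⟩
  have e : (X s₀).p⁻¹ ^ (n + 1) = (X s₀).p ^ (n + 1) := by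
    rw [inv_pow]
    exact inv_eq_of_mul_eq_one_left h.sign_mul_self
  have lim : ((X s₀).mono t 0 0 + (X s₀).mono t 1 1) * Y =
      (X s₀).p ^ (n + 1) • (Y * (X s₀).mono t 0 0) + (X s₀).p⁻¹ ^ (n + 1) • (Y * (X s₀).mono t 1 1) -
        t • (W * ((X s₀).mono t 0 1 * ((X s₀).kOp - (X s₀).kOp'))) := by
    refine tendsto_nhds_unique (((hm 0 0).add (hm 1 1)).mul hY)
      (((((hp.pow _).smul (hY.mul (hm 0 0))).add (((hp.inv₀ h.valid.hp).pow _).smul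
        (hY.mul (hm 1 1)))).sub ((hW.mul ((hm 0 1).mul
          (h.tendsto_kOp.sub h.tendsto_kOp'))).const_smul t)).congr' ?_)
    filter_upwards [h.valid', h.tendsto_p.eventually
      (eventually_qFactorial_ne_zero h.valid.hp (n + 1))] with s hs hq
    exact ((hs.chainRel ht).trace_mul_divPow hs.hp hs.hp2 hq.2.2).symm
  rw [Matrix.trace_fin_two, lim, e, mul_add, smul_add, smul_mul_assoc, mul_assoc]

/-- The factor `1 / N` in `H` is compensated by the `N`th power. -/
theorem hOp_mul {w : ℂ} (h : Deformation X s₀) (hg : ∀ s, (X s).Graded w) {Y : Op N L}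
    (hY : Tendsto (fun s => divPow (X s).p (X s).fOp N) (𝓝[≠] s₀) (𝓝 Y)) :
    ⁅hOp N L, Y⁆ = w • Y := by
  have hN : (N : ℂ) ≠ 0 := by
    have := h.two_le
    exact_mod_cast (by omega : N ≠ 0)
  rw [LieRing.of_associative_ring_bracket, sub_eq_iff_eq_add']
  refine tendsto_nhds_unique (hY.const_mul _) (((hY.mul_const _).add (hY.const_smul w)).congr
    fun s => ?_)
  rw [weight_divPow (hg s).hOp_mul_fOp, mul_inv_cancel_left₀ hN]

end SpinChain.Deformation

/-! ### Operators restricted to a subspace. -/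

section Sectors

variable {N L : ℕ} {W : Submodule ℂ (Config N L → ℂ)}

theorem Preserves.smul {T : Op N L} (h : Preserves W T) (r : ℂ) : Preserves W (r • T) := by
  intro v hv
  rw [Matrix.smul_mulVec]
  exact W.smul_mem r (h v hv)

theorem Preserves.mul {S T : Op N L} (hS : Preserves W S) (hT : Preserves W T) :
    Preserves W (S * T) := by
  intro v hv
  rw [← Matrix.mulVec_mulVec]
  exact hS _ (hT v hv)

/-- `T Y = r Y T` on the subspace `W`. -/
def TwistCommuteOn (W : Submodule ℂ (Config N L → ℂ)) (r : ℂ) (T Y : Op N L) : Prop :=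
  ∀ v ∈ W, T *ᵥ (Y *ᵥ v) = r • (Y *ᵥ (T *ᵥ v))

theorem TwistCommuteOn.smul {r : ℂ} {T Y : Op N L} (h : TwistCommuteOn W r T Y) (a : ℂ) :
    TwistCommuteOn W r (a • T) Y := by
  intro v hv
  rw [Matrix.smul_mulVec, Matrix.smul_mulVec, h v hv, Matrix.mulVec_smul, smul_comm]

/-- A left inverse makes `T` injective on `W`, hence surjective since `W` is finite-dimensional. -/
theorem InvertsOn.exists_eq {R T : Op N L} (hR : InvertsOn W R T) (hT : Preserves W T)
    {w : Config N L → ℂ} (hw : w ∈ W) : ∃ v ∈ W, T *ᵥ v = w := by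
  let f : W →ₗ[ℂ] W := (Matrix.mulVecLin T).restrict hT
  have hf : Function.Injective f := by
    intro a b hab
    have h1 : T *ᵥ (a : Config N L → ℂ) = T *ᵥ b := congrArg Subtype.val hab
    refine Subtype.ext ?_
    rw [← hR a a.2, h1, hR b b.2]
  obtain ⟨v, hv⟩ := LinearMap.injective_iff_surjective.1 hf ⟨w, hw⟩
  exact ⟨v, v.2, congrArg Subtype.val hv⟩

/-- Both `T₁` and `T` pick up the factor `r` when passing `Y`, and `r * r = 1`, so it cancels in `R
* T`. Writing `T v = T₁ x` with `x` in `W` allows `R` to be used as an inverse only on `W`. -/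
theorem InvertsOn.commuteOn {R T₁ T Y : Op N L} {r : ℂ} (hr : r * r = 1)
    (hR : InvertsOn W R T₁) (p₁ : Preserves W T₁) (pT : Preserves W T) (pY : Preserves W Y)
    (h₁ : TwistCommuteOn W r T₁ Y) (hT : TwistCommuteOn W r T Y) : CommuteOn W (R * T) Y := by
  intro v hv
  obtain ⟨x, hx, hxv⟩ := hR.exists_eq p₁ (pT v hv)
  have e1 : Y *ᵥ (T *ᵥ v) = r • (T₁ *ᵥ (Y *ᵥ x)) := by
    rw [← hxv, h₁ x hx, smul_smul, hr, one_smul]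
  rw [LieRing.of_associative_ring_bracket, Matrix.sub_mulVec, sub_eq_zero, ← Matrix.mulVec_mulVec,
    ← Matrix.mulVec_mulVec, ← Matrix.mulVec_mulVec, ← Matrix.mulVec_mulVec, hT v hv, e1, ← hxv,
    hR x hx, smul_smul, hr, one_smul, hR _ (pY x hx)]

/-- The operators that preserve `W` and commute with `M` on `W`. -/
def commutantOn (W : Submodule ℂ (Config N L → ℂ)) (M : Op N L) : LieSubalgebra ℂ (Op N L) where
  carrier := {A | Preserves W A ∧ ∀ v ∈ W, M *ᵥ (A *ᵥ v) = A *ᵥ (M *ᵥ v)}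
  add_mem' := by
    rintro A B ⟨pA, hA⟩ ⟨pB, hB⟩
    refine ⟨fun v hv => ?_, fun v hv => ?_⟩
    · rw [Matrix.add_mulVec]
      exact W.add_mem (pA v hv) (pB v hv)
    · rw [Matrix.add_mulVec, Matrix.add_mulVec, Matrix.mulVec_add, hA v hv, hB v hv]
  zero_mem' := by
    refine ⟨fun v _ => ?_, fun v _ => ?_⟩
    · rw [Matrix.zero_mulVec]
      exact W.zero_mem
    · rw [Matrix.zero_mulVec, Matrix.zero_mulVec, Matrix.mulVec_zero]
  smul_mem' := by
    rintro r A ⟨pA, hA⟩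
    refine ⟨pA.smul r, fun v hv => ?_⟩
    rw [Matrix.smul_mulVec, Matrix.smul_mulVec, Matrix.mulVec_smul, hA v hv]
  lie_mem' := by
    rintro A B ⟨pA, hA⟩ ⟨pB, hB⟩
    refine ⟨fun v hv => ?_, fun v hv => ?_⟩
    · rw [LieRing.of_associative_ring_bracket, Matrix.sub_mulVec]
      exact W.sub_mem (pA.mul pB v hv) (pB.mul pA v hv)
    · rw [LieRing.of_associative_ring_bracket, Matrix.sub_mulVec, Matrix.sub_mulVec,
        Matrix.mulVec_sub, ← Matrix.mulVec_mulVec, ← Matrix.mulVec_mulVec, ← Matrix.mulVec_mulVec,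
        ← Matrix.mulVec_mulVec, hA _ (pB v hv), hB v hv, hB _ (pA v hv), hA v hv]

theorem mem_commutantOn {M A : Op N L} :
    A ∈ commutantOn W M ↔ Preserves W A ∧ CommuteOn W M A := by
  refine and_congr_right fun _ => forall₂_congr fun v _ => ?_
  rw [LieRing.of_associative_ring_bracket, Matrix.sub_mulVec, sub_eq_zero, ← Matrix.mulVec_mulVec,
    ← Matrix.mulVec_mulVec]

theorem LieSubalgebra.map_mem_of_le {𝔩 𝔤 : Type*} [LieRing 𝔩] [LieAlgebra ℂ 𝔩] [LieRing 𝔤]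
    [LieAlgebra ℂ 𝔤] {𝔟 : LieSubalgebra ℂ 𝔩} {x y z : 𝔩} {hx : x ∈ 𝔟} {hy : y ∈ 𝔟} {hz : z ∈ 𝔟}
    (hle : ∀ 𝔠 : LieSubalgebra ℂ 𝔩, x ∈ 𝔠 → y ∈ 𝔠 → z ∈ 𝔠 → 𝔟 ≤ 𝔠) {φ : 𝔟 →ₗ⁅ℂ⁆ 𝔤}
    {𝔠 : LieSubalgebra ℂ 𝔤} (h1 : φ ⟨x, hx⟩ ∈ 𝔠) (h2 : φ ⟨y, hy⟩ ∈ 𝔠) (h3 : φ ⟨z, hz⟩ ∈ 𝔠) (a : 𝔟) :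
    φ a ∈ 𝔠 := by
  refine LieSubalgebra.induction_of_le hx hy hz hle (p := fun a => φ a ∈ 𝔠) h1 h2 h3 ?_ ?_ ?_ ?_ a
  · rw [map_zero]
    exact zero_mem 𝔠
  · intro a b ha hb
    rw [map_add]
    exact add_mem ha hb
  · intro r a ha
    rw [map_smul]
    exact 𝔠.smul_mem r ha
  · intro a b ha hb
    rw [LieHom.map_lie]
    exact 𝔠.lie_mem ha hb

end Sectors

/-! ### The sector on which the group-like element and its inverse agree. -/

namespace SpinChain

variable {N L : ℕ}

theorem swap_kOp (X : SpinChain N L) : X.swap.kOp = X.kOp' := by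
  simp only [kOp, kOp', swap, inv_inv]

theorem swap_kOp' (X : SpinChain N L) : X.swap.kOp' = X.kOp := rfl

theorem trace_swap (X : SpinChain N L) (t : ℂ) : (X.swap.mono t).trace = (X.mono t).trace := by
  rw [Matrix.trace_fin_two, Matrix.trace_fin_two, mono_swap, mono_swap, add_comm]
  rfl

theorem trace_flip (X : SpinChain N L) (t : ℂ) :
    (X.flip.mono t⁻¹).trace = (-1 : ℂ) ^ L • (X.mono t).trace := by
  rw [mono_flip, Matrix.trace_smul]

/-- `W` is the subspace on which the group-like element and its inverse agree. -/
def IsSector (X : SpinChain N L) (W : Submodule ℂ (Config N L → ℂ)) : Prop :=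
  ∀ v, v ∈ W ↔ X.kOp *ᵥ v = X.kOp' *ᵥ v

variable {W : Submodule ℂ (Config N L → ℂ)}

theorem IsSector.swap {X : SpinChain N L} (h : X.IsSector W) : X.swap.IsSector W := by
  intro v
  rw [swap_kOp, swap_kOp', eq_comm, h v]

theorem IsSector.preserves {X : SpinChain N L} (h : X.IsSector W) {Y : Op N L}
    (h1 : Y * X.kOp = X.kOp * Y) (h2 : Y * X.kOp' = X.kOp' * Y) : Preserves W Y := by
  intro v hv
  rw [h] at hv ⊢
  rw [Matrix.mulVec_mulVec, Matrix.mulVec_mulVec, ← h1, ← h2, ← Matrix.mulVec_mulVec,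
    ← Matrix.mulVec_mulVec, hv]

theorem IsSector.preserves_trace {X : SpinChain N L} (h : X.IsSector W) (hX : X.Valid) {t : ℂ}
    (ht : t ≠ 0) : Preserves W (X.mono t).trace := by
  have r := hX.chainRel ht
  rw [Matrix.trace_fin_two]
  refine h.preserves ?_ ?_
  · rw [add_mul, mul_add, r.aK, r.dK]
  · rw [add_mul, mul_add, r.inva, r.invd]

theorem IsSector.preserves_hOp {X : SpinChain N L} (h : X.IsSector W) {w : ℂ} (hw : X.Graded w) :
    Preserves W (hOp N L) :=
  h.preserves hw.hOp_mul_kOp hw.hOp_mul_kOp'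

namespace Deformation

variable {X : ℂ → SpinChain N L} {s₀ : ℂ} {Y Z : Op N L}

theorem preserves (h : Deformation X s₀) (hW : (X s₀).IsSector W)
    (hY : Tendsto (fun s => divPow (X s).p (X s).fOp N) (𝓝[≠] s₀) (𝓝 Y)) : Preserves W Y := by
  intro v hv
  have h1 : (X s₀).kOp * Y = (X s₀).p ^ N • (Y * (X s₀).kOp) := by
    rw [h.mul_kOp hY, smul_smul, h.sign_mul_self, one_smul]
  rw [hW] at hv ⊢
  rw [Matrix.mulVec_mulVec, Matrix.mulVec_mulVec, h1, h.kOp'_mul hY, Matrix.smul_mulVec,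
    Matrix.smul_mulVec, ← Matrix.mulVec_mulVec, ← Matrix.mulVec_mulVec, hv]

/-- The error term of `trace_mul` has `K - K'` as its right factor, which annihilates `W`. -/
theorem twistCommuteOn (h : Deformation X s₀) (hW : (X s₀).IsSector W)
    (hY : Tendsto (fun s => divPow (X s).p (X s).fOp N) (𝓝[≠] s₀) (𝓝 Y)) {t : ℂ} (ht : t ≠ 0) :
    TwistCommuteOn W ((X s₀).p ^ N) ((X s₀).mono t).trace Y := by
  intro v hv
  obtain ⟨V, hV⟩ := h.trace_mul hY ht
  rw [hW] at hv
  rw [Matrix.mulVec_mulVec, hV, Matrix.sub_mulVec, ← Matrix.mulVec_mulVec, Matrix.sub_mulVec, hv,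
    sub_self, Matrix.mulVec_zero, sub_zero, Matrix.smul_mulVec, Matrix.mulVec_mulVec]

/-- The operators that preserve `W` and commute there with a given one form a Lie algebra, so three
generators suffice. The scalar and the changed parameter in `hT` let the flipped chain describe the
same transfer matrix. -/
theorem sector_representation (h : Deformation X s₀) {w : ℂ} (hw : (X s₀).Graded w)
    (hW : (X s₀).IsSector W)
    (hY : Tendsto (fun s => divPow (X s).p (X s).fOp N) (𝓝[≠] s₀) (𝓝 Y))
    (hZ : Tendsto (fun s => divPow (X s).p (X s).swap.fOp N) (𝓝[≠] s₀) (𝓝 Z)) {T : ℂ → Op N L}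
    (hT : ∀ z, z ≠ 0 → ∃ a : ℂ, ∃ t ≠ 0, T z = a • ((X s₀).mono t).trace)
    {𝔩 : Type*} [LieRing 𝔩] [LieAlgebra ℂ 𝔩] {𝔟 : LieSubalgebra ℂ 𝔩} {x y z : 𝔩} {hx : x ∈ 𝔟}
    {hy : y ∈ 𝔟} {hz : z ∈ 𝔟} (hle : ∀ 𝔠 : LieSubalgebra ℂ 𝔩, x ∈ 𝔠 → y ∈ 𝔠 → z ∈ 𝔠 → 𝔟 ≤ 𝔠)
    {φ : 𝔟 →ₗ⁅ℂ⁆ Op N L} (hφ : φ ⟨x, hx⟩ = hOp N L ∧ φ ⟨y, hy⟩ = Z ∧ φ ⟨z, hz⟩ = Y) :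
    (∀ a, Preserves W (φ a)) ∧ (∀ z, z ≠ 0 → Preserves W (T z)) ∧
      ∀ R, InvertsOn W R (T 1) → ∀ z, z ≠ 0 → ∀ a, CommuteOn W (R * T z) (φ a) := by
  obtain ⟨h1, h2, h3⟩ := hφ
  have pH : Preserves W (hOp N L) := hW.preserves_hOp hw
  have pY : Preserves W Y := h.preserves hW hY
  have pZ : Preserves W Z := h.swap.preserves hW.swap hZ
  have pT : ∀ z, z ≠ 0 → Preserves W (T z) := by
    intro z hz
    obtain ⟨a, t, ht, e⟩ := hT z hz
    rw [e]
    exact (hW.preserves_trace h.valid ht).smul a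
  have cY : ∀ z, z ≠ 0 → TwistCommuteOn W ((X s₀).p ^ N) (T z) Y := by
    intro z hz
    obtain ⟨a, t, ht, e⟩ := hT z hz
    rw [e]
    exact (h.twistCommuteOn hW hY ht).smul a
  have cZ : ∀ z, z ≠ 0 → TwistCommuteOn W ((X s₀).p ^ N) (T z) Z := by
    intro z hz
    obtain ⟨a, t, ht, e⟩ := hT z hz
    rw [e, ← trace_swap]
    exact (h.swap.twistCommuteOn hW.swap hZ ht).smul a
  have cH : ∀ z, z ≠ 0 → TwistCommuteOn W 1 (T z) (hOp N L) := by
    intro z hz v _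
    obtain ⟨a, t, ht, e⟩ := hT z hz
    rw [e, one_smul, Matrix.mulVec_mulVec, Matrix.mulVec_mulVec, smul_mul_assoc, mul_smul_comm,
      hw.hOp_mul_trace]
  refine ⟨fun a => ?_, pT, fun R hR z hz a => ?_⟩
  -- With `M = 0` the commutant consists of all operators that preserve `W`.
  · have c0 : ∀ A : Op N L, CommuteOn W 0 A := fun A v _ => by rw [zero_lie, Matrix.zero_mulVec]
    refine (mem_commutantOn.1 (LieSubalgebra.map_mem_of_le hle (hx := hx) (hy := hy) (hz := hz)
      (𝔠 := commutantOn W 0) ?_ ?_ ?_ a)).1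
    · exact mem_commutantOn.2 ⟨h1 ▸ pH, c0 _⟩
    · exact mem_commutantOn.2 ⟨h2 ▸ pZ, c0 _⟩
    · exact mem_commutantOn.2 ⟨h3 ▸ pY, c0 _⟩
  · have p1 := pT 1 one_ne_zero

    refine (mem_commutantOn.1 (LieSubalgebra.map_mem_of_le hle (hx := hx) (hy := hy) (hz := ‹_›)
      (𝔠 := commutantOn W (R * T z)) ?_ ?_ ?_ a)).2
    · rw [h1]
      exact mem_commutantOn.2 ⟨pH, hR.commuteOn (one_mul 1) p1 (pT z hz) pH (cH 1 one_ne_zero)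
        (cH z hz)⟩
    · rw [h2]
      exact mem_commutantOn.2 ⟨pZ, hR.commuteOn h.sign_mul_self p1 (pT z hz) pZ (cZ 1 one_ne_zero)
        (cZ z hz)⟩
    · rw [h3]
      exact mem_commutantOn.2 ⟨pY, hR.commuteOn h.sign_mul_self p1 (pT z hz) pY (cY 1 one_ne_zero)
        (cY z hz)⟩

end Deformation

end SpinChain

/-! ### The root of unity and continuity in `s`. -/

section RootOfUnity

variable {N : ℕ} {q : ℂ}

theorem IsPrimitiveRoot.sq_of_ite (hq : IsPrimitiveRoot q (if Odd N then N else 2 * N)) (hN : N ≠ 0) :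
    IsPrimitiveRoot (q ^ 2) N := by
  split_ifs at hq with h
  · exact hq.pow_of_coprime 2 h.coprime_two_left
  · exact hq.pow (by omega) rfl

theorem IsPrimitiveRoot.pow_of_ite (hq : IsPrimitiveRoot q (if Odd N then N else 2 * N)) (hN : N ≠ 0) :
    q ^ N = (-1) ^ (N + 1) := by
  split_ifs at hq with h
  · rw [hq.pow_eq_one, (h.add_one).neg_one_pow]
  · have h1 : (q ^ N) ^ 2 = 1 := by rw [← pow_mul, mul_comm, hq.pow_eq_one]
    have h2 : q ^ N ≠ 1 := hq.pow_ne_one_of_pos_of_lt hN (by omega)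
    rw [((Nat.not_odd_iff_even.1 h).add_one).neg_one_pow]
    exact (sq_eq_one_iff.1 h1).resolve_left h2

end RootOfUnity

section Continuity

variable {N : ℕ} {s₀ : ℂ}

/-- The equation `s ^ 2 = s₀ ^ 2` has the solutions `±s₀`, and `-s₀` stays away from `s₀`. -/
theorem tendsto_sq_nhdsNE (hs : s₀ ≠ 0) : Tendsto (fun s : ℂ => s ^ 2) (𝓝[≠] s₀) (𝓝[≠] (s₀ ^ 2)) := by
  refine tendsto_nhdsWithin_iff.2 ⟨((continuous_pow 2).tendsto s₀).mono_left nhdsWithin_le_nhds, ?_⟩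
  have hne : s₀ ≠ -s₀ := fun h => hs (self_eq_neg.1 h)
  filter_upwards [self_mem_nhdsWithin,
    (continuousAt_id.eventually_ne hne).filter_mono nhdsWithin_le_nhds] with s h1 h2 h3
  exact (sq_eq_sq_iff_eq_or_eq_neg.1 h3).elim h1 h2

theorem continuousAt_kHalf (hs : s₀ ≠ 0) {c : ℂ} (hc : c ≠ 0) (m : ℤ) :
    ContinuousAt (fun s => kHalf N s c m) s₀ := by
  have : ContinuousAt (fun s => fun σ : Fin N => (c * s ^ ((N : ℤ) - 1 - 2 * (σ : ℕ))) ^ m) s₀ :=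
    continuousAt_pi.2 fun σ => (continuousAt_const.mul (continuousAt_zpow₀ _ _ (Or.inl hs))).zpow₀ _
      (Or.inl (mul_ne_zero hc (zpow_ne_zero _ hs)))
  exact (continuous_id.matrix_diagonal (n := Fin N)).continuousAt.comp this

theorem continuousAt_qInt_sq (hs : s₀ ≠ 0) (hs2 : (s₀ ^ 2) ^ 2 ≠ 1) (n : ℤ) :
    ContinuousAt (fun s => qInt (s ^ 2) n) s₀ :=
  (continuousAt_qInt (pow_ne_zero 2 hs) hs2 n).comp (f := fun s => s ^ 2) (continuous_pow 2).continuousAt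

theorem continuousAt_fMat (hs : s₀ ≠ 0) (hs2 : (s₀ ^ 2) ^ 2 ≠ 1) (a : ℂ) :
    ContinuousAt (fun s => fMat N s a) s₀ := by
  refine continuousAt_pi.2 fun ρ => continuousAt_pi.2 fun σ => ?_
  simp only [fMat, Matrix.of_apply]
  split_ifs
  · exact continuousAt_const.mul (continuousAt_qInt_sq hs hs2 _)
  · exact continuousAt_const

theorem continuousAt_eMat (hs : s₀ ≠ 0) (hs2 : (s₀ ^ 2) ^ 2 ≠ 1) (a : ℂ) :
    ContinuousAt (fun s => eMat N s a) s₀ := by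
  refine continuousAt_pi.2 fun ρ => continuousAt_pi.2 fun σ => ?_
  simp only [eMat, Matrix.of_apply]
  split_ifs
  · exact continuousAt_const.mul (continuousAt_qInt_sq hs hs2 _)
  · exact continuousAt_const

end Continuity

/-! ### The `τ₂`-chain at the root of unity. -/

section TauChainRoot

variable {N L : ℕ} {c s₀ : ℂ} {u α : Fin L → ℂ}

theorem tauChain_deformation (hN : 2 ≤ N) (hu : ∀ i, u i ≠ 0) (hα : ∀ i, α i ≠ 0)
    (hc : c ^ 2 = epsSign N) (hs : s₀ ≠ 0)
    (hs₀ : IsPrimitiveRoot (s₀ ^ 2) (if Odd N then N else 2 * N)) :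
    SpinChain.Deformation (fun s => tauChain N s c u α) s₀ := by
  have hroot := hs₀.sq_of_ite (by omega)
  have hs2 : (s₀ ^ 2) ^ 2 ≠ 1 := hroot.ne_one (by omega)
  have hc0 := ne_zero_of_sq_eq_epsSign hc
  have lim : ∀ {E : Type} [TopologicalSpace E] {A : ℂ → E}, ContinuousAt A s₀ →
      Tendsto A (𝓝[≠] s₀) (𝓝 (A s₀)) := fun h => h.tendsto.mono_left nhdsWithin_le_nhds
  exact
    { two_le := hN
      root := hroot
      sign := hs₀.pow_of_ite (by omega)
      valid := tauChain_valid hu hα hc hs hs2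
      valid' := by
        filter_upwards [eventually_pow_ne_one s₀ (n := 4) (by omega),
          (continuousAt_id.eventually_ne hs).filter_mono nhdsWithin_le_nhds] with s h4 h0
        exact tauChain_valid hu hα hc h0 (by rwa [← pow_mul])
      tendsto_p := tendsto_sq_nhdsNE hs
      tendsto_g := lim continuousAt_id
      tendsto_κ := lim (continuousAt_kHalf hs hc0 1)
      tendsto_κ' := lim (continuousAt_kHalf hs hc0 (-1))
      tendsto_F := fun i => lim (continuousAt_fMat hs hs2 (α i))
      tendsto_G := fun i => lim (continuousAt_eMat hs hs2 (α i))
      tendsto_y := fun i => lim (continuousAt_const.mul continuousAt_id)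
      F_pow := fun s i => fMat_pow N s (α i)
      G_pow := fun s i => eMat_pow N s (α i) }

theorem tauChain_graded (s : ℂ) : (tauChain N s c u α).Graded (-2) where
  hF _ := hMat_mul_fMat
  hG _ := by
    rw [neg_neg]
    exact hMat_mul_eMat
  hκ := hMat_mul_kHalf 1
  hκ' := hMat_mul_kHalf (-1)

/-- Here `K = s ^ (-L) A` and `K' = s ^ L A⁻¹`; they agree on a vector exactly when `A ^ 2` acts on
it as `s ^ (2 L) = q ^ L`. For the flipped chain `A` and `A⁻¹` trade places, which gives `q ^ (-L)`.
-/
theorem tauChain_isSector {s : ℂ} (hu : ∀ i, u i ≠ 0) (hα : ∀ i, α i ≠ 0)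
    (hc : c ^ 2 = epsSign N) (hs : s ≠ 0) (hs2 : (s ^ 2) ^ 2 ≠ 1) :
    (tauChain N s c u α).IsSector (sector N L s c ((s ^ 2) ^ L)) := by
  have h := tauChain_valid hu hα hc hs hs2
  have e : aOp N L s c ^ 2 = (s ^ L • aOp N L s c) * (tauChain N s c u α).kOp := by
    rw [SpinChain.kOp_eq, smul_mul_smul_comm]
    change _ = (s ^ L * s⁻¹ ^ L) • _
    rw [← mul_pow, mul_inv_cancel₀ hs, one_pow, one_smul, pow_two]
    rfl
  have e' : (s ^ 2) ^ L • (1 : Op N L) = (s ^ L • aOp N L s c) * (tauChain N s c u α).kOp' := by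
    rw [SpinChain.kOp'_eq, smul_mul_smul_comm]
    change _ = (s ^ L * s ^ L) • ((tensorOp fun _ => (tauChain N s c u α).κ) *
      tensorOp fun _ => (tauChain N s c u α).κ')
    rw [SpinChain.tensorOp_mul_inv h, ← mul_pow, ← pow_two]
  intro v
  rw [sector, Module.End.mem_eigenspace_iff, Matrix.mulVecLin_apply, e,
    show (s ^ 2) ^ L • v = ((s ^ 2) ^ L • (1 : Op N L)) *ᵥ v by
      rw [Matrix.smul_mulVec, Matrix.one_mulVec], e', ← Matrix.mulVec_mulVec,
    ← Matrix.mulVec_mulVec]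
  refine ⟨fun hv => ?_, fun hv => by rw [hv]⟩
  have hinv : (s⁻¹ ^ L • tensorOp fun _ => (tauChain N s c u α).κ') * (s ^ L • aOp N L s c) = 1 := by
    rw [smul_mul_smul_comm, ← mul_pow, inv_mul_cancel₀ hs, one_pow, one_smul]
    exact SpinChain.tensorOp_inv_mul h
  have := congrArg (fun x => (s⁻¹ ^ L • tensorOp fun _ => (tauChain N s c u α).κ') *ᵥ x) hv
  simpa only [Matrix.mulVec_mulVec, ← mul_assoc, hinv, one_mul] using this

theorem tauChain_flip_isSector {s : ℂ} (hu : ∀ i, u i ≠ 0) (hα : ∀ i, α i ≠ 0)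
    (hc : c ^ 2 = epsSign N) (hs : s ≠ 0) (hs2 : (s ^ 2) ^ 2 ≠ 1) :
    (tauChain N s c u α).flip.IsSector (sector N L s c ((s ^ 2)⁻¹ ^ L)) := by
  have h := tauChain_valid hu hα hc hs hs2
  have e : aOp N L s c ^ 2 = (s⁻¹ ^ L • aOp N L s c) * (tauChain N s c u α).flip.kOp' := by
    rw [SpinChain.kOp'_eq, smul_mul_smul_comm]
    change _ = (s⁻¹ ^ L * s ^ L) • _
    rw [← mul_pow, inv_mul_cancel₀ hs, one_pow, one_smul, pow_two]
    rfl
  have e' : (s ^ 2)⁻¹ ^ L • (1 : Op N L) =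
      (s⁻¹ ^ L • aOp N L s c) * (tauChain N s c u α).flip.kOp := by
    rw [SpinChain.kOp_eq, smul_mul_smul_comm]
    change _ = (s⁻¹ ^ L * s⁻¹ ^ L) • ((tensorOp fun _ => (tauChain N s c u α).κ) *
      tensorOp fun _ => (tauChain N s c u α).κ')
    rw [SpinChain.tensorOp_mul_inv h, ← mul_pow, ← pow_two, inv_pow s]
  intro v
  rw [sector, Module.End.mem_eigenspace_iff, Matrix.mulVecLin_apply, e,
    show (s ^ 2)⁻¹ ^ L • v = ((s ^ 2)⁻¹ ^ L • (1 : Op N L)) *ᵥ v by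
      rw [Matrix.smul_mulVec, Matrix.one_mulVec], e', ← Matrix.mulVec_mulVec,
    ← Matrix.mulVec_mulVec]
  refine ⟨fun hv => ?_, fun hv => by rw [hv]⟩
  have hinv : (s ^ L • tensorOp fun _ => (tauChain N s c u α).κ') * (s⁻¹ ^ L • aOp N L s c) = 1 := by
    rw [smul_mul_smul_comm, ← mul_pow, mul_inv_cancel₀ hs, one_pow, one_smul]
    exact SpinChain.tensorOp_inv_mul h
  have := congrArg (fun x => (s ^ L • tensorOp fun _ => (tauChain N s c u α).κ') *ᵥ x) hv.symm
  simpa only [Matrix.mulVec_mulVec, ← mul_assoc, hinv, one_mul] using this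

theorem transfer_eq (s z : ℂ) : transfer N s c u α z = ((tauChain N s c u α).mono z).trace := by
  rw [transfer, monodromy_eq]

/-- The `q`-factorial is invariant under `q ↦ q⁻¹`, so the flipped chain has the same divided
powers. -/
theorem isDividedPowerLimit_of_tendsto (hs : s₀ ≠ 0) {X : ℂ → SpinChain N L} {B : ℂ → Op N L}
    (hB : ∀ s, s ≠ 0 → B s = (X s).fOp) (hX : ∀ s, (X s).p = s ^ 2 ∨ (X s).p = (s ^ 2)⁻¹) {Y : Op N L}
    (hY : Tendsto (fun s => divPow (X s).p (X s).fOp N) (𝓝[≠] s₀) (𝓝 Y)) :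
    IsDividedPowerLimit s₀ B Y := by
  refine hY.congr' ?_
  filter_upwards [(continuousAt_id.eventually_ne hs).filter_mono nhdsWithin_le_nhds] with s h0
  rw [hB s h0, divPow]
  rcases hX s with h | h
  · rw [h]
  · rw [h, qFactorial_inv]

end TauChainRoot

/-! ### Assembly: the chain itself for `b₊`, the flipped chain for `b₋`. -/

theorem mainTheorem3 (N L : ℕ) (hN : 2 ≤ N)
    (u α : Fin L → ℂ) (hu : ∀ i, u i ≠ 0) (hα : ∀ i, α i ≠ 0)
    (c : ℂ) (hc : c ^ 2 = epsSign N)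
    (s₀ : ℂ) (hs₀ : IsPrimitiveRoot (s₀ ^ 2) (if Odd N then N else 2 * N)) :
    -- generic `q = s ^ 2`: the limits of the monodromy matrix and the quantum affine algebra
    (∀ s : ℂ, s ≠ 0 → (s ^ 2) ^ 2 ≠ 1 →
      Tendsto (fun z => (mFactor s u z * s ^ (-(L : ℤ)))⁻¹ • monodromy N s c u α z 0 0)
        (Bornology.cobounded ℂ) (𝓝 (aOp N L s c)) ∧
      Tendsto (fun z => (mFactor s u z * s ^ (L : ℤ))⁻¹ • monodromy N s c u α z 1 1)
        (𝓝[≠] 0) (𝓝 (aOp N L s c)) ∧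
      Tendsto (fun z => (mFactor s u z * nFactor s 1 z)⁻¹ • monodromy N s c u α z 0 1)
        (Bornology.cobounded ℂ) (𝓝 (bOp N s c u α 1)) ∧
      Tendsto (fun z => (mFactor s u z * nFactor s (-1) z)⁻¹ • monodromy N s c u α z 0 1)
        (𝓝[≠] 0) (𝓝 (bOp N s c u α (-1))) ∧
      Tendsto (fun z => (mFactor s u z * nFactor s 1 z)⁻¹ • monodromy N s c u α z 1 0)
        (Bornology.cobounded ℂ) (𝓝 (cOp N s c u α 1)) ∧
      Tendsto (fun z => (mFactor s u z * nFactor s (-1) z)⁻¹ • monodromy N s c u α z 1 0)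
        (𝓝[≠] 0) (𝓝 (cOp N s c u α (-1))) ∧
      ∃ π : UqAffine (s ^ 2) →ₐ[ℂ] Op N L,
        π (UqAffine.gen _ (.k 0)) = (aOp N L s c ^ 2)⁻¹ ∧
        π (UqAffine.gen _ (.k 1)) = aOp N L s c ^ 2 ∧
        π (UqAffine.gen _ (.e 0)) = bOp N s c u α 1 ∧
        π (UqAffine.gen _ (.e 1)) = cOp N s c u α 1 ∧
        π (UqAffine.gen _ (.f 0)) = cOp N s c u α (-1) ∧
        π (UqAffine.gen _ (.f 1)) = bOp N s c u α (-1)) ∧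
    -- the divided powers in the limit `ε q^N → 1`
    ∃ Bp Bm Cp Cm : Op N L,
      IsDividedPowerLimit s₀ (fun s => bOp N s c u α 1) Bp ∧
      IsDividedPowerLimit s₀ (fun s => bOp N s c u α (-1)) Bm ∧
      IsDividedPowerLimit s₀ (fun s => cOp N s c u α 1) Cp ∧
      IsDividedPowerLimit s₀ (fun s => cOp N s c u α (-1)) Cm ∧
      -- the representation of `b₊` and the sector `A² = q^L`
      (∃ φ : borelPlus →ₗ⁅ℂ⁆ Op N L,
        ExtendsPlus φ (hOp N L) Cp Bp ∧
        (∀ ψ : borelPlus →ₗ⁅ℂ⁆ Op N L, ExtendsPlus ψ (hOp N L) Cp Bp → ψ = φ) ∧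
        (∀ x, Preserves (sector N L s₀ c ((s₀ ^ 2) ^ L)) (φ x)) ∧
        (∀ z : ℂ, z ≠ 0 →
          Preserves (sector N L s₀ c ((s₀ ^ 2) ^ L)) (transfer N s₀ c u α z)) ∧
        ∀ R : Op N L,
          InvertsOn (sector N L s₀ c ((s₀ ^ 2) ^ L)) R (transfer N s₀ c u α 1) →
          ∀ z : ℂ, z ≠ 0 → ∀ x : borelPlus,
            CommuteOn (sector N L s₀ c ((s₀ ^ 2) ^ L)) (R * transfer N s₀ c u α z) (φ x)) ∧
      -- the representation of `b₋` and the sector `A² = q^{-L}`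
      (∃ φ : borelMinus →ₗ⁅ℂ⁆ Op N L,
        ExtendsMinus φ (hOp N L) Cm Bm ∧
        (∀ ψ : borelMinus →ₗ⁅ℂ⁆ Op N L, ExtendsMinus ψ (hOp N L) Cm Bm → ψ = φ) ∧
        (∀ x, Preserves (sector N L s₀ c ((s₀ ^ 2)⁻¹ ^ L)) (φ x)) ∧
        (∀ z : ℂ, z ≠ 0 →
          Preserves (sector N L s₀ c ((s₀ ^ 2)⁻¹ ^ L)) (transfer N s₀ c u α z)) ∧
        ∀ R : Op N L,
          InvertsOn (sector N L s₀ c ((s₀ ^ 2)⁻¹ ^ L)) R (transfer N s₀ c u α 1) →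
          ∀ z : ℂ, z ≠ 0 → ∀ x : borelMinus,
            CommuteOn (sector N L s₀ c ((s₀ ^ 2)⁻¹ ^ L)) (R * transfer N s₀ c u α z) (φ x)) := by
  have hs : s₀ ≠ 0 := by
    rintro rfl
    have h1 := hs₀.pow_eq_one
    rw [zero_pow two_ne_zero, zero_pow (by split_ifs <;> omega)] at h1
    exact zero_ne_one h1
  have hs2 : (s₀ ^ 2) ^ 2 ≠ 1 := (hs₀.sq_of_ite (by omega)).ne_one (by omega)
  refine ⟨fun s h0 h2 => ?_, ?_⟩
  · obtain ⟨h1, h2, h3, h4, h5, h6⟩ := tendsto_monodromy hu hα hc h0 h2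
    exact ⟨h1, h2, h3, h4, h5, h6, exists_affine_representation hu hα hc h0 ‹_›⟩
  have hD := tauChain_deformation hN hu hα hc hs hs₀
  have hw := tauChain_graded (N := N) (c := c) (u := u) (α := α)
  obtain ⟨Bp, hBp⟩ := hD.exists_tendsto_divPow le_rfl
  obtain ⟨Bm, hBm⟩ := hD.flip.exists_tendsto_divPow le_rfl
  obtain ⟨Cp, hCp⟩ := hD.swap.exists_tendsto_divPow le_rfl
  obtain ⟨Cm, hCm⟩ := hD.flip.swap.exists_tendsto_divPow le_rfl
  refine ⟨Bp, Bm, Cp, Cm,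
    isDividedPowerLimit_of_tendsto hs (fun s h0 => bOp_one_eq h0) (fun s => Or.inl rfl) hBp,
    isDividedPowerLimit_of_tendsto hs (fun s h0 => bOp_neg_one_eq h0) (fun s => Or.inr rfl) hBm,
    isDividedPowerLimit_of_tendsto hs (fun s h0 => cOp_one_eq h0) (fun s => Or.inl rfl) hCp,
    isDividedPowerLimit_of_tendsto hs (fun s h0 => cOp_neg_one_eq h0) (fun s => Or.inr rfl) hCm,
    ?_, ?_⟩
  · obtain ⟨φ, hφ⟩ := exists_lieHom_borelPlus (hOp N L) Cp Bp
      (by rw [hD.swap.hOp_mul (fun s => (hw s).swap) hCp, neg_neg])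
      (by rw [hD.hOp_mul hw hBp, neg_smul])
      (hD.swap.serre hCp (by simpa only [SpinChain.swap_swap, SpinChain.swap_p] using hBp)) (hD.serre hBp hCp)
    obtain ⟨h1, h2, h3⟩ := hD.sector_representation (hw s₀) (tauChain_isSector hu hα hc hs hs2)
      hBp hCp (T := transfer N s₀ c u α)
      (fun z hz => ⟨1, z, hz, by rw [transfer_eq, one_smul]⟩)
      (fun 𝔠 h0 he hf => borelPlus_le h0 he hf) hφ
    refine ⟨φ, hφ, fun ψ hψ => ?_, h1, h2, h3⟩
    exact LieSubalgebra.lieHom_ext_of_le _ _ _ (fun 𝔠 h0 he hf => borelPlus_le h0 he hf)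
      (hψ.1.trans hφ.1.symm) (hψ.2.1.trans hφ.2.1.symm) (hψ.2.2.trans hφ.2.2.symm)
  · obtain ⟨φ, hφ⟩ := exists_lieHom_borelMinus (hOp N L) Cm Bm
      (by rw [hD.flip.swap.hOp_mul (fun s => (hw s).flip.swap) hCm, neg_neg])
      (by rw [hD.flip.hOp_mul (fun s => (hw s).flip) hBm, neg_smul])
      (hD.flip.swap.serre hCm (by simpa only [SpinChain.swap_swap, SpinChain.swap_p] using hBm))
      (hD.flip.serre hBm hCm)
    obtain ⟨h1, h2, h3⟩ := hD.flip.sector_representation (hw s₀).flip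
      (tauChain_flip_isSector hu hα hc hs hs2) hBm hCm (T := transfer N s₀ c u α)
      -- The flipped chain reproduces the transfer matrix at the inverse parameter, with one sign
      -- per site.
      (fun z hz => ⟨(-1) ^ L, z⁻¹, inv_ne_zero hz, by
        rw [transfer_eq, SpinChain.trace_flip, smul_smul, ← mul_pow, neg_one_mul, neg_neg, one_pow,
          one_smul]⟩)
      (fun 𝔠 h0 he hf => borelMinus_le h0 he hf) hφ
    refine ⟨φ, hφ, fun ψ hψ => ?_, h1, h2, h3⟩
    exact LieSubalgebra.lieHom_ext_of_le _ _ _ (fun 𝔠 h0 he hf => borelMinus_le h0 he hf)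
      (hψ.1.trans hφ.1.symm) (hψ.2.1.trans hφ.2.1.symm) (hψ.2.2.trans hφ.2.2.symm)
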